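/- **Lemma (Capacity equivalence).** Let $M_1,M_2$ be compact connected smooth Riemannian manifolds with (possibly empty) smooth boundary, of dimensions $n_1\ge n_2\ge 1$, with Riemannian distances $d_1,d_2$, both smoothly embedded in a Euclidean space $\mathbb R^m$ (their Riemannian metrics need not be the induced ones). Put $X=M_1\cup M_2$ and $L=M_1\cap M_2$. Assume that $L\neq\emptyset$, that $L$ lies in the interior of both manifolds, that $L$ is a smooth embedded manifold of dimension $k=n_2-1$, and that $M_1$ and $M_2$ are transversal: there are an embedded smooth manifold $P\subseteq\mathbb R^m$ and an open $U\supseteq L$ with $M_i\cap U\subseteq P$ for $i=1,2$ and $T_xM_1+T_xM_2=T_xP$ for all $x\in L$. Let $d$ be the glued distance on $X$, $$d(x,y)=\inf\Big\{\sum_{i=0}^{l-1}\widetilde d(x_i,x_{i+1}) : x_0=x,\ x_l=y\Big\},$$ where $\widetilde d(x,y)$ is $\min(d_1(x,y),d_2(x,y))$ if $x,y\in L$; otherwise $d_i(x,y)$ if $x,y\in M_i$ for exactly one $i$, and $\infty$ if there is no such $i$. Let $B_r(x)$ denote the open balls of $d$, and let $L_R=\bigcup_{x\in L}B_R(x)$.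 Let $\omega_i>0$ be a weight on $M_i$ in the Muckenhoupt class $A_2(M_i)$, i.e. there is $C$ with $$\frac1{\mathrm{vol}(B)}\int_B\omega_i\,d\mathrm{vol}_{M_i}\cdot\frac1{\mathrm{vol}(B)}\int_B\frac1{\omega_i}\,d\mathrm{vol}_{M_i}\le C$$ for all balls $B$ of $(M_i,d_i)$. Assume that $\omega_2$ is bounded from above and from below by positive constants and that $\omega_1$ is bounded above in a neighbourhood of $\partial M_1$. Let $\mu_i=\omega_i\cdot\mathrm{vol}_{M_i}$ and $\mu=\mu_1+\mu_2$ on $X$. Assume that $\mu(L)=0$ and that there is $N\in L^1_{loc}([0,\infty))$ with $$\mu(B_{3r}(x))\le N(2r)\,\mu(B_r(x))\qquad\text{for all }x\in X,\ r>0 .$$ For compact $K\subseteq M_i$ and relatively open $\Omega\subseteq M_i$ let $$\mathrm{Cap}_{2,\mu_i}(K,\Omega)=\inf\Big\{\int_\Omega|\nabla u|^2\,d\mu_i : u\in \mathrm{Lip}_{\mathcal E_i}(M_i)\cap C_c(\Omega),\ u\ge\chi_K\Big\},$$ where $\mathrm{Lip}_{\mathcal E_i}(M_i)$ is the set of those $u$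 in the closure of $C^\infty(M_i)$ under the norm $\big(\|u\|_{L^2(\mu_i)}^2+\int_{M_i}|\nabla u|^2d\mu_i\big)^{1/2}$ for which $|\nabla u|$ (extended to the closure by continuity) is essentially bounded. Then there is $R>0$ such that $$\mathrm{Cap}_{2,\mu_1}(L,L_R\cap M_1)>0\quad\text{and}\quad \mathrm{Cap}_{2,\mu_2}(L,L_R\cap M_2)>0 .$$ -/

import Mathlib

open MeasureTheory Set Filter Topology Bundle Manifold
open scoped ENNReal NNReal ContDiff

noncomputable section

namespace GluedManifold

/-! ### Volume and Muckenhoupt weights -/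

section Weights

variable {M : Type*} [MetricSpace M] [MeasurableSpace M] [BorelSpace M]

/-- The Riemannian volume measure of an `n`-dimensional Riemannian manifold whose metric is the
Riemannian distance: the `n`-dimensional Hausdorff measure, normalised so that it agrees with
Lebesgue measure on `n`-dimensional Euclidean space. -/
def vol (M : Type*) [MetricSpace M] [MeasurableSpace M] [BorelSpace M] (n : ℕ) : Measure M :=
  μHE[n]

/-- The weighted volume measure `w · vol_M`. -/
def weightedVol (n : ℕ) (w : M → ℝ) : Measure M :=
  (vol M n).withDensity (fun x => ENNReal.ofReal (w x))

/-- `w` is a positive weight in the Muckenhoupt class `A₂(M)`: the product of the averages of `w`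
and of `1/w` over metric balls of `M` is bounded, uniformly over all balls. The averages are taken
in `[0, ∞]`, so that local integrability of `w` and of `1/w` is part of the condition. -/
def IsMuckenhouptA2 (n : ℕ) (w : M → ℝ) : Prop :=
  Measurable w ∧ (∀ᵐ x ∂vol M n, 0 < w x) ∧
    ∃ C : ℝ≥0, ∀ (x : M) (r : ℝ), 0 < r →
      (⨍⁻ y in Metric.ball x r, ENNReal.ofReal (w y) ∂vol M n) *
        (⨍⁻ y in Metric.ball x r, (ENNReal.ofReal (w y))⁻¹ ∂vol M n) ≤ C

end Weights

/-! ### The energy form of a weighted manifold and relative capacities -/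

section Capacity

variable {n : ℕ} [NeZero n]
  {M : Type*} [MetricSpace M] [ChartedSpace (EuclideanHalfSpace n) M]
  [RiemannianBundle (fun x : M => TangentSpace (𝓡∂ n) x)] [MeasurableSpace M]

/-- The differential of `φ` at `x`, a linear form on the tangent space at `x`. -/
def differential (φ : M → ℝ) (x : M) : TangentSpace (𝓡∂ n) x →L[ℝ] ℝ :=
  mfderiv (𝓡∂ n) 𝓘(ℝ, ℝ) φ x

/-- `|∇φ|(x)`: the norm of the differential of `φ` at `x` that is dual to the Riemannian norm on
the tangent space. -/
def gradNorm (φ : M → ℝ) (x : M) : ℝ :=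
  ‖differential (n := n) φ x‖

/-- `u` lies in the domain of the form `E(f) = ∫ |∇f|² dμ`, that is, in the closure of the smooth
functions for the norm `(‖f‖²_{L²(μ)} + E(f))^{1/2}`, and its energy measure `Γ(u)`, defined by
continuous extension from `Γ(φ) = |∇φ|² μ` for smooth `φ`, has the density `h` with respect to `μ`.
Thus `h = |∇u|²`. -/
def HasEnergyDensity (n : ℕ) [NeZero n]
    {M : Type*} [MetricSpace M] [ChartedSpace (EuclideanHalfSpace n) M]
    [RiemannianBundle (fun x : M => TangentSpace (𝓡∂ n) x)] [MeasurableSpace M]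
    (μ : Measure M) (u h : M → ℝ) : Prop :=
  Measurable h ∧ ∃ φ : ℕ → M → ℝ,
    (∀ j, ContMDiff (𝓡∂ n) 𝓘(ℝ, ℝ) ∞ (φ j)) ∧
    Tendsto (fun j => ∫⁻ x, ‖φ j x - u x‖ₑ ^ 2 ∂μ) atTop (𝓝 0) ∧
    Tendsto (fun p : ℕ × ℕ => ∫⁻ x, ‖gradNorm (n := n) (φ p.1 - φ p.2) x‖ₑ ^ 2 ∂μ)
      atTop (𝓝 0) ∧
    Tendsto (fun j => ∫⁻ x, ‖gradNorm (n := n) (φ j) x ^ 2 - h x‖ₑ ∂μ) atTop (𝓝 0)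

/-- `u` is a competitor for the relative capacity of `K` in `Ω`, with `|∇u|² = h`: it is
`E`-Lipschitz (it lies in the domain of `E` and `|∇u|²` is essentially bounded), it is continuous
with compact support in `Ω`, and `u ≥ χ_K`. -/
structure IsCapacityCompetitor (n : ℕ) [NeZero n]
    {M : Type*} [MetricSpace M] [ChartedSpace (EuclideanHalfSpace n) M]
    [RiemannianBundle (fun x : M => TangentSpace (𝓡∂ n) x)] [MeasurableSpace M]
    (μ : Measure M) (K Ω : Set M) (u h : M → ℝ) : Prop where
  energy : HasEnergyDensity n μ u h
  bounded : ∃ C : ℝ, ∀ᵐ x ∂μ, h x ≤ C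
  continuous : Continuous u
  compactSupport : HasCompactSupport u
  support_subset : tsupport u ⊆ Ω
  ge_indicator : ∀ x, K.indicator (fun _ => (1 : ℝ)) x ≤ u x

/-- The relative `(2, μ)`-capacity of a compact set `K` in an open set `Ω` of the manifold `M`:
the infimum of `∫_Ω |∇u|² dμ` over all competitors. -/
def capacity (n : ℕ) [NeZero n]
    {M : Type*} [MetricSpace M] [ChartedSpace (EuclideanHalfSpace n) M]
    [RiemannianBundle (fun x : M => TangentSpace (𝓡∂ n) x)] [MeasurableSpace M]
    (μ : Measure M) (K Ω : Set M) : ℝ≥0∞ :=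
  ⨅ (u : M → ℝ) (h : M → ℝ) (_ : IsCapacityCompetitor n μ K Ω u h),
    ∫⁻ x in Ω, ENNReal.ofReal (h x) ∂μ

end Capacity

/-! ### The glued space -/

section Glued

variable {E M₁ M₂ : Type*}

/-- The distance of `x` and `y` measured in the embedded manifold `ι(M)`; it is `∞` unless both
points lie in `ι(M)`. -/
def imageEDist {M : Type*} [MetricSpace M] (ι : M → E) (x y : E) : ℝ≥0∞ :=
  ⨅ (a : M) (b : M) (_ : ι a = x) (_ : ι b = y), edist a b

/-- The one-step distance on `M₁ ∪ M₂`: `min (d₁, d₂)` if both points lie in `M₁ ∩ M₂`, the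
distance `dᵢ` if `Mᵢ` is the only one of the two manifolds that contains both points, and `∞` if
there is none. -/
def stepEDist [MetricSpace M₁] [MetricSpace M₂] (ι₁ : M₁ → E) (ι₂ : M₂ → E) (x y : E) : ℝ≥0∞ :=
  min (imageEDist ι₁ x y) (imageEDist ι₂ x y)

/-- The glued distance: the infimum of the lengths of finite chains from `x` to `y`. -/
def gluedEDist [MetricSpace M₁] [MetricSpace M₂] (ι₁ : M₁ → E) (ι₂ : M₂ → E) (x y : E) : ℝ≥0∞ :=
  ⨅ (m : ℕ) (p : ℕ → E) (_ : p 0 = x) (_ : p m = y),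
    ∑ i ∈ Finset.range m, stepEDist ι₁ ι₂ (p i) (p (i + 1))

/-- The open ball of the glued distance. For a centre in the glued space it is contained in the
glued space. -/
def gluedBall [MetricSpace M₁] [MetricSpace M₂] (ι₁ : M₁ → E) (ι₂ : M₂ → E) (x : E) (r : ℝ) :
    Set E :=
  {y | gluedEDist ι₁ ι₂ x y < ENNReal.ofReal r}

/-- The glued space `X = M₁ ∪ M₂`. -/
def space (ι₁ : M₁ → E) (ι₂ : M₂ → E) : Set E := range ι₁ ∪ range ι₂

/-- The intersection `L = M₁ ∩ M₂`. -/
def inter (ι₁ : M₁ → E) (ι₂ : M₂ → E) : Set E := range ι₁ ∩ range ι₂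

/-- The tube `L_R`: the union of the glued balls of radius `R` centred at points of `L`. -/
def tube [MetricSpace M₁] [MetricSpace M₂] (ι₁ : M₁ → E) (ι₂ : M₂ → E) (R : ℝ) : Set E :=
  ⋃ x ∈ inter ι₁ ι₂, gluedBall ι₁ ι₂ x R

/-- The measure `μ = w₁ · vol_{M₁} + w₂ · vol_{M₂}` of the glued space. -/
def gluedMeasure [MeasurableSpace E]
    [MetricSpace M₁] [MeasurableSpace M₁] [BorelSpace M₁]
    [MetricSpace M₂] [MeasurableSpace M₂] [BorelSpace M₂]
    (n₁ n₂ : ℕ) (ι₁ : M₁ → E) (ι₂ : M₂ → E) (w₁ : M₁ → ℝ) (w₂ : M₂ → ℝ) : Measure E :=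
  (weightedVol n₁ w₁).map ι₁ + (weightedVol n₂ w₂).map ι₂

/-- The measure `μ` is `N`-doubling on the glued space:
`μ(B_{3r}(x)) ≤ N(2r) μ(B_r(x))` for all points `x` of the glued space and all `r > 0`. -/
def IsNDoubling [MeasurableSpace E] [MetricSpace M₁] [MetricSpace M₂]
    (ι₁ : M₁ → E) (ι₂ : M₂ → E) (μ : Measure E) (N : ℝ → ℝ) : Prop :=
  ∀ x ∈ space ι₁ ι₂, ∀ r : ℝ, 0 < r →
    μ (gluedBall ι₁ ι₂ x (3 * r)) ≤ ENNReal.ofReal (N (2 * r)) * μ (gluedBall ι₁ ι₂ x r)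

end Glued

/-! ### Transversality -/

section Transversality

variable {E : Type*} [NormedAddCommGroup E] [NormedSpace ℝ E]

/-- The differential of a map `f` from a manifold to a vector space. -/
def vectorDifferential {V H : Type*} [NormedAddCommGroup V] [NormedSpace ℝ V] [TopologicalSpace H]
    (I : ModelWithCorners ℝ V H) {M : Type*} [TopologicalSpace M] [ChartedSpace H M]
    (f : M → E) (a : M) : V →L[ℝ] E :=
  mfderiv I 𝓘(ℝ, E) f a

/-- The tangent space of the embedded manifold `f(M)` at `f a`, as a subspace of `E`. -/
def imageTangentSpace {V H : Type*} [NormedAddCommGroup V] [NormedSpace ℝ V] [TopologicalSpace H]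
    (I : ModelWithCorners ℝ V H) {M : Type*} [TopologicalSpace M] [ChartedSpace H M]
    (f : M → E) (a : M) : Submodule ℝ E :=
  LinearMap.range (vectorDifferential I f a).toLinearMap

/-- The embedded manifolds `ι₁(M₁)` and `ι₂(M₂)` are transversal in the embedded manifold `j(P)`:
they are contained in `j(P)` in some open neighbourhood `U` of their intersection, and
`T_x M₁ + T_x M₂ = T_x P` at each point `x` of the intersection. -/
def IsTransversal {n₁ n₂ n : ℕ} [NeZero n₁] [NeZero n₂]
    {M₁ M₂ P : Type*} [TopologicalSpace M₁] [ChartedSpace (EuclideanHalfSpace n₁) M₁]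
    [TopologicalSpace M₂] [ChartedSpace (EuclideanHalfSpace n₂) M₂]
    [TopologicalSpace P] [ChartedSpace (EuclideanSpace ℝ (Fin n)) P]
    (ι₁ : M₁ → E) (ι₂ : M₂ → E) (j : P → E) : Prop :=
  (∃ U : Set E, IsOpen U ∧ inter ι₁ ι₂ ⊆ U ∧ range ι₁ ∩ U ⊆ range j ∧ range ι₂ ∩ U ⊆ range j) ∧
    ∀ (a : M₁) (b : M₂) (c : P), ι₁ a = ι₂ b → ι₁ a = j c →
      imageTangentSpace (𝓡∂ n₁) ι₁ a ⊔ imageTangentSpace (𝓡∂ n₂) ι₂ b =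
        imageTangentSpace (𝓡 n) j c

end Transversality

end GluedManifold

end

/-! The capacity is positive because a competitor must fall from at least 1 on `L` to 0 at the edge
of a small tube, and the weights are not small enough near `L` for this to cost arbitrarily little.
It is enough to see this near one common point of the two manifolds.

There `exists_isAdaptedChart` gives bi-Lipschitz C¹ coordinates (x, z) in ℝᵏ × ℝᵈ⁺¹ in which `L` is
z = 0. Integrating the derivative along the rays τ ↦ (x, τz), and bounding G by cG² + 1/c with c
proportional to τᵈw, gives `lintegral_rays_le`: the drop along the rays is at most a multiple of the
energy plus a multiple of ∫₀¹ τ^(-(2d+1)) ∫_{shell of radius τr} 1/w dτ. If this last integral is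
finite, it can be absorbed with a constant independent of the competitor, and the energy is bounded
below (`IsAdaptedChart.capacity_pos`). Competitors are only limits of smooth functions in the energy
norm, so cut-offs and thin shells around `L` replace exact boundary values, with errors that vanish
in the limit.

It remains to bound the integral of 1/w over a shell of radius σ by σ^(2d+1) g(σ) with g integrable.
On `M₂` the codimension is one, d = 0, and the shell has volume of order σ while 1/w is bounded: g =
1 works.

On `M₁` the doubling condition does the work. For y in `M₁` at distance s from `L`, the glued ball
B_s(y) lies in `M₁` alone, whereas B_{3s}(y) contains a ball of `M₂` of radius s centred on `L`, of
mass at least of order s^(k+1). Hence s^(k+1) is at most a constant times N(2s) μ₁(B_s(y))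
(`IsNDoubling.measure_ball_le`). The A₂ condition turns this lower bound for the integral of w into
an upper bound of order N(2s) s^(2n₁-k-1) = N(2s) s^(k+2d+1) for the integral of 1/w over balls
centred on `L` (`IsAdaptedChart.exists_ball_bound`). Averaging over centres in `L` removes the
factor sᵏ, so g(σ) = N(2σ), which is integrable near 0. -/

namespace GluedManifold

/-! ### Riemannian distance in an interior chart -/

section Chart

variable {E : Type*} [NormedAddCommGroup E] [NormedSpace ℝ E]
  {H : Type*} [TopologicalSpace H]

/-- The differential of a map from a manifold to a vector space, on the tangent space at `x`. -/
noncomputable def covectorMap (I : ModelWithCorners ℝ E H) {M : Type*} [TopologicalSpace M]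
    [ChartedSpace H M] {F : Type*} [NormedAddCommGroup F] [NormedSpace ℝ F] (f : M → F) (x : M) :
    TangentSpace I x →L[ℝ] F :=
  mfderiv I 𝓘(ℝ, F) f x

/-- The differential within `s` of a map from a vector space to a manifold. -/
noncomputable def velocityMap (I : ModelWithCorners ℝ E H) {M : Type*} [TopologicalSpace M]
    [ChartedSpace H M] {F : Type*} [NormedAddCommGroup F] [NormedSpace ℝ F] (f : F → M)
    (s : Set F) (x : F) : F →L[ℝ] TangentSpace I (f x) :=
  mfderivWithin 𝓘(ℝ, F) I f s x

variable {I : ModelWithCorners ℝ E H}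

theorem isContinuousRiemannianBundle_of_contMDiff
    {M : Type*} [TopologicalSpace M] [ChartedSpace H M] [IsManifold I 1 M]
    [RiemannianBundle (fun x : M => TangentSpace I x)]
    [h : IsContMDiffRiemannianBundle I ∞ E (fun x : M => TangentSpace I x)] :
    IsContinuousRiemannianBundle E (fun x : M => TangentSpace I x) := by
  obtain ⟨g, hg, h'⟩ := h.exists_contMDiff
  exact ⟨g, hg.continuous, h'⟩

variable {M : Type*} [PseudoEMetricSpace M] [ChartedSpace H M]
  [RiemannianBundle (fun x : M => TangentSpace I x)]

/-- The image of a segment is a path, and its length bounds the Riemannian distance. The derivative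
is taken within a larger set `t` because an inverse chart is controlled within the range of the
model. -/
theorem edist_image_le_of_velocity_le [IsManifold I 1 M] [IsRiemannianManifold I M]
    {g : E → M} {s : Set E} (hs : Convex ℝ s)
    (hg : ContMDiffOn 𝓘(ℝ, E) I 1 g s) {t : Set E} (hst : s ⊆ t) {C : ℝ≥0}
    (hgt : ∀ y ∈ s, MDifferentiableWithinAt 𝓘(ℝ, E) I g t y)
    (hC : ∀ y ∈ s, ‖velocityMap I g t y‖ₑ ≤ C) {x y : E} (hx : x ∈ s) (hy : y ∈ s) :
    edist (g x) (g y) ≤ C * edist x y := by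
  let η := ContinuousAffineMap.lineMap (R := ℝ) x y
  have hη : MapsTo η (Icc 0 1) s := by
    intro u hu
    have : η u ∈ segment ℝ x y := by
      rw [segment_eq_image_lineMap]
      exact ⟨u, hu, by simp [η, ContinuousAffineMap.coe_lineMap_eq]⟩
    exact hs.segment_subset hx hy this
  have η_smooth : ContMDiffOn 𝓘(ℝ, ℝ) 𝓘(ℝ, E) 1 η (Icc 0 1) := by
    apply ContMDiff.contMDiffOn
    rw [contMDiff_iff_contDiff]
    exact ContinuousAffineMap.contDiff _
  rw [IsRiemannianManifold.out (I := I) (g x) (g y)]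
  have : riemannianEDist I (g x) (g y) ≤ pathELength I (g ∘ η) 0 1 := by
    apply riemannianEDist_le_pathELength _ _ _ zero_le_one
    · exact hg.comp η_smooth hη
    · simp [η, ContinuousAffineMap.coe_lineMap_eq]
    · simp [η, ContinuousAffineMap.coe_lineMap_eq]
  apply this.trans
  have hlen : ∫⁻ u in Icc (0 : ℝ) 1, ‖(fderivWithin ℝ η (Icc 0 1) u 1 : E)‖ₑ = edist x y := by
    have : ∀ u ∈ Icc (0 : ℝ) 1, ‖(fderivWithin ℝ η (Icc 0 1) u 1 : E)‖ₑ = edist x y := by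
      intro u hu
      have h1 : HasDerivWithinAt η (y - x) (Icc 0 1) u := by
        simpa [η, ContinuousAffineMap.coe_lineMap_eq] using
          (AffineMap.hasDerivWithinAt_lineMap (a := x) (b := y) (s := Icc (0 : ℝ) 1) (x := u))
      rw [fderivWithin_derivWithin, h1.derivWithin (uniqueDiffOn_Icc zero_lt_one u hu),
        edist_comm, edist_eq_enorm_sub]
    rw [setLIntegral_congr_fun measurableSet_Icc this]
    simp
  rw [← hlen, pathELength_eq_lintegral_mfderivWithin_Icc,
    ← lintegral_const_mul' _ _ ENNReal.coe_ne_top]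
  apply setLIntegral_mono' measurableSet_Icc (fun u hu ↦ ?_)
  have hcomp : mfderivWithin 𝓘(ℝ, ℝ) I (g ∘ η) (Icc 0 1) u =
      (mfderivWithin 𝓘(ℝ, E) I g t (η u)) ∘L
        (mfderivWithin 𝓘(ℝ, ℝ) 𝓘(ℝ, E) η (Icc 0 1) u) := by
    apply mfderivWithin_comp
    · exact hgt _ (hη hu)
    · exact η_smooth.mdifferentiableOn one_ne_zero u hu
    · exact fun v hv => hst (hη hv)
    · rw [uniqueMDiffWithinAt_iff_uniqueDiffWithinAt]
      exact uniqueDiffOn_Icc zero_lt_one u hu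
  have : mfderivWithin 𝓘(ℝ, ℝ) I (g ∘ η) (Icc 0 1) u 1 =
      velocityMap I g t (η u) (fderivWithin ℝ η (Icc 0 1) u 1) := by
    rw [← mfderivWithin_eq_fderivWithin]
    exact congr($hcomp 1)
  rw [this]
  apply (ContinuousLinearMap.le_opENorm _ _).trans
  gcongr
  exact hC _ (hη hu)

/-- Almost shortest paths between points of the ball of radius `r` have length below `2 * r`, hence
stay in the ball of radius `3 * r`, where the differential is bounded. -/
theorem edist_image_le_of_covector_le [IsManifold I 1 M] [IsRiemannianManifold I M]
    {F : Type*} [NormedAddCommGroup F] [NormedSpace ℝ F]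
    {f : M → F} {p : M} {r : ℝ≥0∞} 
    (hf : ContMDiffOn I 𝓘(ℝ, F) 1 f (Metric.eball p (3 * r))) {C : ℝ≥0}
    (hC : ∀ y ∈ Metric.eball p (3 * r), ‖covectorMap I f y‖ₑ ≤ C) {x y : M}
    (hx : x ∈ Metric.eball p r) (hy : y ∈ Metric.eball p r) :
    edist (f x) (f y) ≤ C * edist x y := by
  have hxy : edist x y < 2 * r := by
    calc edist x y ≤ edist x p + edist p y := edist_triangle _ _ _
      _ < r + r := ENNReal.add_lt_add hx (by rw [edist_comm]; exact hy)
      _ = 2 * r := (two_mul r).symm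
  -- A shortest path need not exist, so the estimate is proved for every slightly larger length `d`,
  -- which then decreases to the distance.
  have key : ∀ d, edist x y < d → d ≤ 2 * r → edist (f x) (f y) ≤ C * d := by
    intro d hd hdr
    rw [IsRiemannianManifold.out (I := I) x y] at hd
    obtain ⟨γ, hγx, hγy, γ_smooth, hγ⟩ := exists_lt_of_riemannianEDist_lt hd
    have hmem : MapsTo γ (Icc 0 1) (Metric.eball p (3 * r)) := by
      intro u hu
      have h1 : edist x (γ u) < 2 * r := by
        rw [IsRiemannianManifold.out (I := I), ← hγx]
        refine (riemannianEDist_le_pathELength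
          (γ_smooth.mono (Icc_subset_Icc_right hu.2)) rfl rfl hu.1).trans_lt ?_
        exact (pathELength_mono le_rfl hu.2).trans_lt (hγ.trans_le hdr)
      calc edist (γ u) p ≤ edist (γ u) x + edist x p := edist_triangle _ _ _
        _ < 2 * r + r := ENNReal.add_lt_add (by rw [edist_comm]; exact h1) hx
        _ = 3 * r := by ring
    have hcomp : ContMDiffOn 𝓘(ℝ, ℝ) 𝓘(ℝ, F) 1 (f ∘ γ) (Icc 0 1) := hf.comp γ_smooth hmem
    calc edist (f x) (f y) = ‖(f ∘ γ) 1 - (f ∘ γ) 0‖ₑ := by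
          rw [edist_comm, edist_eq_enorm_sub]; simp [hγx, hγy]
      _ ≤ ∫⁻ u in Icc 0 1, ‖derivWithin (f ∘ γ) (Icc 0 1) u‖ₑ := by
          apply enorm_sub_le_lintegral_derivWithin_Icc_of_contDiffOn_Icc _ zero_le_one
          rwa [← contMDiffOn_iff_contDiffOn]
      _ ≤ ∫⁻ u in Icc 0 1, C * ‖mfderivWithin 𝓘(ℝ, ℝ) I γ (Icc 0 1) u 1‖ₑ := by
          apply setLIntegral_mono' measurableSet_Icc (fun u hu ↦ ?_)
          have hcomp : mfderivWithin 𝓘(ℝ, ℝ) 𝓘(ℝ, F) (f ∘ γ) (Icc 0 1) u =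
              (mfderiv I 𝓘(ℝ, F) f (γ u)) ∘L (mfderivWithin 𝓘(ℝ, ℝ) I γ (Icc 0 1) u) := by
            apply mfderiv_comp_mfderivWithin
            · exact ((hf _ (hmem hu)).contMDiffAt
                (Metric.isOpen_eball.mem_nhds (hmem hu))).mdifferentiableAt one_ne_zero
            · exact γ_smooth.mdifferentiableOn one_ne_zero _ hu
            · rw [uniqueMDiffWithinAt_iff_uniqueDiffWithinAt]
              exact uniqueDiffOn_Icc zero_lt_one _ hu
          have : derivWithin (f ∘ γ) (Icc 0 1) u =
              covectorMap I f (γ u) (mfderivWithin 𝓘(ℝ, ℝ) I γ (Icc 0 1) u 1) := by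
            rw [← fderivWithin_derivWithin, ← mfderivWithin_eq_fderivWithin]
            exact congr($hcomp 1)
          rw [this]
          apply (ContinuousLinearMap.le_opENorm _ _).trans
          gcongr
          exact hC _ (hmem hu)
      _ = C * pathELength I γ 0 1 := by
          rw [lintegral_const_mul' _ _ ENNReal.coe_ne_top,
            pathELength_eq_lintegral_mfderivWithin_Icc]
      _ ≤ C * d := by gcongr
  have hne : (𝓝[>] (edist x y)).NeBot := nhdsGT_neBot_of_exists_gt ⟨_, hxy⟩
  have htend : Tendsto (fun d => (C : ℝ≥0∞) * d) (𝓝[>] (edist x y)) (𝓝 (C * edist x y)) :=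
    (ENNReal.continuous_const_mul ENNReal.coe_ne_top).continuousAt.tendsto.mono_left
      nhdsWithin_le_nhds
  refine ge_of_tendsto htend ?_
  filter_upwards [Ioo_mem_nhdsGT hxy] with d hd
  exact key d hd.1 hd.2.le

/-- Continuity of the metric bounds the derivatives of the chart and of its inverse near `p`. Since
`p` is interior, the range of the model is a neighbourhood of its image, so derivatives within the
range are full derivatives. -/
theorem exists_interior_chart_comparison [IsManifold I 1 M] [IsRiemannianManifold I M]
    [IsContinuousRiemannianBundle E (fun x : M => TangentSpace I x)] {p : M}
    (hp : I.IsInteriorPoint p) :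
    ∃ C : ℝ≥0, ∃ s ∈ 𝓝 (extChartAt I p p), s ⊆ (extChartAt I p).target ∧
      (∀ x ∈ s, ∀ y ∈ s,
        edist ((extChartAt I p).symm x) ((extChartAt I p).symm y) ≤ C * edist x y) ∧
      (∀ x ∈ s, ∀ y ∈ s,
        edist x y ≤ C * edist ((extChartAt I p).symm x) ((extChartAt I p).symm y)) ∧
      ∀ f : M → ℝ, ∀ y ∈ s, MDifferentiableAt I 𝓘(ℝ, ℝ) f ((extChartAt I p).symm y) →
        ‖fderiv ℝ (f ∘ (extChartAt I p).symm) y‖ₑ ≤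
          C * ‖covectorMap I f ((extChartAt I p).symm y)‖ₑ := by
  set φ := extChartAt I p with hφ
  have hpt : φ p ∈ interior (range I) := hp
  have hrange : range I ∈ 𝓝 (φ p) := mem_interior_iff_mem_nhds.1 hpt
  obtain ⟨C₁, -, hC₁⟩ := eventually_enorm_mfderiv_extChartAt_lt I p
  obtain ⟨C₂, -, hC₂⟩ := eventually_enorm_mfderivWithin_symm_extChartAt_lt I p
  rw [nhdsWithin_eq_nhds.2 hrange] at hC₂
  have htarget : φ.target ∈ 𝓝 (φ p) := by
    have := extChartAt_target_mem_nhdsWithin (I := I) p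
    rwa [nhdsWithin_eq_nhds.2 hrange] at this
  obtain ⟨ρ, hρ, hρs⟩ : ∃ ρ > 0, Metric.ball (φ p) ρ ⊆ φ.target ∩ interior (range I) ∩
      {y | ‖velocityMap I φ.symm (range I) y‖ₑ ≤ C₂} := by
    refine Metric.mem_nhds_iff.1 (inter_mem (inter_mem htarget ?_) ?_)
    · exact isOpen_interior.mem_nhds hpt
    · filter_upwards [hC₂] with y hy using hy.le
  obtain ⟨r', hr', hr's⟩ : ∃ r > 0, Metric.eball p r ⊆ (chartAt H p).source ∩
      {y | ‖covectorMap I φ y‖ₑ ≤ C₁} := by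
    refine EMetric.mem_nhds_iff.1 (inter_mem (chart_source_mem_nhds H p) ?_)
    filter_upwards [hC₁] with y hy using hy.le
  have hr3 : 0 < r' / 3 := ENNReal.div_pos hr'.ne' (by simp)
  have h3 : 3 * (r' / 3) = r' := ENNReal.mul_div_cancel (by simp) (by simp)
  have hpre : φ.symm ⁻¹' Metric.eball p (r' / 3) ∈ 𝓝 (φ p) :=
    extChartAt_preimage_mem_nhds (Metric.eball_mem_nhds _ hr3)
  refine ⟨max C₁ C₂, Metric.ball (φ p) ρ ∩ φ.symm ⁻¹' Metric.eball p (r' / 3),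
    inter_mem (Metric.ball_mem_nhds _ hρ) hpre, fun y hy => (hρs hy.1).1.1, ?_, ?_, ?_⟩
  · intro x hx y hy
    have := edist_image_le_of_velocity_le (I := I) (g := φ.symm) (convex_ball (φ p) ρ)
      ((contMDiffOn_extChartAt_symm p).mono fun y hy => (hρs hy).1.1)
      (fun y hy => interior_subset (hρs hy).1.2)
      (fun y hy => mdifferentiableWithinAt_extChartAt_symm (hρs hy).1.1)
      (fun y hy => (hρs hy).2) hx.1 hy.1
    refine this.trans ?_
    gcongr
    exact le_max_right _ _
  · intro x hx y hy
    have := edist_image_le_of_covector_le (I := I) (f := φ) (p := p) (r := r' / 3)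
      (contMDiffOn_extChartAt.mono (by rw [h3]; exact fun y hy => (hr's hy).1))
      (by rw [h3]; exact fun y hy => (hr's hy).2) hx.2 hy.2
    rw [φ.right_inv (hρs hx.1).1.1, φ.right_inv (hρs hy.1).1.1] at this
    refine this.trans ?_
    gcongr
    exact le_max_left _ _
  · intro f y hy hf
    have hcomp : mfderivWithin 𝓘(ℝ, E) 𝓘(ℝ, ℝ) (f ∘ φ.symm) (range I) y =
        (mfderiv I 𝓘(ℝ, ℝ) f (φ.symm y)) ∘L (mfderivWithin 𝓘(ℝ, E) I φ.symm (range I) y) := by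
      apply mfderiv_comp_mfderivWithin
      · exact hf
      · exact mdifferentiableWithinAt_extChartAt_symm (hρs hy.1).1.1
      · rw [uniqueMDiffWithinAt_iff_uniqueDiffWithinAt]
        exact uniqueDiffWithinAt_of_mem_nhds (mem_interior_iff_mem_nhds.1 (hρs hy.1).1.2)
    have : fderiv ℝ (f ∘ φ.symm) y =
        (covectorMap I f (φ.symm y)) ∘L (velocityMap I φ.symm (range I) y) := by
      rw [← fderivWithin_of_mem_nhds (mem_interior_iff_mem_nhds.1 (hρs hy.1).1.2),
        ← mfderivWithin_eq_fderivWithin]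
      exact hcomp
    rw [this, mul_comm]
    refine (ContinuousLinearMap.opENorm_comp_le _ _).trans ?_
    gcongr
    exact (hρs hy.1).2.trans (by exact_mod_cast le_max_right _ _)

end Chart
end GluedManifold

namespace GluedManifold

/-! ### Straightening a submanifold -/

section Straightening

variable {E : Type*} [NormedAddCommGroup E] [NormedSpace ℝ E] [FiniteDimensional ℝ E]
  {V W : Type*} [NormedAddCommGroup V] [NormedSpace ℝ V] [FiniteDimensional ℝ V]
  [NormedAddCommGroup W] [NormedSpace ℝ W] [FiniteDimensional ℝ W]

theorem exists_coprod_equiv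
    (hdim : Module.finrank ℝ V + Module.finrank ℝ W = Module.finrank ℝ E) (A : V →L[ℝ] E)
    (hA : Function.Injective A) :
    ∃ (B : W →L[ℝ] E) (T : (V × W) ≃L[ℝ] E), (T : V × W →L[ℝ] E) = A.coprod B := by
  obtain ⟨S, hS⟩ := Submodule.exists_isCompl (LinearMap.range (A : V →ₗ[ℝ] E))
  have h1 : Module.finrank ℝ (LinearMap.range (A : V →ₗ[ℝ] E)) = Module.finrank ℝ V :=
    LinearMap.finrank_range_of_inj hA
  have h2 := Submodule.finrank_add_eq_of_isCompl hS
  have h3 : Module.finrank ℝ W = Module.finrank ℝ S := by omega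
  let b : W ≃ₗ[ℝ] S := LinearEquiv.ofFinrankEq W S h3
  let B : W →L[ℝ] E := LinearMap.toContinuousLinearMap (S.subtype ∘ₗ (b : W →ₗ[ℝ] S))
  have hB : ∀ w, B w = (b w : E) := fun w => rfl
  have hinj : Function.Injective (A.coprod B) := by
    rw [injective_iff_map_eq_zero]
    rintro ⟨v, w⟩ h
    rw [ContinuousLinearMap.coprod_apply] at h
    have hv : A v ∈ LinearMap.range (A : V →ₗ[ℝ] E) := ⟨v, rfl⟩
    have hw : A v ∈ S := by
      rw [eq_neg_of_add_eq_zero_left h, hB]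
      exact S.neg_mem (b w).2
    have h0 : A v = 0 := Submodule.disjoint_def.1 hS.disjoint _ hv hw
    have hv0 : v = 0 := hA (by simpa using h0)
    have hw0 : w = 0 := by
      rw [h0, zero_add, hB] at h
      simpa using h
    simp [hv0, hw0]
  have hfin : Module.finrank ℝ (V × W) = Module.finrank ℝ E := by
    rw [Module.finrank_prod]; exact hdim
  let T := (LinearEquiv.ofInjectiveOfFinrankEq ((A.coprod B : V × W →L[ℝ] E) : V × W →ₗ[ℝ] E)
    hinj hfin).toContinuousLinearEquiv
  refine ⟨B, T, ?_⟩
  ext q <;> rfl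

/-- The map (v, w) ↦ g(x₀ + v) + Bw, with B onto a complement of the range of the derivative of `g`,
has invertible derivative at 0. Strict differentiability then makes it bi-Lipschitz near 0. -/
theorem exists_straightening
    (hdim : Module.finrank ℝ V + Module.finrank ℝ W = Module.finrank ℝ E) {g : V → E} {x₀ : V}
    (hg : ContDiffAt ℝ 1 g x₀) (hinj : Function.Injective (fderiv ℝ g x₀)) :
    ∃ (F : V × W → E) (C : ℝ≥0), ∃ s ∈ 𝓝 (0 : V × W), (∀ x, F (x, 0) = g (x₀ + x)) ∧
      (∀ q ∈ s, ContDiffAt ℝ 1 F q) ∧ LipschitzOnWith C F s ∧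
      (∀ q ∈ s, ∀ q' ∈ s, edist q q' ≤ C * edist (F q) (F q')) ∧
      map F (𝓝 0) = 𝓝 (g x₀) := by
  obtain ⟨B, T, hT⟩ := exists_coprod_equiv (W := W) hdim _ hinj
  let F : V × W → E := fun q => g (x₀ + q.1) + B q.2
  have hF0 : F 0 = g x₀ := by simp [F]
  have hcd : ContDiffAt ℝ 1 F 0 := by
    have h1 : ContDiffAt ℝ 1 (fun q : V × W => g (x₀ + q.1)) 0 := by
      have : ContDiffAt ℝ 1 g (x₀ + (0 : V × W).1) := by simpa using hg
      exact this.comp (0 : V × W) (by fun_prop)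
    exact h1.add (by fun_prop)
  have hder : HasStrictFDerivAt F (T : V × W →L[ℝ] E) 0 := by
    have h1 : HasStrictFDerivAt g (fderiv ℝ g x₀) (x₀ + (0 : V × W).1) := by
      simpa using hg.hasStrictFDerivAt one_ne_zero
    have h2 : HasStrictFDerivAt (fun q : V × W => x₀ + q.1) (ContinuousLinearMap.fst ℝ V W) 0 :=
      hasStrictFDerivAt_fst.const_add _
    have h3 : HasStrictFDerivAt (fun q : V × W => B q.2)
        (B ∘L ContinuousLinearMap.snd ℝ V W) 0 :=
      B.hasStrictFDerivAt.comp _ hasStrictFDerivAt_snd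
    have := (HasStrictFDerivAt.comp (0 : V × W) (g := g) h1 h2).add h3
    rw [hT]
    exact this
  obtain ⟨s, hs0, hso, hs⟩ : ∃ s, (0 : V × W) ∈ s ∧ IsOpen s ∧
      ApproximatesLinearOn F (T : V × W →L[ℝ] E) s
        (‖(T.symm : E →L[ℝ] V × W)‖₊⁻¹ / 2) := hder.approximates_deriv_on_open_nhds
  have hev : ∀ᶠ q in 𝓝 (0 : V × W), ContDiffAt ℝ 1 F q := hcd.eventually (by simp)
  have hanti := hs.antilipschitz (T.subsingleton_or_nnnorm_symm_pos.imp id fun h =>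
    NNReal.half_lt_self (inv_pos.2 h).ne')
  have hlip := hs.lipschitz
  set C₁ := ‖(T : V × W →L[ℝ] E)‖₊ + ‖(T.symm : E →L[ℝ] V × W)‖₊⁻¹ / 2
  set C₂ := (‖(T.symm : E →L[ℝ] V × W)‖₊⁻¹ - ‖(T.symm : E →L[ℝ] V × W)‖₊⁻¹ / 2)⁻¹
  refine ⟨F, max C₁ C₂, s ∩ {q | ContDiffAt ℝ 1 F q}, inter_mem (hso.mem_nhds hs0) hev,
    fun x => by simp [F], fun q hq => hq.2, ?_, ?_, ?_⟩
  · intro q hq q' hq'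
    refine (hlip ⟨q, hq.1⟩ ⟨q', hq'.1⟩).trans ?_
    gcongr
    · exact le_max_left _ _
    · exact le_of_eq rfl
  · intro q hq q' hq'
    refine (hanti ⟨q, hq.1⟩ ⟨q', hq'.1⟩).trans ?_
    gcongr
    · exact le_max_right _ _
    · exact le_of_eq rfl
  · rw [hder.map_nhds_eq_of_equiv, hF0]

end Straightening

/-! ### Adapted charts -/

section Adapted

variable {n : ℕ} [NeZero n] {k d : ℕ}
  {M : Type*} [MetricSpace M] [ChartedSpace (EuclideanHalfSpace n) M]

/-- A bi-Lipschitz parametrisation of a neighbourhood of a point of `L` in which `L` is the set of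
the points with vanishing second coordinate. -/
structure IsAdaptedChart [RiemannianBundle (fun x : M => TangentSpace (𝓡∂ n) x)] (L : Set M)
    (Φ : EuclideanSpace ℝ (Fin k) × EuclideanSpace ℝ (Fin d) → M)
    (ρ : ℝ) (C : ℝ≥0) : Prop where
  contDiffAt : ∀ f : M → ℝ, ContMDiff (𝓡∂ n) 𝓘(ℝ, ℝ) ∞ f → ∀ q ∈ Metric.ball 0 ρ,
    ContDiffAt ℝ 1 (f ∘ Φ) q
  enorm_fderiv_le : ∀ f : M → ℝ, ContMDiff (𝓡∂ n) 𝓘(ℝ, ℝ) ∞ f → ∀ q ∈ Metric.ball 0 ρ,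
    ‖fderiv ℝ (f ∘ Φ) q‖ₑ ≤ C * ‖gradNorm (n := n) f (Φ q)‖ₑ
  lipschitzOnWith : LipschitzOnWith C Φ (Metric.ball 0 ρ)
  edist_le : ∀ q ∈ Metric.ball 0 ρ, ∀ q' ∈ Metric.ball 0 ρ,
    edist q q' ≤ C * edist (Φ q) (Φ q')
  mem : ∀ x : EuclideanSpace ℝ (Fin k), ‖x‖ < ρ → Φ (x, 0) ∈ L
  norm_snd_le : ∀ q ∈ Metric.ball 0 ρ, ∀ a ∈ L, ‖q.2‖ ≤ C * dist (Φ q) a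
  image_mem_nhds : Φ '' Metric.ball 0 ρ ∈ 𝓝 (Φ 0)

/-- Since its image lies in that of `ι`, the map `e` factors as `ι ∘ γ`, and γ is smooth because `ι`
is an immersion. In charts γ is the required `g`. A smooth left inverse, built from slice
coordinates of `e`, makes its derivative injective. -/
theorem exists_coordinates_of_isSmoothEmbedding {m : ℕ} [IsManifold (𝓡∂ n) ∞ M]
    {ι : M → EuclideanSpace ℝ (Fin m)}
    (hι : IsSmoothEmbedding (𝓡∂ n) 𝓘(ℝ, EuclideanSpace ℝ (Fin m)) ∞ ι)
    {K : Type*} [TopologicalSpace K] [ChartedSpace (EuclideanSpace ℝ (Fin k)) K]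
    [IsManifold (𝓡 k) ∞ K] {e : K → EuclideanSpace ℝ (Fin m)}
    (he : IsSmoothEmbedding (𝓡 k) 𝓘(ℝ, EuclideanSpace ℝ (Fin m)) ∞ e)
    (hsub : range e ⊆ range ι) {p : M} (hp : (𝓡∂ n).IsInteriorPoint p) (hpe : ι p ∈ range e) :
    ∃ (g : EuclideanSpace ℝ (Fin k) → EuclideanSpace ℝ (Fin n)) (x₀ : EuclideanSpace ℝ (Fin k)),
      ContDiffAt ℝ 1 g x₀ ∧ Function.Injective (fderiv ℝ g x₀) ∧
      g x₀ = extChartAt (𝓡∂ n) p p ∧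
      (∀ᶠ x in 𝓝 x₀, ι ((extChartAt (𝓡∂ n) p).symm (g x)) ∈ range e) ∧
      ∀ s ∈ 𝓝 x₀, ∀ᶠ a in 𝓝 p, ι a ∈ range e →
        ∃ x ∈ s, (extChartAt (𝓡∂ n) p).symm (g x) = a := by
  obtain ⟨x, hx⟩ := hpe
  choose γ hγ using fun y => hsub (mem_range_self y)
  have hγx : γ x = p := hι.isEmbedding.injective (by rw [hγ, hx])
  have hcomp : ι ∘ γ = e := funext hγ
  have hγemb : IsEmbedding γ := by
    refine IsEmbedding.of_comp ?_ hι.isEmbedding.continuous (by rw [hcomp]; exact he.isEmbedding)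
    rw [hι.isEmbedding.continuous_iff, hcomp]
    exact he.isEmbedding.continuous
  have hγsmooth : ContMDiffAt (𝓡 k) (𝓡∂ n) ∞ γ x := by
    rw [ContMDiffAt.iff_comp_isImmersionAt (hι.isImmersion.isImmersionAt (γ x)), hcomp]
    exact ⟨hγemb.continuous.continuousAt, he.contMDiff x⟩
  have h := he.isImmersion.isImmersionAt x
  set κ := h.domChart
  set ψ := h.codChart
  set φ := extChartAt (𝓡∂ n) p
  have hxκ : x ∈ κ.source := h.mem_domChart_source
  have hκsymm : κ.symm (κ x) = x := κ.left_inv hxκ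
  have hφp : p ∈ φ.source := mem_extChartAt_source p
  let g := φ ∘ γ ∘ κ.symm
  have hgx : g (κ x) = φ p := by simp only [g, Function.comp_apply, hκsymm, hγx]
  have hsymm : ContMDiffAt (𝓡 k) (𝓡 k) ∞ κ.symm (κ x) :=
    contMDiffAt_symm_of_mem_maximalAtlas h.domChart_mem_maximalAtlas (κ.map_source hxκ)
  have hgsmooth : ContDiffAt ℝ ∞ g (κ x) := by
    rw [← contMDiffAt_iff_contDiffAt]
    have h1 : ContMDiffAt (𝓡 k) (𝓡∂ n) ∞ (γ ∘ κ.symm) (κ x) :=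
      ContMDiffAt.comp (κ x) (by rw [hκsymm]; exact hγsmooth) hsymm
    have h2 : ContMDiffAt (𝓡∂ n) 𝓘(ℝ, EuclideanSpace ℝ (Fin n)) ∞ φ ((γ ∘ κ.symm) (κ x)) := by
      rw [Function.comp_apply, hκsymm, hγx]
      exact contMDiffAt_extChartAt
    exact h2.comp (κ x) h1
  have hev : ∀ᶠ z in 𝓝 (κ x), z ∈ κ.target ∧ γ (κ.symm z) ∈ φ.source := by
    refine Filter.Eventually.and (κ.open_target.mem_nhds (κ.map_source hxκ)) ?_
    have hc : ContinuousAt (γ ∘ κ.symm) (κ x) :=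
      hγemb.continuous.continuousAt.comp hsymm.continuousAt
    refine hc.preimage_mem_nhds ?_
    rw [Function.comp_apply, hκsymm, hγx]
    exact extChartAt_source_mem_nhds p
  -- In the slice charts `e` is a linear inclusion, so the first slice coordinate of `ι` undoes γ up
  -- to the chart κ.
  let G : M → EuclideanSpace ℝ (Fin k) := fun a => (h.equiv.symm (ψ (ι a))).1
  have hGγ : ∀ y ∈ κ.source, G (γ y) = κ y := by
    intro y hy
    have hy' : y ∈ (κ.extend (𝓡 k)).source := by rwa [κ.extend_source]
    have h1 : ψ (e y) = h.equiv (κ y, 0) := by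
      have := h.writtenInCharts ((κ.extend (𝓡 k)).map_source hy')
      simp only [Function.comp_apply] at this
      rw [(κ.extend (𝓡 k)).left_inv hy'] at this
      exact this
    simp only [G, hγ, h1, ContinuousLinearEquiv.symm_apply_apply]
  have hGsmooth : ContMDiffAt (𝓡∂ n) (𝓡 k) ∞ G p := by
    have h1 : ContMDiffAt 𝓘(ℝ, EuclideanSpace ℝ (Fin m)) 𝓘(ℝ, EuclideanSpace ℝ (Fin m)) ∞ ψ
        (ι p) := by
      refine contMDiffAt_of_mem_maximalAtlas h.codChart_mem_maximalAtlas ?_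
      rw [← hγx, hγ]
      exact h.mem_codChart_source
    have h2 : ContDiff ℝ ∞ (fun v => (h.equiv.symm v).1) := by fun_prop
    exact h2.contMDiff.contMDiffAt.comp p (h1.comp p (hι.contMDiff p))
  have hL : DifferentiableAt ℝ (G ∘ φ.symm) (φ p) := by
    have h1 : ContMDiffWithinAt 𝓘(ℝ, EuclideanSpace ℝ (Fin n)) (𝓡∂ n) ∞ φ.symm
        (range (𝓡∂ n)) (φ p) := contMDiffWithinAt_extChartAt_symm_range p (mem_extChartAt_target p)
    have h2 := h1.contMDiffAt (mem_interior_iff_mem_nhds.1 hp)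
    have h3 : ContMDiffAt 𝓘(ℝ, EuclideanSpace ℝ (Fin n)) (𝓡 k) ∞ (G ∘ φ.symm) (φ p) :=
      ContMDiffAt.comp (φ p) (by rw [extChartAt_to_inv]; exact hGsmooth) h2
    exact (contMDiffAt_iff_contDiffAt.1 h3).differentiableAt (by simp)
  have hLg : (G ∘ φ.symm) ∘ g =ᶠ[𝓝 (κ x)] id := by
    filter_upwards [hev] with z hz
    simp only [g, Function.comp_apply, φ.left_inv hz.2, id]
    rw [hGγ _ (κ.map_target hz.1), κ.right_inv hz.1]
  refine ⟨g, κ x, hgsmooth.of_le (by simp), ?_, hgx, ?_, ?_⟩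
  · have h1 : fderiv ℝ ((G ∘ φ.symm) ∘ g) (κ x) = ContinuousLinearMap.id ℝ _ := by
      rw [hLg.fderiv_eq, fderiv_id]
    rw [fderiv_comp _ (by rw [hgx]; exact hL) (hgsmooth.differentiableAt (by simp))] at h1
    exact Function.LeftInverse.injective fun v => congr($h1 v)
  · filter_upwards [hev] with z hz
    simp only [g, Function.comp_apply, φ.left_inv hz.2, hγ]
    exact mem_range_self _
  · intro s hs
    -- Here γ being a topological embedding is needed: a point of the submanifold close to `p` in
    -- `M` must come from a parameter close to `x`.
    have h1 : κ ⁻¹' s ∩ κ.source ∈ 𝓝 x :=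
      inter_mem ((κ.continuousAt hxκ).preimage_mem_nhds hs) (κ.open_source.mem_nhds hxκ)
    rw [hγemb.isInducing.nhds_eq_comap, hγx] at h1
    obtain ⟨U, hU, hUs⟩ := h1
    filter_upwards [hU, extChartAt_source_mem_nhds (I := 𝓡∂ n) p] with a haU haφ ⟨y, hy⟩
    have hya : γ y = a := hι.isEmbedding.injective (by rw [hγ, hy])
    have hyU := hUs (show y ∈ γ ⁻¹' U by rw [mem_preimage, hya]; exact haU)
    refine ⟨κ y, hyU.1, ?_⟩
    simp only [g, Function.comp_apply, κ.left_inv hyU.2, hya]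
    exact φ.left_inv haφ

theorem exists_isAdaptedChart {m : ℕ} [IsManifold (𝓡∂ n) ∞ M]
    [RiemannianBundle (fun x : M => TangentSpace (𝓡∂ n) x)]
    [IsContMDiffRiemannianBundle (𝓡∂ n) ∞ (EuclideanSpace ℝ (Fin n))
      (fun x : M => TangentSpace (𝓡∂ n) x)] [IsRiemannianManifold (𝓡∂ n) M]
    {ι : M → EuclideanSpace ℝ (Fin m)}
    (hι : IsSmoothEmbedding (𝓡∂ n) 𝓘(ℝ, EuclideanSpace ℝ (Fin m)) ∞ ι)
    {K : Type*} [TopologicalSpace K] [ChartedSpace (EuclideanSpace ℝ (Fin k)) K]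
    [IsManifold (𝓡 k) ∞ K] {e : K → EuclideanSpace ℝ (Fin m)}
    (he : IsSmoothEmbedding (𝓡 k) 𝓘(ℝ, EuclideanSpace ℝ (Fin m)) ∞ e)
    (hsub : range e ⊆ range ι) {p : M} (hp : (𝓡∂ n).IsInteriorPoint p) (hpe : ι p ∈ range e)
    (hdim : k + d = n) :
    ∃ (Φ : EuclideanSpace ℝ (Fin k) × EuclideanSpace ℝ (Fin d) → M) (ρ : ℝ) (C : ℝ≥0), 0 < ρ ∧
      Φ 0 = p ∧ IsAdaptedChart (n := n) (ι ⁻¹' range e) Φ ρ C := by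
  have := isContinuousRiemannianBundle_of_contMDiff (I := 𝓡∂ n) (M := M)
  obtain ⟨g, x₀, hg, hinj, hgp, hgL, hLg⟩ :=
    exists_coordinates_of_isSmoothEmbedding hι he hsub hp hpe
  obtain ⟨F, C₁, s₁, hs₁, hF0, hFsmooth, hFlip, hFanti, hFmap⟩ :=
    exists_straightening (W := EuclideanSpace ℝ (Fin d)) (by simpa using hdim) hg hinj
  obtain ⟨C₂, s₂, hs₂, hs₂t, hlip, hanti, hder⟩ :=
    exists_interior_chart_comparison (I := 𝓡∂ n) hp
  set φ := extChartAt (𝓡∂ n) p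
  have hrange : range (𝓡∂ n) ∈ 𝓝 (φ p) := mem_interior_iff_mem_nhds.1 hp
  have hF0' : F 0 = φ p := by
    have := hF0 0
    rw [add_zero, hgp] at this
    exact this
  rw [hgp] at hFmap
  have hmap : map (φ.symm ∘ F) (𝓝 0) = 𝓝 p := by
    rw [← Filter.map_map, hFmap, ← nhdsWithin_eq_nhds.2 hrange]
    exact map_extChartAt_symm_nhdsWithin_range p
  have hΦ0 : (φ.symm ∘ F) 0 = p := by
    simp only [Function.comp_apply, hF0']
    exact extChartAt_to_inv p
  have htend : Tendsto (φ.symm ∘ F) (𝓝 0) (𝓝 p) := hmap.le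
  have hFtend : Tendsto F (𝓝 0) (𝓝 (φ p)) := hFmap.le
  obtain ⟨ρ₁, hρ₁, hball⟩ := Metric.mem_nhds_iff.1
    (inter_mem hs₁ (hFtend (interior_mem_nhds.2 hs₂)))
  obtain ⟨ρ₂, hρ₂, hballL⟩ := Metric.mem_nhds_iff.1 hgL
  obtain ⟨σ, hσ, hσL⟩ := Metric.mem_nhds_iff.1 (hLg _ (Metric.ball_mem_nhds x₀ hρ₁))
  obtain ⟨ρ₃, hρ₃, hball₃⟩ := Metric.mem_nhds_iff.1 (htend (Metric.ball_mem_nhds p (half_pos hσ)))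
  -- This constant serves only `norm_snd_le` for points of `L` far from `p`: these have distance at
  -- least `σ / 2` from the chart image, while the coordinates stay below `ρ₁`.
  set C₃ : ℝ≥0 := Real.toNNReal (ρ₁ / (σ / 2)) with hC₃
  have hC₃' : (C₃ : ℝ) = ρ₁ / (σ / 2) := Real.coe_toNNReal _ (by positivity)
  have hanti' : ∀ q ∈ Metric.ball 0 ρ₁, ∀ q' ∈ Metric.ball 0 ρ₁,
      edist q q' ≤ (C₁ * C₂ + C₃ : ℝ≥0) * edist ((φ.symm ∘ F) q) ((φ.symm ∘ F) q') := by
    intro q hq q' hq'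
    calc edist q q' ≤ C₁ * edist (F q) (F q') := hFanti q (hball hq).1 q' (hball hq').1
      _ ≤ C₁ * (C₂ * edist ((φ.symm ∘ F) q) ((φ.symm ∘ F) q')) := by
        gcongr
        exact hanti _ (interior_subset (hball hq).2) _ (interior_subset (hball hq').2)
      _ = (C₁ * C₂ : ℝ≥0) * edist ((φ.symm ∘ F) q) ((φ.symm ∘ F) q') := by
        rw [ENNReal.coe_mul, mul_assoc]
      _ ≤ _ := by gcongr; exact le_self_add
  set ρ := min ρ₁ (min ρ₂ ρ₃)
  have hρ : 0 < ρ := lt_min hρ₁ (lt_min hρ₂ hρ₃)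
  have hb₁ {q : EuclideanSpace ℝ (Fin k) × EuclideanSpace ℝ (Fin d)} (hq : q ∈ Metric.ball 0 ρ) :
      q ∈ Metric.ball 0 ρ₁ := Metric.ball_subset_ball (min_le_left _ _) hq
  have hb₃ {q : EuclideanSpace ℝ (Fin k) × EuclideanSpace ℝ (Fin d)} (hq : q ∈ Metric.ball 0 ρ) :
      q ∈ Metric.ball 0 ρ₃ :=
    Metric.ball_subset_ball ((min_le_right _ _).trans (min_le_right _ _)) hq
  have hdiff : ∀ f : M → ℝ, ContMDiff (𝓡∂ n) 𝓘(ℝ, ℝ) ∞ f → ∀ q ∈ Metric.ball 0 ρ,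
      ContDiffAt ℝ 1 (f ∘ φ.symm) (F q) := by
    intro f hf q hq
    have hq2 : φ.target ∈ 𝓝 (F q) :=
      mem_of_superset (mem_interior_iff_mem_nhds.1 (hball (hb₁ hq)).2) hs₂t
    have h1 : ContMDiffAt 𝓘(ℝ, EuclideanSpace ℝ (Fin n)) (𝓡∂ n) ∞ φ.symm (F q) :=
      (contMDiffOn_extChartAt_symm p).contMDiffAt hq2
    exact (contMDiffAt_iff_contDiffAt.1 (hf.contMDiffAt.comp _ h1)).of_le (by simp)
  refine ⟨φ.symm ∘ F, ρ, C₁ * C₂ + C₃, hρ, hΦ0, ?_, ?_, ?_, ?_, ?_, ?_, ?_⟩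
  · intro f hf q hq
    exact (hdiff f hf q hq).comp q (hFsmooth q (hball (hb₁ hq)).1)
  · intro f hf q hq
    have hFq : ‖fderiv ℝ F q‖ₑ ≤ C₁ := by
      have := norm_fderiv_le_of_lipschitzOn ℝ
        (mem_of_superset (Metric.isOpen_ball.mem_nhds hq) fun q hq => (hball (hb₁ hq)).1) hFlip
      simp only [enorm, nnnorm]
      exact_mod_cast this
    rw [← Function.comp_assoc, fderiv_comp q ((hdiff f hf q hq).differentiableAt one_ne_zero)
      ((hFsmooth q (hball (hb₁ hq)).1).differentiableAt one_ne_zero)]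
    calc _ ≤ ‖fderiv ℝ (f ∘ φ.symm) (F q)‖ₑ * ‖fderiv ℝ F q‖ₑ :=
          ContinuousLinearMap.opENorm_comp_le _ _
      _ ≤ (C₂ * ‖gradNorm (n := n) f (φ.symm (F q))‖ₑ) * C₁ := by
        gcongr
        refine (hder f _ (interior_subset (hball (hb₁ hq)).2)
          (hf.mdifferentiable (by simp) _)).trans_eq ?_
        congr 1
        exact (enorm_norm _).symm
      _ = (C₁ * C₂ : ℝ≥0) * ‖gradNorm (n := n) f (φ.symm (F q))‖ₑ := by
        rw [ENNReal.coe_mul]; ring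
      _ ≤ _ := mul_le_mul' (ENNReal.coe_le_coe.2 le_self_add) le_rfl
  · intro q hq q' hq'
    calc edist ((φ.symm ∘ F) q) ((φ.symm ∘ F) q') ≤ C₂ * edist (F q) (F q') :=
          hlip _ (interior_subset (hball (hb₁ hq)).2) _ (interior_subset (hball (hb₁ hq')).2)
      _ ≤ C₂ * (C₁ * edist q q') := by
        gcongr
        exact hFlip (hball (hb₁ hq)).1 (hball (hb₁ hq')).1
      _ = (C₁ * C₂ : ℝ≥0) * edist q q' := by rw [ENNReal.coe_mul]; ring
      _ ≤ _ := by gcongr; exact le_self_add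
  · exact fun q hq q' hq' => hanti' q (hb₁ hq) q' (hb₁ hq')
  · intro x hx
    rw [mem_preimage, Function.comp_apply, hF0]
    refine hballL ?_
    simpa using hx.trans_le ((min_le_right _ _).trans (min_le_left _ _))
  · intro q hq a ha
    by_cases haσ : a ∈ Metric.ball p σ
    · obtain ⟨x, hx, hxa⟩ := hσL haσ ha
      have hq' : ((x - x₀, 0) : EuclideanSpace ℝ (Fin k) × EuclideanSpace ℝ (Fin d)) ∈
          Metric.ball 0 ρ₁ := by
        rw [mem_ball_zero_iff, Prod.norm_mk, norm_zero, max_eq_left (norm_nonneg _),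
          ← dist_eq_norm]
        exact hx
      have hΦ : (φ.symm ∘ F) (x - x₀, 0) = a := by
        rw [Function.comp_apply, hF0, add_sub_cancel, hxa]
      have h1 := hanti' q (hb₁ hq) _ hq'
      rw [hΦ, edist_nndist, edist_nndist] at h1
      have h2 : dist q (x - x₀, 0) ≤ (C₁ * C₂ + C₃ : ℝ≥0) * dist ((φ.symm ∘ F) q) a := by
        exact_mod_cast h1
      refine le_trans ?_ h2
      rw [dist_eq_norm]
      exact le_trans (by simp) (norm_snd_le (q - (x - x₀, 0)))
    · have h1 : σ / 2 ≤ dist ((φ.symm ∘ F) q) a := by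
        have h2 : dist ((φ.symm ∘ F) q) p < σ / 2 := hball₃ (hb₃ hq)
        have h3 : σ ≤ dist a p := not_lt.1 haσ
        have h4 := dist_triangle_left a p ((φ.symm ∘ F) q)
        linarith
      have h2 : ‖q‖ < ρ₁ := by simpa using hb₁ hq
      calc ‖q.2‖ ≤ ρ₁ := (norm_snd_le q).trans h2.le
        _ = C₃ * (σ / 2) := by rw [hC₃']; field_simp
        _ ≤ (C₁ * C₂ + C₃ : ℝ≥0) * dist ((φ.symm ∘ F) q) a := by
          push_cast
          gcongr
          exact le_add_of_nonneg_left (by positivity)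
  · rw [hΦ0, ← hmap]
    exact image_mem_map (Metric.ball_mem_nhds _ hρ)

end Adapted
end GluedManifold

namespace GluedManifold

/-! ### An estimate along rays -/

section Rays

/-- This stands in for the Cauchy–Schwarz inequality. It also holds for `c = 0` and `c = ∞`, so no
positivity or finiteness of the weight is needed later. -/
theorem ENNReal_le_mul_sq_add_inv (c G : ℝ≥0∞) : G ≤ c * G ^ 2 + c⁻¹ := by
  rcases le_or_gt G c⁻¹ with h | h
  · exact h.trans le_add_self
  · have h1 : 1 ≤ c * G := by
      have hc : c ≠ 0 := by rintro rfl; simp at h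
      rcases eq_or_ne c ∞ with rfl | hc'
      · have : G ≠ 0 := by rintro rfl; simp at h
        rw [ENNReal.top_mul this]; exact le_top
      · rw [← ENNReal.mul_inv_cancel hc hc']
        gcongr
    calc G = 1 * G := (one_mul G).symm
      _ ≤ c * G * G := by gcongr
      _ = c * G ^ 2 := by ring
      _ ≤ _ := le_self_add

/-- The closed spherical shell of inner radius `r / 2` and outer radius `r`. -/
def shell (W : Type*) [NormedAddCommGroup W] (r : ℝ) : Set W := {z | r / 2 ≤ ‖z‖ ∧ ‖z‖ ≤ r}

variable {W : Type*} [NormedAddCommGroup W]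

theorem measurableSet_shell [MeasurableSpace W] [OpensMeasurableSpace W] (r : ℝ) :
    MeasurableSet (shell W r) :=
  ((isClosed_le continuous_const continuous_norm).inter
    (isClosed_le continuous_norm continuous_const)).measurableSet

/-- With s = ‖y‖ / r, the point lies in the shell exactly for s ≤ τ ≤ 2s, an interval of length s on
which the integrand is at most 1/s. -/
theorem lintegral_inv_shell_le {r : ℝ} (hr : 0 < r) (y : W) :
    ∫⁻ τ in Ioc (0 : ℝ) 1, (shell W (τ * r)).indicator (fun _ => ENNReal.ofReal τ⁻¹) y ≤
      (Metric.closedBall (0 : W) r).indicator 1 y := by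
  set s := ‖y‖ / r with hs
  have hmem : ∀ τ : ℝ, y ∈ shell W (τ * r) ↔ s ≤ τ ∧ τ ≤ 2 * s := by
    intro τ
    simp only [shell, mem_ofPred_eq, hs]
    rw [div_le_iff₀ hr, ← mul_div_assoc, le_div_iff₀ hr]
    constructor
    · rintro ⟨h1, h2⟩; exact ⟨h2, by linarith⟩
    · rintro ⟨h1, h2⟩; exact ⟨by linarith, h1⟩
  by_cases hy : y ∈ Metric.closedBall (0 : W) r
  · rw [indicator_of_mem hy, Pi.one_apply]
    rcases eq_or_lt_of_le (show 0 ≤ s by positivity) with h0 | h0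
    · have : ∀ τ ∈ Ioc (0 : ℝ) 1,
          (shell W (τ * r)).indicator (fun _ => ENNReal.ofReal τ⁻¹) y = 0 := by
        intro τ hτ
        refine indicator_of_notMem (fun h => ?_) _
        have := ((hmem τ).1 h).2
        have := hτ.1
        linarith
      rw [setLIntegral_congr_fun measurableSet_Ioc this]
      simp
    · calc ∫⁻ τ in Ioc (0 : ℝ) 1, (shell W (τ * r)).indicator (fun _ => ENNReal.ofReal τ⁻¹) y
          ≤ ∫⁻ τ, (Icc s (2 * s)).indicator (fun _ => ENNReal.ofReal s⁻¹) τ := by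
            refine (setLIntegral_le_lintegral _ _).trans (lintegral_mono fun τ => ?_)
            by_cases hτ : y ∈ shell W (τ * r)
            · have h := (hmem τ).1 hτ
              rw [indicator_of_mem hτ, indicator_of_mem (show τ ∈ Icc s (2 * s) from h)]
              exact ENNReal.ofReal_le_ofReal (inv_anti₀ h0 h.1)
            · rw [indicator_of_notMem hτ]; exact zero_le
        _ = 1 := by
            rw [lintegral_indicator_const measurableSet_Icc, Real.volume_Icc,
              ← ENNReal.ofReal_mul (by positivity), show s⁻¹ * (2 * s - s) = 1 by field_simp; ring,
              ENNReal.ofReal_one]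
  · rw [indicator_of_notMem hy]
    have : ∀ τ ∈ Ioc (0 : ℝ) 1,
        (shell W (τ * r)).indicator (fun _ => ENNReal.ofReal τ⁻¹) y = 0 := by
      intro τ hτ
      refine indicator_of_notMem (fun h => hy ?_) _
      rw [mem_closedBall_zero_iff]
      exact h.2.trans (mul_le_of_le_one_left hr.le hτ.2)
    rw [setLIntegral_congr_fun measurableSet_Ioc this]
    simp

variable [NormedSpace ℝ W]

theorem smul_mem_shell_iff {τ r : ℝ} (hτ : 0 < τ) {z : W} :
    τ • z ∈ shell W (τ * r) ↔ z ∈ shell W r := by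
  simp only [shell, mem_ofPred_eq, norm_smul, Real.norm_eq_abs, abs_of_pos hτ, mul_div_assoc,
    mul_le_mul_iff_right₀ hτ]

/-- The bound integrates over all of (0, 1], so it does not depend on the point `s` where the ray
stops. -/
theorem enorm_sub_le_lintegral_ray {V : Type*} [NormedAddCommGroup V] [NormedSpace ℝ V]
    {f : V × W → ℝ} {q : V × W} {r : ℝ} (hq : ‖q.2‖ ≤ r) {s : ℝ} (hs0 : 0 < s) (hs1 : s ≤ 1)
    (hf : ∀ τ ∈ Icc s 1, ContDiffAt ℝ 1 f (q.1, τ • q.2)) :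
    ‖f q - f (q.1, s • q.2)‖ₑ ≤
      ENNReal.ofReal r * ∫⁻ τ in Ioc (0 : ℝ) 1, ‖fderiv ℝ f (q.1, τ • q.2)‖ₑ := by
  let γ : ℝ → V × W := fun τ => (q.1, τ • q.2)
  have hγ : ∀ τ, HasDerivAt γ (0, q.2) τ := by
    intro τ
    have := (hasDerivAt_const τ q.1).prodMk ((hasDerivAt_id τ).smul_const q.2)
    simpa using this
  have hcd : ContDiffOn ℝ 1 (f ∘ γ) (Icc s 1) := by
    intro τ hτ
    have h1 : ContDiffAt ℝ 1 γ τ := by fun_prop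
    exact ((hf τ hτ).comp τ h1).contDiffWithinAt
  have h1 : γ 1 = q := by simp [γ]
  calc ‖f q - f (q.1, s • q.2)‖ₑ = ‖(f ∘ γ) 1 - (f ∘ γ) s‖ₑ := by
        rw [Function.comp_apply, h1]; rfl
    _ ≤ ∫⁻ τ in Icc s 1, ‖deriv (f ∘ γ) τ‖ₑ :=
        enorm_sub_le_lintegral_deriv_of_contDiffOn_Icc hcd hs1
    _ ≤ ∫⁻ τ in Icc s 1, ENNReal.ofReal r * ‖fderiv ℝ f (q.1, τ • q.2)‖ₑ := by
        refine setLIntegral_mono' measurableSet_Icc fun τ hτ => ?_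
        have hfd := ((hf τ hτ).differentiableAt one_ne_zero).hasFDerivAt.comp_hasDerivAt τ (hγ τ)
        rw [hfd.deriv, mul_comm]
        refine (ContinuousLinearMap.le_opENorm _ _).trans (mul_le_mul' le_rfl ?_)
        rw [← ofReal_norm]
        refine ENNReal.ofReal_le_ofReal ?_
        rw [Prod.norm_mk, norm_zero, max_eq_right (norm_nonneg _)]
        exact hq
    _ = ENNReal.ofReal r * ∫⁻ τ in Icc s 1, ‖fderiv ℝ f (q.1, τ • q.2)‖ₑ :=
        lintegral_const_mul' _ _ ENNReal.ofReal_ne_top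
    _ ≤ _ := by
        gcongr

/-! ### Integration over dilated shells -/

variable [MeasureSpace W] [BorelSpace W]

theorem measurable_comp_smul_snd {H : W → ℝ≥0∞} (hH : Measurable H) :
    Measurable (fun p : W × ℝ => H (p.2 • p.1)) :=
  hH.comp (continuous_snd.smul continuous_fst).measurable

variable [FiniteDimensional ℝ W] [(volume : Measure W).IsAddHaarMeasure]

theorem lintegral_comp_smul {τ : ℝ} (hτ : 0 < τ) {H : W → ℝ≥0∞} (hH : Measurable H) :
    ∫⁻ z, H (τ • z) = ENNReal.ofReal ((τ ^ Module.finrank ℝ W)⁻¹) * ∫⁻ z, H z := by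
  have h := Measure.map_addHaar_smul (volume : Measure W) hτ.ne'
  rw [← lintegral_map hH (measurable_const_smul τ), h, lintegral_smul_measure,
    abs_of_pos (by positivity)]
  rfl

theorem setLIntegral_shell_comp_smul {τ : ℝ} (hτ : 0 < τ) (r : ℝ) {H : W → ℝ≥0∞}
    (hH : Measurable H) :
    ∫⁻ z in shell W r, H (τ • z) =
      ENNReal.ofReal ((τ ^ Module.finrank ℝ W)⁻¹) * ∫⁻ z in shell W (τ * r), H z := by
  rw [← lintegral_indicator (measurableSet_shell r),
    ← lintegral_indicator (measurableSet_shell (τ * r)),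
    ← lintegral_comp_smul hτ (hH.indicator (measurableSet_shell _))]
  congr 1 with z
  by_cases hz : z ∈ shell W r
  · rw [indicator_of_mem hz, indicator_of_mem ((smul_mem_shell_iff hτ).2 hz)]
  · rw [indicator_of_notMem hz, indicator_of_notMem (fun h => hz ((smul_mem_shell_iff hτ).1 h))]

/-- This replaces polar coordinates. Dilation by τ has Jacobian factor τ^(-(d+1)), so the weight τᵈ
leaves 1/τ, whose integral over the shells containing a given point is at most 1. -/
theorem lintegral_shell_lintegral_smul_le {d : ℕ} (hd : Module.finrank ℝ W = d + 1) {r : ℝ}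
    (hr : 0 < r) {H : W → ℝ≥0∞} (hH : Measurable H) :
    ∫⁻ z in shell W r, ∫⁻ τ in Ioc (0 : ℝ) 1, ENNReal.ofReal (τ ^ d) * H (τ • z) ≤
      ∫⁻ y in Metric.closedBall 0 r, H y := by
  have hm : Measurable (fun p : W × ℝ => ENNReal.ofReal (p.2 ^ d) * H (p.2 • p.1)) :=
    (by fun_prop : Measurable fun p : W × ℝ => ENNReal.ofReal (p.2 ^ d)).mul
      (measurable_comp_smul_snd hH)
  have hset : MeasurableSet {p : ℝ × W | p.2 ∈ shell W (p.1 * r)} := by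
    have h1 : IsClosed {p : ℝ × W | p.1 * r / 2 ≤ ‖p.2‖} :=
      isClosed_le (by fun_prop) (by fun_prop)
    have h2 : IsClosed {p : ℝ × W | ‖p.2‖ ≤ p.1 * r} :=
      isClosed_le (by fun_prop) (by fun_prop)
    exact (h1.inter h2).measurableSet
  have hm2 : Measurable (fun p : ℝ × W =>
      (shell W (p.1 * r)).indicator (fun _ => ENNReal.ofReal p.1⁻¹) p.2 * H p.2) := by
    refine Measurable.mul ?_ (hH.comp measurable_snd)
    exact (by fun_prop : Measurable fun p : ℝ × W => ENNReal.ofReal p.1⁻¹).indicator hset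
  calc ∫⁻ z in shell W r, ∫⁻ τ in Ioc (0 : ℝ) 1, ENNReal.ofReal (τ ^ d) * H (τ • z)
      = ∫⁻ τ in Ioc (0 : ℝ) 1, ∫⁻ z in shell W r, ENNReal.ofReal (τ ^ d) * H (τ • z) :=
        lintegral_lintegral_swap hm.aemeasurable
    _ = ∫⁻ τ in Ioc (0 : ℝ) 1, ∫⁻ y,
          (shell W (τ * r)).indicator (fun _ => ENNReal.ofReal τ⁻¹) y * H y := by
        refine setLIntegral_congr_fun measurableSet_Ioc fun τ hτ => ?_
        have hτ0 : 0 < τ := hτ.1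
        rw [lintegral_const_mul _
          (show Measurable fun z : W => H (τ • z) from hH.comp (measurable_const_smul τ)),
          setLIntegral_shell_comp_smul hτ0 r hH, ← mul_assoc,
          ← ENNReal.ofReal_mul (by positivity), hd,
          show τ ^ d * (τ ^ (d + 1))⁻¹ = τ⁻¹ by field_simp; ring,
          ← lintegral_const_mul _ hH, ← lintegral_indicator (measurableSet_shell _)]
        congr 1 with y
        by_cases hy : y ∈ shell W (τ * r) <;> simp [hy]
    _ = ∫⁻ y, ∫⁻ τ in Ioc (0 : ℝ) 1,
          (shell W (τ * r)).indicator (fun _ => ENNReal.ofReal τ⁻¹) y * H y :=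
        lintegral_lintegral_swap hm2.aemeasurable
    _ ≤ ∫⁻ y, (Metric.closedBall (0 : W) r).indicator 1 y * H y := by
        refine lintegral_mono fun y => ?_
        rw [lintegral_mul_const]
        · gcongr
          exact lintegral_inv_shell_le hr y
        · exact ((by fun_prop : Measurable fun p : ℝ × W => ENNReal.ofReal p.1⁻¹).indicator
            hset).comp (measurable_id.prodMk measurable_const)
    _ = ∫⁻ y in Metric.closedBall 0 r, H y := by
        rw [← lintegral_indicator Metric.isClosed_closedBall.measurableSet]
        congr 1 with y
        by_cases hy : y ∈ Metric.closedBall (0 : W) r <;> simp [hy]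

variable {V : Type*} [MeasureSpace V] [SFinite (volume : Measure V)]

theorem setLIntegral_prod_shell_comp_smul {τ : ℝ} (hτ : 0 < τ) (r : ℝ) (Q : Set V)
    {H : V × W → ℝ≥0∞} (hH : Measurable H) :
    ∫⁻ q in Q ×ˢ shell W r, H (q.1, τ • q.2) =
      ENNReal.ofReal ((τ ^ Module.finrank ℝ W)⁻¹) * ∫⁻ q in Q ×ˢ shell W (τ * r), H q := by
  have h1 : Measurable fun q : V × W => H (q.1, τ • q.2) :=
    hH.comp (measurable_fst.prodMk (measurable_snd.const_smul τ))
  rw [Measure.volume_eq_prod, setLIntegral_prod _ h1.aemeasurable,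
    setLIntegral_prod _ hH.aemeasurable, ← lintegral_const_mul _ hH.lintegral_prod_right']
  congr 1 with x
  exact setLIntegral_shell_comp_smul hτ r (hH.comp measurable_prodMk_left)

/-- The quadratic inequality is applied with c = a τᵈ w. The factor τᵈ is exactly what the first
term needs to become the energy; in the second, τ^(-d) times the Jacobian factor τ^(-(d+1)) gives
τ^(-(2d+1)). -/
theorem lintegral_rays_le {d : ℕ} (hd : Module.finrank ℝ W = d + 1) {r : ℝ} (hr : 0 < r)
    (Q : Set V) {G w : V × W → ℝ≥0∞} (hG : Measurable G) (hw : Measurable w) {a : ℝ≥0∞}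
    (ha0 : a ≠ 0) (ha : a ≠ ⊤) :
    ∫⁻ q in Q ×ˢ shell W r, ∫⁻ τ in Ioc (0 : ℝ) 1, G (q.1, τ • q.2) ≤
      a * (∫⁻ q in Q ×ˢ Metric.closedBall 0 r, w q * G q ^ 2) +
      a⁻¹ * ∫⁻ τ in Ioc (0 : ℝ) 1, ENNReal.ofReal ((τ ^ (2 * d + 1))⁻¹) *
        ∫⁻ q in Q ×ˢ shell W (τ * r), (w q)⁻¹ := by
  have hmap : Measurable fun p : (V × W) × ℝ => (p.1.1, p.2 • p.1.2) := by fun_prop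
  set H : V × W → ℝ≥0∞ := fun q => w q * G q ^ 2
  have hH : Measurable H := hw.mul (hG.pow_const 2)
  have hF1 : Measurable fun p : (V × W) × ℝ => ENNReal.ofReal (p.2 ^ d) * H (p.1.1, p.2 • p.1.2) :=
    (by fun_prop : Measurable fun p : (V × W) × ℝ => ENNReal.ofReal (p.2 ^ d)).mul (hH.comp hmap)
  have hF2 : Measurable fun p : (V × W) × ℝ =>
      ENNReal.ofReal ((p.2 ^ d)⁻¹) * (w (p.1.1, p.2 • p.1.2))⁻¹ :=
    (by fun_prop : Measurable fun p : (V × W) × ℝ => ENNReal.ofReal ((p.2 ^ d)⁻¹)).mul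
      (hw.comp hmap).inv
  have hpt : ∀ q : V × W, ∀ τ ∈ Ioc (0 : ℝ) 1, G (q.1, τ • q.2) ≤
      a * (ENNReal.ofReal (τ ^ d) * H (q.1, τ • q.2)) +
        a⁻¹ * (ENNReal.ofReal ((τ ^ d)⁻¹) * (w (q.1, τ • q.2))⁻¹) := by
    intro q τ hτ
    have hτd : 0 < τ ^ d := pow_pos hτ.1 d
    have h0 : ENNReal.ofReal (τ ^ d) ≠ 0 := by simpa using hτd
    refine (ENNReal_le_mul_sq_add_inv (a * (ENNReal.ofReal (τ ^ d) * w (q.1, τ • q.2))) _).trans ?_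
    rw [ENNReal.mul_inv (Or.inl ha0) (Or.inl ha),
      ENNReal.mul_inv (Or.inl h0) (Or.inl ENNReal.ofReal_ne_top), ENNReal.ofReal_inv_of_pos hτd]
    refine add_le_add (le_of_eq ?_) le_rfl
    simp only [H]; ring
  calc ∫⁻ q in Q ×ˢ shell W r, ∫⁻ τ in Ioc (0 : ℝ) 1, G (q.1, τ • q.2)
      ≤ ∫⁻ q in Q ×ˢ shell W r, ∫⁻ τ in Ioc (0 : ℝ) 1,
          (a * (ENNReal.ofReal (τ ^ d) * H (q.1, τ • q.2)) +
            a⁻¹ * (ENNReal.ofReal ((τ ^ d)⁻¹) * (w (q.1, τ • q.2))⁻¹)) :=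
        lintegral_mono fun q => setLIntegral_mono' measurableSet_Ioc (hpt q)
    _ = a * (∫⁻ q in Q ×ˢ shell W r, ∫⁻ τ in Ioc (0 : ℝ) 1,
            ENNReal.ofReal (τ ^ d) * H (q.1, τ • q.2)) +
          a⁻¹ * ∫⁻ q in Q ×ˢ shell W r, ∫⁻ τ in Ioc (0 : ℝ) 1,
            ENNReal.ofReal ((τ ^ d)⁻¹) * (w (q.1, τ • q.2))⁻¹ := by
        rw [← lintegral_const_mul _ hF1.lintegral_prod_right',
          ← lintegral_const_mul _ hF2.lintegral_prod_right', ← lintegral_add_left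
            (hF1.lintegral_prod_right'.const_mul a)]
        congr 1 with q
        rw [lintegral_add_left, lintegral_const_mul, lintegral_const_mul]
        · exact hF2.comp measurable_prodMk_left
        · exact hF1.comp measurable_prodMk_left
        · exact (hF1.comp measurable_prodMk_left).const_mul a
    _ ≤ _ := by
        refine add_le_add (mul_le_mul' le_rfl ?_) (mul_le_mul' le_rfl ?_)
        · rw [Measure.volume_eq_prod, setLIntegral_prod _ hF1.lintegral_prod_right'.aemeasurable,
            setLIntegral_prod _ hH.aemeasurable]
          exact lintegral_mono fun x =>
            lintegral_shell_lintegral_smul_le hd hr (hH.comp measurable_prodMk_left)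
        · rw [lintegral_lintegral_swap hF2.aemeasurable]
          refine setLIntegral_mono' measurableSet_Ioc fun τ hτ => ?_
          have hτ0 : 0 < τ := hτ.1
          rw [lintegral_const_mul _ (show Measurable fun q : V × W => (w (q.1, τ • q.2))⁻¹ from
              (hw.comp (by fun_prop)).inv),
            setLIntegral_prod_shell_comp_smul (H := fun q => (w q)⁻¹) hτ0 r Q hw.inv, ← mul_assoc,
            ← ENNReal.ofReal_mul (by positivity), hd]
          refine le_of_eq ?_
          congr 2
          field_simp
          ring

/-- The lower bound for the weighted energy of a function that vanishes on a shell and is bounded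
below, up to an error, on a smaller shell. -/
theorem measure_shell_le_energy {V : Type*} [NormedAddCommGroup V] [NormedSpace ℝ V]
    [MeasureSpace V] [BorelSpace V] [SecondCountableTopology V] [SFinite (volume : Measure V)]
    {d : ℕ} (hd : Module.finrank ℝ W = d + 1)
    {r : ℝ} (hr : 0 < r) {Q : Set V} (hQ : MeasurableSet Q) {f : V × W → ℝ}
    (hf : ∀ q ∈ Q ×ˢ Metric.closedBall 0 r, ContDiffAt ℝ 1 f q)
    (hf0 : ∀ q ∈ Q ×ˢ shell W r, f q = 0) {w e : V × W → ℝ≥0∞} (hw : Measurable w)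
    (he : Measurable e) {s : ℝ} (hs0 : 0 < s) (hs1 : s ≤ 1) {c : ℝ≥0∞}
    (hlow : ∀ q ∈ Q ×ˢ shell W (s * r), c ≤ ‖f q‖ₑ + e q)
    {a b : ℝ≥0∞} (ha0 : a ≠ 0) (ha : a ≠ ⊤) (hb0 : b ≠ 0) (hb : b ≠ ⊤) :
    c * volume (Q ×ˢ shell W r) ≤
      ENNReal.ofReal ((s ^ (d + 1))⁻¹) * (b * (∫⁻ q in Q ×ˢ Metric.closedBall 0 r, w q * e q ^ 2) +
        b⁻¹ * ∫⁻ q in Q ×ˢ shell W (s * r), (w q)⁻¹) +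
      ENNReal.ofReal r * (a * (∫⁻ q in Q ×ˢ Metric.closedBall 0 r, w q * ‖fderiv ℝ f q‖ₑ ^ 2) +
        a⁻¹ * ∫⁻ τ in Ioc (0 : ℝ) 1, ENNReal.ofReal ((τ ^ (2 * d + 1))⁻¹) *
          ∫⁻ q in Q ×ˢ shell W (τ * r), (w q)⁻¹) := by
  have hQA : MeasurableSet (Q ×ˢ shell W r) := hQ.prod (measurableSet_shell r)
  have hQs : MeasurableSet (Q ×ˢ shell W (s * r)) := hQ.prod (measurableSet_shell _)
  have hG : Measurable fun q => ‖fderiv ℝ f q‖ₑ := (measurable_fderiv ℝ f).enorm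
  have hes : Measurable fun q : V × W => e (q.1, s • q.2) := he.comp (by fun_prop)
  have hpt : ∀ q ∈ Q ×ˢ shell W r, c ≤ e (q.1, s • q.2) +
      ENNReal.ofReal r * ∫⁻ τ in Ioc (0 : ℝ) 1, ‖fderiv ℝ f (q.1, τ • q.2)‖ₑ := by
    rintro q ⟨hq1, hq2⟩
    have h1 := hlow (q.1, s • q.2) ⟨hq1, (smul_mem_shell_iff hs0).2 hq2⟩
    have h2 := enorm_sub_le_lintegral_ray (f := f) hq2.2 hs0 hs1 fun τ hτ => by
      refine hf _ ⟨hq1, ?_⟩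
      rw [mem_closedBall_zero_iff, norm_smul, Real.norm_of_nonneg (hs0.le.trans hτ.1)]
      exact (mul_le_of_le_one_left (norm_nonneg _) hτ.2).trans hq2.2
    rw [hf0 q ⟨hq1, hq2⟩, zero_sub, enorm_neg] at h2
    rw [add_comm]
    exact h1.trans (add_le_add h2 le_rfl)
  calc c * volume (Q ×ˢ shell W r) = ∫⁻ q in Q ×ˢ shell W r, c := by
        rw [setLIntegral_const]
    _ ≤ ∫⁻ q in Q ×ˢ shell W r, (e (q.1, s • q.2) +
          ENNReal.ofReal r * ∫⁻ τ in Ioc (0 : ℝ) 1, ‖fderiv ℝ f (q.1, τ • q.2)‖ₑ) :=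
        setLIntegral_mono' hQA hpt
    _ = (∫⁻ q in Q ×ˢ shell W r, e (q.1, s • q.2)) + ENNReal.ofReal r *
          ∫⁻ q in Q ×ˢ shell W r, ∫⁻ τ in Ioc (0 : ℝ) 1, ‖fderiv ℝ f (q.1, τ • q.2)‖ₑ := by
        rw [lintegral_add_left hes, lintegral_const_mul' _ _ ENNReal.ofReal_ne_top]
    _ ≤ _ := by
        refine add_le_add ?_ (mul_le_mul' le_rfl (lintegral_rays_le hd hr Q hG hw ha0 ha))
        -- Transporting the error to the thin shell costs a negative power of `s`. This is harmless,
        -- as `s` stays fixed while the error tends to zero.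
        rw [setLIntegral_prod_shell_comp_smul hs0 r Q he, hd]
        refine mul_le_mul' le_rfl ?_
        calc ∫⁻ q in Q ×ˢ shell W (s * r), e q
            ≤ ∫⁻ q in Q ×ˢ shell W (s * r), (b * (w q * e q ^ 2) + b⁻¹ * (w q)⁻¹) := by
              refine lintegral_mono fun q => (ENNReal_le_mul_sq_add_inv (b * w q) (e q)).trans ?_
              rw [ENNReal.mul_inv (Or.inl hb0) (Or.inl hb), mul_assoc]
          _ = b * (∫⁻ q in Q ×ˢ shell W (s * r), w q * e q ^ 2) +
                b⁻¹ * ∫⁻ q in Q ×ˢ shell W (s * r), (w q)⁻¹ := by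
              have h1 : Measurable fun q => w q * e q ^ 2 := hw.mul (he.pow_const 2)
              have h2 : Measurable fun q => (w q)⁻¹ := hw.inv
              rw [lintegral_add_left (h1.const_mul b), lintegral_const_mul _ h1,
                lintegral_const_mul _ h2]
          _ ≤ _ := by
              refine add_le_add (mul_le_mul' le_rfl (lintegral_mono_set ?_)) le_rfl
              refine prod_mono le_rfl fun z hz => ?_
              rw [mem_closedBall_zero_iff]
              exact hz.2.trans (mul_le_of_le_one_left hr.le hs1)

end Rays
end GluedManifold

namespace GluedManifold

/-! ### Comparison of the volume with Lebesgue measure -/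

section Volume

variable {X : Type*} [NormedAddCommGroup X] [NormedSpace ℝ X] [FiniteDimensional ℝ X]
  [MeasureSpace X] [BorelSpace X]
  {M : Type*} [MetricSpace M] [MeasurableSpace M] [BorelSpace M]

theorem lintegral_comp_eq_lintegral_map [SecondCountableTopology M] {Φ : X → M} {T : Set X}
    (hT : MeasurableSet T) (hΦ : ContinuousOn Φ T) (hinj : InjOn Φ T) (f : M → ℝ≥0∞) :
    ∫⁻ q in T, f (Φ q) =
      ∫⁻ y, f y ∂(Measure.map (T.domRestrict Φ) (Measure.comap Subtype.val volume)) := by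
  have hemb : MeasurableEmbedding (T.domRestrict Φ) := hΦ.measurableEmbedding hT hinj
  rw [hemb.lintegral_map]
  exact (lintegral_subtype_comap hT fun q => f (Φ q)).symm

theorem exists_vol_eq_smul_hausdorffMeasure (n : ℕ) :
    ∃ c : ℝ≥0, c ≠ 0 ∧ ∀ S : Set M, vol M n S = c * μH[n] S :=
  ⟨_, Measure.addHaarScalarFactor_volume_hausdorffMeasure_ne_zero n, fun S => by
    rw [vol, Measure.euclideanHausdorffMeasure_def]; rfl⟩

variable [(volume : Measure X).IsAddHaarMeasure]

theorem exists_volume_eq_smul_hausdorffMeasure {n : ℕ} (hn : Module.finrank ℝ X = n) :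
    ∃ c : ℝ≥0, c ≠ 0 ∧ ∀ S : Set X, (volume : Measure X) S = c * μH[n] S := by
  subst hn
  refine ⟨Measure.addHaarScalarFactor (volume : Measure X) μH[Module.finrank ℝ X],
    (Measure.addHaarScalarFactor_pos_of_isAddHaarMeasure _ _).ne', fun S => ?_⟩
  conv_lhs => rw [Measure.isAddLeftInvariant_eq_smul (volume : Measure X) μH[Module.finrank ℝ X]]
  rfl

/-- Both measures are positive multiples of the Hausdorff measure, which Lipschitz maps enlarge at
most by `C ^ n`; this is applied to `Φ` and to its inverse. -/
theorem exists_volume_comparison {n : ℕ} (hn : Module.finrank ℝ X = n) {Φ : X → M} {B : Set X}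
    {C : ℝ≥0} (hΦ : LipschitzOnWith C Φ B)
    (hΦ' : ∀ q ∈ B, ∀ q' ∈ B, edist q q' ≤ C * edist (Φ q) (Φ q')) :
    ∃ c : ℝ≥0, ∀ S ⊆ B, volume S ≤ c * vol M n (Φ '' S) ∧ vol M n (Φ '' S) ≤ c * volume S := by
  obtain ⟨c₁, hc₁, h₁⟩ := exists_vol_eq_smul_hausdorffMeasure (M := M) n
  obtain ⟨c₂, hc₂, h₂⟩ := exists_volume_eq_smul_hausdorffMeasure hn
  have hinj : InjOn Φ B := by
    intro q hq q' hq' h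
    have := hΦ' q hq q' hq'
    rw [h, edist_self, mul_zero] at this
    exact edist_le_zero.1 this
  refine ⟨c₂ * C ^ n * c₁⁻¹ + c₁ * C ^ n * c₂⁻¹, fun S hS => ⟨?_, ?_⟩⟩
  · have hlip : LipschitzOnWith C (Function.invFunOn Φ B) (Φ '' S) := by
      rintro _ ⟨q, hq, rfl⟩ _ ⟨q', hq', rfl⟩
      rw [hinj.leftInvOn_invFunOn (hS hq), hinj.leftInvOn_invFunOn (hS hq')]
      exact hΦ' q (hS hq) q' (hS hq')
    have himg : Function.invFunOn Φ B '' (Φ '' S) = S :=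
      (hinj.leftInvOn_invFunOn.mono hS).image_image
    have h := hlip.hausdorffMeasure_image_le (d := n) (Nat.cast_nonneg n)
    rw [himg, ENNReal.rpow_natCast] at h
    rw [h₁, h₂]
    calc (c₂ : ℝ≥0∞) * μH[n] S ≤ c₂ * (C ^ n * μH[n] (Φ '' S)) := by gcongr
      _ = ((c₂ * C ^ n * c₁⁻¹ : ℝ≥0) : ℝ≥0∞) * (c₁ * μH[n] (Φ '' S)) := by
        rw [← mul_assoc, ← mul_assoc, ← ENNReal.coe_mul, inv_mul_cancel_right₀ hc₁]
        push_cast; rfl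
      _ ≤ _ := by gcongr; exact le_self_add
  · have h := (hΦ.mono hS).hausdorffMeasure_image_le (d := n) (Nat.cast_nonneg n)
    rw [ENNReal.rpow_natCast] at h
    rw [h₁, h₂]
    calc (c₁ : ℝ≥0∞) * μH[n] (Φ '' S) ≤ c₁ * (C ^ n * μH[n] S) := by gcongr
      _ = ((c₁ * C ^ n * c₂⁻¹ : ℝ≥0) : ℝ≥0∞) * (c₂ * μH[n] S) := by
        rw [← mul_assoc, ← mul_assoc, ← ENNReal.coe_mul, inv_mul_cancel_right₀ hc₂]
        push_cast; rfl
      _ ≤ _ := by gcongr; exact le_add_self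

/-- On `T` the map is a measurable embedding, so the bound on sets is an inequality of measures. The
integrand may be arbitrary, which avoids any measurability question for `gradNorm`. -/
theorem exists_lintegral_comparison [SecondCountableTopology M] {n : ℕ}
    (hn : Module.finrank ℝ X = n) {Φ : X → M} {B : Set X}
    {C : ℝ≥0} (hΦ : LipschitzOnWith C Φ B)
    (hΦ' : ∀ q ∈ B, ∀ q' ∈ B, edist q q' ≤ C * edist (Φ q) (Φ q')) :
    ∃ c : ℝ≥0, ∀ T ⊆ B, MeasurableSet T → MeasurableSet (Φ '' T) ∧ ∀ f : M → ℝ≥0∞,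
      ∫⁻ q in T, f (Φ q) ≤ c * ∫⁻ y in Φ '' T, f y ∂vol M n ∧
      ∫⁻ y in Φ '' T, f y ∂vol M n ≤ c * ∫⁻ q in T, f (Φ q) := by
  obtain ⟨c, hc⟩ := exists_volume_comparison (M := M) hn hΦ hΦ'
  have hinj : InjOn Φ B := by
    intro q hq q' hq' h
    have := hΦ' q hq q' hq'
    rw [h, edist_self, mul_zero] at this
    exact edist_le_zero.1 this
  refine ⟨c, fun T hTB hT => ?_⟩
  have hcont : ContinuousOn Φ T := hΦ.continuousOn.mono hTB
  have hinjT := hinj.mono hTB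
  have hemb : MeasurableEmbedding (T.domRestrict Φ) := hcont.measurableEmbedding hT hinjT
  have himg : MeasurableSet (Φ '' T) := hT.image_of_continuousOn_injOn hcont hinjT
  have hm : ∀ E : Set M, MeasurableSet E →
      Measure.map (T.domRestrict Φ) (Measure.comap Subtype.val volume) E =
        volume (T ∩ Φ ⁻¹' E) := by
    intro E hE
    rw [hemb.map_apply, comap_subtype_coe_apply hT]
    congr 1
    ext q
    simp [and_comm]
  have hset : ∀ E : Set M, Φ '' (T ∩ Φ ⁻¹' E) = E ∩ Φ '' T := fun E => by
    rw [image_inter_preimage, inter_comm]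
  refine ⟨himg, fun f => ?_⟩
  rw [lintegral_comp_eq_lintegral_map hT hcont hinjT]
  constructor
  · have hle : Measure.map (T.domRestrict Φ) (Measure.comap Subtype.val volume) ≤
        (c : ℝ≥0∞) • (vol M n).restrict (Φ '' T) := by
      refine Measure.le_iff.2 fun E hE => ?_
      rw [hm E hE, Measure.smul_apply, Measure.restrict_apply hE, smul_eq_mul, ← hset]
      exact (hc _ (inter_subset_left.trans hTB)).1
    refine (lintegral_mono' hle le_rfl).trans ?_
    rw [lintegral_smul_measure]; rfl
  · have hle : (vol M n).restrict (Φ '' T) ≤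
        (c : ℝ≥0∞) • Measure.map (T.domRestrict Φ) (Measure.comap Subtype.val volume) := by
      refine Measure.le_iff.2 fun E hE => ?_
      rw [Measure.smul_apply, hm E hE, Measure.restrict_apply hE, smul_eq_mul, ← hset]
      exact (hc _ (inter_subset_left.trans hTB)).2
    refine (lintegral_mono' hle le_rfl).trans ?_
    rw [lintegral_smul_measure]; rfl

end Volume
end GluedManifold

namespace GluedManifold

/-! ### Positivity of the capacity -/

section CapacityPos

theorem setLIntegral_weightedVol {M : Type*} [MetricSpace M] [MeasurableSpace M] [BorelSpace M]
    (n : ℕ) {w : M → ℝ} (hw : Measurable w) {S : Set M} (hS : MeasurableSet S) (f : M → ℝ≥0∞) :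
    ∫⁻ y in S, f y ∂weightedVol n w = ∫⁻ y in S, ENNReal.ofReal (w y) * f y ∂vol M n := by
  rw [weightedVol, setLIntegral_withDensity_eq_setLIntegral_mul_non_measurable _
    hw.ennreal_ofReal f hS (Eventually.of_forall fun _ => ENNReal.ofReal_lt_top)]
  rfl

theorem ENNReal_add_sq_le (a b : ℝ≥0∞) : (a + b) ^ 2 ≤ 4 * a ^ 2 + 4 * b ^ 2 := by
  rcases le_total a b with h | h
  · calc (a + b) ^ 2 ≤ (b + b) ^ 2 := by gcongr
      _ = 4 * b ^ 2 := by ring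
      _ ≤ _ := le_add_self
  · calc (a + b) ^ 2 ≤ (a + a) ^ 2 := by gcongr
      _ = 4 * a ^ 2 := by ring
      _ ≤ _ := le_self_add

theorem ENNReal_quarter_add_quarter (x : ℝ≥0∞) : x / 4 + x / 4 = x / 2 := by
  rw [← ENNReal.add_halves (x / 2), div_eq_mul_inv x 4, div_eq_mul_inv (x / 2),
    div_eq_mul_inv x 2, mul_assoc, ← ENNReal.mul_inv (by simp) (by simp)]
  norm_num

theorem ENNReal_exists_mul_inv_le {x κ : ℝ≥0∞} (hx : x ≠ ⊤) (hκ : κ ≠ 0) (hκ' : κ ≠ ⊤) :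
    ∃ a : ℝ≥0∞, a ≠ 0 ∧ a ≠ ⊤ ∧ x * a⁻¹ ≤ κ := by
  -- The summand 1 keeps the witness nonzero when `x = 0`.
  refine ⟨x / κ + 1, by simp, by simp [ENNReal.div_eq_top, hx, hκ], ?_⟩
  rw [← div_eq_mul_inv]
  refine ENNReal.div_le_of_le_mul ?_
  rw [mul_add, ENNReal.mul_div_cancel hκ hκ']
  exact le_self_add

/-- The derivative vanishes on both closed sets, even where they have no interior, because every
point of them is a global extremum of the cut-off. -/
theorem exists_smooth_cutoff {X : Type*} [NormedAddCommGroup X] [NormedSpace ℝ X]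
    [FiniteDimensional ℝ X] {s t : Set X} (hs : IsClosed s) (ht : IsClosed t)
    (hst : Disjoint s t) :
    ∃ χ : X → ℝ, ContDiff ℝ ∞ χ ∧ (∀ q, 0 ≤ χ q ∧ χ q ≤ 1) ∧
      (∀ q ∈ s, χ q = 0 ∧ fderiv ℝ χ q = 0) ∧ ∀ q ∈ t, χ q = 1 ∧ fderiv ℝ χ q = 0 := by
  obtain ⟨χ, h0, h1, h⟩ := exists_contMDiffMap_zero_one_of_isClosed (n := ⊤) 𝓘(ℝ, X) hs ht hst
  refine ⟨χ, χ.contMDiff.contDiff, fun q => h q, fun q hq => ⟨h0 hq, ?_⟩,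
    fun q hq => ⟨h1 hq, ?_⟩⟩
  · refine IsLocalMin.fderiv_eq_zero (Eventually.of_forall fun y => ?_)
    rw [h0 hq]; exact (h y).1
  · refine IsLocalMax.fderiv_eq_zero (Eventually.of_forall fun y => ?_)
    rw [h1 hq]; exact (h y).2

theorem opENorm_add_le {X : Type*} [NormedAddCommGroup X] [NormedSpace ℝ X] (A B : X →L[ℝ] ℝ) :
    ‖A + B‖ₑ ≤ ‖A‖ₑ + ‖B‖ₑ := by
  rw [← ofReal_norm, ← ofReal_norm, ← ofReal_norm,
    ← ENNReal.ofReal_add (norm_nonneg _) (norm_nonneg _)]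
  exact ENNReal.ofReal_le_ofReal (norm_add_le _ _)

theorem opENorm_zero {X : Type*} [NormedAddCommGroup X] [NormedSpace ℝ X] :
    ‖(0 : X →L[ℝ] ℝ)‖ₑ = 0 := by
  rw [← ofReal_norm, norm_zero, ENNReal.ofReal_zero]

/-- In the product rule, the term with the derivative of χ survives only where `v` is bounded by the
error `e`. In the application this is off the support of the competitor, where the approximating
function equals the approximation error. -/
theorem enorm_fderiv_cutoff_mul_sq_le {X : Type*} [NormedAddCommGroup X] [NormedSpace ℝ X]
    {χ v : X → ℝ} {q : X} {B g e : ℝ≥0∞} {P : Prop} [Decidable P]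
    (hχ : DifferentiableAt ℝ χ q) (hv : DifferentiableAt ℝ v q)
    (h01 : 0 ≤ χ q ∧ χ q ≤ 1) (hB : ‖fderiv ℝ χ q‖ₑ ≤ B) (hg : ‖fderiv ℝ v q‖ₑ ≤ g)
    (hP : ¬P → χ q = 0 ∧ fderiv ℝ χ q = 0) (he : fderiv ℝ χ q = 0 ∨ ‖v q‖ₑ ≤ e) :
    ‖fderiv ℝ (fun y => χ y * v y) q‖ₑ ^ 2 ≤
      4 * (if P then g ^ 2 else 0) + 4 * (B ^ 2 * e ^ 2) := by
  rw [fderiv_fun_mul hχ hv]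
  by_cases h : P
  · have h1 : ‖χ q • fderiv ℝ v q‖ₑ ≤ g := by
      rw [enorm_smul]
      refine le_trans (mul_le_of_le_one_left' ?_) hg
      rw [Real.enorm_of_nonneg h01.1]
      exact ENNReal.ofReal_le_one.2 h01.2
    have h2 : ‖v q • fderiv ℝ χ q‖ₑ ≤ B * e := by
      rcases he with he | he
      · rw [he, smul_zero, opENorm_zero]
        exact zero_le
      · rw [enorm_smul, mul_comm]
        exact mul_le_mul' hB he
    rw [if_pos h, ← mul_pow]
    exact (pow_le_pow_left' ((opENorm_add_le _ _).trans (add_le_add h1 h2)) 2).trans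
      (ENNReal_add_sq_le _ _)
  · obtain ⟨h1, h2⟩ := hP h
    rw [h1, h2, zero_smul, smul_zero, add_zero, opENorm_zero]
    simp

/-! ### Competitors in an adapted chart -/

variable {n : ℕ} [NeZero n] {k d : ℕ}
  {M : Type*} [MetricSpace M] [ChartedSpace (EuclideanHalfSpace n) M]
  [RiemannianBundle (fun x : M => TangentSpace (𝓡∂ n) x)]

/-- A function that is at least `1` on `L` is at least `1 / 2` on thin shells around `L`. -/
theorem IsAdaptedChart.exists_half_le {L : Set M}
    {Φ : EuclideanSpace ℝ (Fin k) × EuclideanSpace ℝ (Fin d) → M} {ρ : ℝ} {C : ℝ≥0}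
    (hΦ : IsAdaptedChart (n := n) L Φ ρ C) {r : ℝ} (hr : 0 < r) (hrρ : r < ρ) {u : M → ℝ}
    (hu : Continuous u) (huL : ∀ y ∈ L, 1 ≤ u y) :
    ∃ s : ℝ, 0 < s ∧ s ≤ 1 ∧
      ∀ q ∈ Metric.closedBall 0 r ×ˢ shell (EuclideanSpace ℝ (Fin d)) (s * r), 1 / 2 ≤ u (Φ q) := by
  have hDρ : Metric.closedBall 0 r ⊆
      Metric.ball (0 : EuclideanSpace ℝ (Fin k) × EuclideanSpace ℝ (Fin d)) ρ :=
    Metric.closedBall_subset_ball hrρ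
  have hcont : ContinuousOn (u ∘ Φ) (Metric.closedBall 0 r) :=
    hu.comp_continuousOn (hΦ.lipschitzOnWith.continuousOn.mono hDρ)
  have hunif := (isCompact_closedBall (0 : EuclideanSpace ℝ (Fin k) × EuclideanSpace ℝ (Fin d))
    r).uniformContinuousOn_of_continuous hcont
  obtain ⟨δ, hδ, h⟩ := Metric.uniformContinuousOn_iff.1 hunif (1 / 2) (by norm_num)
  -- The outer radius of the thin shell is then at most `δ / 2`, within the modulus of uniform
  -- continuity of `u ∘ Φ`.
  refine ⟨min 1 (δ / (2 * r)), lt_min one_pos (by positivity), min_le_left _ _, ?_⟩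
  rintro ⟨x, z⟩ ⟨hx, hz⟩
  rw [mem_closedBall_zero_iff] at hx
  have hz1 : ‖z‖ ≤ r := hz.2.trans (mul_le_of_le_one_left hr.le (min_le_left _ _))
  have hz2 : ‖z‖ < δ := by
    refine hz.2.trans_lt ?_
    calc min 1 (δ / (2 * r)) * r ≤ δ / (2 * r) * r := by gcongr; exact min_le_right _ _
      _ = δ / 2 := by field_simp
      _ < δ := half_lt_self hδ
  have h1 := h (x, z) (by simp [Prod.norm_mk, hx, hz1]) (x, 0) (by simp [Prod.norm_mk, hx])
    (by simpa [Prod.dist_eq, hδ] using hz2)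
  have h2 := huL _ (hΦ.mem x (hx.trans_lt hrρ))
  rw [Real.dist_eq] at h1
  have h3 := neg_abs_le ((u ∘ Φ) (x, z) - (u ∘ Φ) (x, 0))
  simp only [Function.comp_apply] at h1 h3
  linarith

variable [MeasurableSpace M]

theorem setLIntegral_enorm_gradNorm_sq_le {μ : Measure M} {φ h : M → ℝ} (hh : Measurable h)
    (Ω : Set M) :
    ∫⁻ y in Ω, ‖gradNorm (n := n) φ y‖ₑ ^ 2 ∂μ ≤
      (∫⁻ y in Ω, ENNReal.ofReal (h y) ∂μ) + ∫⁻ y, ‖gradNorm (n := n) φ y ^ 2 - h y‖ₑ ∂μ := by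
  calc ∫⁻ y in Ω, ‖gradNorm (n := n) φ y‖ₑ ^ 2 ∂μ
      ≤ ∫⁻ y in Ω, (ENNReal.ofReal (h y) + ‖gradNorm (n := n) φ y ^ 2 - h y‖ₑ) ∂μ := by
        refine lintegral_mono fun y => ?_
        have h1 : ‖gradNorm (n := n) φ y‖ₑ ^ 2 = ENNReal.ofReal (gradNorm (n := n) φ y ^ 2) := by
          rw [← enorm_pow, Real.enorm_of_nonneg (sq_nonneg _)]
        rw [h1, Real.enorm_eq_ofReal_abs]
        refine le_trans (ENNReal.ofReal_le_ofReal ?_) ENNReal.ofReal_add_le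
        have := le_abs_self (gradNorm (n := n) φ y ^ 2 - h y)
        linarith
    _ = (∫⁻ y in Ω, ENNReal.ofReal (h y) ∂μ) +
          ∫⁻ y in Ω, ‖gradNorm (n := n) φ y ^ 2 - h y‖ₑ ∂μ :=
        lintegral_add_left hh.ennreal_ofReal _
    _ ≤ _ := add_le_add le_rfl (setLIntegral_le_lintegral _ _)

variable [BorelSpace M]

/-- Making the chart constant off the ball gives global measurability, and the properties of an
adapted chart depend only on its values in the ball. -/
theorem IsAdaptedChart.exists_measurable {L : Set M}
    {Φ : EuclideanSpace ℝ (Fin k) × EuclideanSpace ℝ (Fin d) → M} {ρ : ℝ} {C : ℝ≥0}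
    (hρ : 0 < ρ) (h : IsAdaptedChart (n := n) L Φ ρ C) :
    ∃ Ψ : EuclideanSpace ℝ (Fin k) × EuclideanSpace ℝ (Fin d) → M, Ψ 0 = Φ 0 ∧ Measurable Ψ ∧
      IsAdaptedChart (n := n) L Ψ ρ C := by
  classical
  let Ψ := (Metric.ball 0 ρ).piecewise Φ (fun _ => Φ 0)
  have hΨ : ∀ q ∈ Metric.ball 0 ρ, Ψ q = Φ q := fun q hq => piecewise_eq_of_mem _ _ _ hq
  have hev : ∀ f : M → ℝ, ∀ q ∈ Metric.ball 0 ρ, f ∘ Ψ =ᶠ[𝓝 q] f ∘ Φ := by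
    intro f q hq
    filter_upwards [Metric.isOpen_ball.mem_nhds hq] with y hy
    rw [Function.comp_apply, hΨ y hy, Function.comp_apply]
  have h0 : (0 : EuclideanSpace ℝ (Fin k) × EuclideanSpace ℝ (Fin d)) ∈ Metric.ball 0 ρ :=
    Metric.mem_ball_self hρ
  refine ⟨Ψ, hΨ 0 h0, h.lipschitzOnWith.continuousOn.measurable_piecewise
    continuousOn_const Metric.isOpen_ball.measurableSet, ?_, ?_, ?_, ?_, ?_, ?_, ?_⟩
  · exact fun f hf q hq => (h.contDiffAt f hf q hq).congr_of_eventuallyEq (hev f q hq)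
  · intro f hf q hq
    rw [(hev f q hq).fderiv_eq, hΨ q hq]
    exact h.enorm_fderiv_le f hf q hq
  · intro q hq q' hq'
    rw [hΨ q hq, hΨ q' hq']
    exact h.lipschitzOnWith hq hq'
  · intro q hq q' hq'
    rw [hΨ q hq, hΨ q' hq']
    exact h.edist_le q hq q' hq'
  · intro x hx
    rw [hΨ _ (by simpa [Prod.norm_mk] using hx)]
    exact h.mem x hx
  · intro q hq a ha
    rw [hΨ q hq]
    exact h.norm_snd_le q hq a ha
  · rw [hΨ 0 h0, image_congr hΨ]
    exact h.image_mem_nhds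

/-- The weighted energy of a cut-off function in an adapted chart. -/
theorem IsAdaptedChart.energy_cutoff_le [SecondCountableTopology M] {L : Set M}
    {Φ : EuclideanSpace ℝ (Fin k) × EuclideanSpace ℝ (Fin d) → M} {ρ : ℝ} {C : ℝ≥0}
    (hΦm : Measurable Φ) (hΦ : IsAdaptedChart (n := n) L Φ ρ C)
    {c : ℝ≥0} (hc : ∀ T ⊆ Metric.ball 0 ρ, MeasurableSet T → MeasurableSet (Φ '' T) ∧
      ∀ f : M → ℝ≥0∞, ∫⁻ q in T, f (Φ q) ≤ c * ∫⁻ y in Φ '' T, f y ∂vol M n)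
    {w : M → ℝ} (hw : Measurable w) {D : Set (EuclideanSpace ℝ (Fin k) × EuclideanSpace ℝ (Fin d))}
    (hD : MeasurableSet D) (hDρ : D ⊆ Metric.ball 0 ρ) {Ω : Set M} (hΩ : MeasurableSet Ω)
    {u φ : M → ℝ} (hu : Continuous u) (hφ : ContMDiff (𝓡∂ n) 𝓘(ℝ, ℝ) ∞ φ)
    {χ : EuclideanSpace ℝ (Fin k) × EuclideanSpace ℝ (Fin d) → ℝ} (hχ : ContDiff ℝ ∞ χ)
    (h01 : ∀ q, 0 ≤ χ q ∧ χ q ≤ 1) {B : ℝ≥0∞} (hB : ∀ q ∈ D, ‖fderiv ℝ χ q‖ₑ ≤ B)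
    (hχ0 : ∀ q ∈ D, Φ q ∉ Ω → χ q = 0 ∧ fderiv ℝ χ q = 0)
    (hχ1 : ∀ q ∈ D, Φ q ∈ tsupport u → fderiv ℝ χ q = 0) :
    ∫⁻ q in D, ENNReal.ofReal (w (Φ q)) * ‖fderiv ℝ (fun y => χ y * φ (Φ y)) q‖ₑ ^ 2 ≤
      4 * (C ^ 2 * (c * ∫⁻ y in Ω, ‖gradNorm (n := n) φ y‖ₑ ^ 2 ∂weightedVol n w)) +
        4 * (B ^ 2 * ∫⁻ q in D, ENNReal.ofReal (w (Φ q)) * ‖φ (Φ q) - u (Φ q)‖ₑ ^ 2) := by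
  classical
  have hwm : Measurable fun q => ENNReal.ofReal (w (Φ q)) := (hw.comp hΦm).ennreal_ofReal
  have hem : Measurable fun q => ENNReal.ofReal (w (Φ q)) * ‖φ (Φ q) - u (Φ q)‖ₑ ^ 2 :=
    hwm.mul ((((hφ.continuous.measurable.comp hΦm).sub (hu.measurable.comp hΦm)).enorm).pow_const 2)
  have hpt : ∀ q ∈ D, ‖fderiv ℝ (fun y => χ y * φ (Φ y)) q‖ₑ ^ 2 ≤
      4 * (if Φ q ∈ Ω then (C * ‖gradNorm (n := n) φ (Φ q)‖ₑ) ^ 2 else 0) +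
        4 * (B ^ 2 * ‖φ (Φ q) - u (Φ q)‖ₑ ^ 2) := by
    intro q hq
    refine enorm_fderiv_cutoff_mul_sq_le (v := φ ∘ Φ) (hχ.differentiable (by simp) q)
      ((hΦ.contDiffAt φ hφ q (hDρ hq)).differentiableAt one_ne_zero) (h01 q) (hB q hq)
      (hΦ.enorm_fderiv_le φ hφ q (hDρ hq)) (hχ0 q hq) ?_
    by_cases h : Φ q ∈ tsupport u
    · exact Or.inl (hχ1 q hq h)
    · right
      rw [image_eq_zero_of_notMem_tsupport h, sub_zero]
      rfl
  set g : M → ℝ≥0∞ := fun y => ENNReal.ofReal (w y) * ‖gradNorm (n := n) φ y‖ₑ ^ 2 with hg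
  calc _ ≤ ∫⁻ q in D, (4 * C ^ 2 * Ω.indicator g (Φ q) +
          4 * B ^ 2 * (ENNReal.ofReal (w (Φ q)) * ‖φ (Φ q) - u (Φ q)‖ₑ ^ 2)) := by
        refine setLIntegral_mono' hD fun q hq => (mul_le_mul' le_rfl (hpt q hq)).trans ?_
        by_cases h : Φ q ∈ Ω
        · rw [if_pos h, indicator_of_mem h, hg]
          refine le_of_eq ?_
          ring
        · rw [if_neg h, indicator_of_notMem h]
          refine le_of_eq ?_
          ring
    _ = (∫⁻ q in D, 4 * C ^ 2 * Ω.indicator g (Φ q)) +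
          4 * B ^ 2 * ∫⁻ q in D, ENNReal.ofReal (w (Φ q)) * ‖φ (Φ q) - u (Φ q)‖ₑ ^ 2 := by
        rw [lintegral_add_right _ (hem.const_mul _), lintegral_const_mul _ hem]
    _ ≤ _ := by
        refine add_le_add ?_ (le_of_eq (mul_assoc _ _ _))
        rw [lintegral_const_mul' _ _ (by finiteness), mul_assoc]
        refine mul_le_mul' le_rfl (mul_le_mul' le_rfl ?_)
        refine ((hc D hDρ hD).2 (Ω.indicator g)).trans (mul_le_mul' le_rfl ?_)
        rw [setLIntegral_weightedVol n hw hΩ, ← lintegral_indicator hΩ]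
        exact setLIntegral_le_lintegral _ _

theorem measure_shell_pos_and_finite {V W : Type*} [NormedAddCommGroup V] [NormedSpace ℝ V]
    [MeasureSpace V] [BorelSpace V] [FiniteDimensional ℝ V] [(volume : Measure V).IsAddHaarMeasure]
    [NormedAddCommGroup W] [NormedSpace ℝ W] [Nontrivial W]
    [MeasureSpace W] [BorelSpace W] [FiniteDimensional ℝ W]
    [(volume : Measure W).IsAddHaarMeasure] {r : ℝ} (hr : 0 < r) :
    volume (Metric.closedBall (0 : V) r ×ˢ shell W r) ≠ 0 ∧
      volume (Metric.closedBall (0 : V) r ×ˢ shell W r) ≠ ⊤ := by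
  rw [Measure.volume_eq_prod, Measure.prod_prod]
  obtain ⟨z, hz⟩ := exists_norm_eq W (show 0 ≤ 3 / 4 * r by positivity)
  have hsub : Metric.ball z (r / 4) ⊆ shell W r := by
    intro y hy
    rw [mem_ball_iff_norm] at hy
    have h1 := norm_sub_norm_le y z
    have h2 := norm_sub_norm_le z y
    rw [norm_sub_rev] at h2
    exact ⟨by linarith, by linarith⟩
  have h1 : 0 < volume (shell W r) :=
    (Metric.measure_ball_pos volume z (by positivity)).trans_le (measure_mono hsub)
  have h2 : volume (shell W r) < ⊤ :=
    (measure_mono (fun y hy => mem_closedBall_zero_iff.2 hy.2)).trans_lt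
      (measure_closedBall_lt_top (x := (0 : W)) (r := r))
  exact ⟨mul_ne_zero (Metric.measure_closedBall_pos _ _ hr).ne' h1.ne',
    ENNReal.mul_ne_top measure_closedBall_lt_top.ne h2.ne⟩

/-- The order of choices matters: `a` depends only on the weight and the geometry, while the thin
shell, the cut-off and `b` depend on the competitor. The latter enter only through terms that are
small or vanish in the limit, so the lower bound is uniform. -/
theorem IsAdaptedChart.capacity_pos [SecondCountableTopology M] {L : Set M}
    {Φ : EuclideanSpace ℝ (Fin k) × EuclideanSpace ℝ (Fin (d + 1)) → M} {ρ : ℝ} {C : ℝ≥0}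
    (hdim : k + (d + 1) = n) (hΦm : Measurable Φ) (hΦ : IsAdaptedChart (n := n) L Φ ρ C)
    {r : ℝ} (hr : 0 < r) (hrρ : r < ρ) {w : M → ℝ} (hw : Measurable w)
    (hfin : ∀ s ∈ Ioc (0 : ℝ) 1,
      ∫⁻ q in Metric.closedBall 0 r ×ˢ shell _ (s * r), (ENNReal.ofReal (w (Φ q)))⁻¹ ≠ ⊤)
    (hJ : ∫⁻ τ in Ioc (0 : ℝ) 1, ENNReal.ofReal ((τ ^ (2 * d + 1))⁻¹) *
      ∫⁻ q in Metric.closedBall 0 r ×ˢ shell _ (τ * r), (ENNReal.ofReal (w (Φ q)))⁻¹ ≠ ⊤)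
    {Ω : Set M} (hΩ : IsOpen Ω)
    (hΩr : ∀ q ∈ Metric.closedBall 0 r ×ˢ shell _ r, Φ q ∉ Ω) :
    0 < capacity n (weightedVol n w) L Ω := by
  set J := ∫⁻ τ in Ioc (0 : ℝ) 1, ENNReal.ofReal ((τ ^ (2 * d + 1))⁻¹) *
      ∫⁻ q in Metric.closedBall 0 r ×ˢ shell _ (τ * r), (ENNReal.ofReal (w (Φ q)))⁻¹ with hJdef
  set D : Set (EuclideanSpace ℝ (Fin k) × EuclideanSpace ℝ (Fin (d + 1))) :=
    Metric.closedBall 0 r ×ˢ Metric.closedBall 0 r with hDdef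
  have hDball : D = Metric.closedBall 0 r := by rw [hDdef, closedBall_prod_same]; rfl
  have hDρ : D ⊆ Metric.ball 0 ρ := by rw [hDball]; exact Metric.closedBall_subset_ball hrρ
  have hDc : IsCompact D := by rw [hDball]; exact isCompact_closedBall _ _
  have hDm : MeasurableSet D := hDc.isClosed.measurableSet
  have hΦc : ContinuousOn Φ D := hΦ.lipschitzOnWith.continuousOn.mono hDρ
  have : (volume : Measure (EuclideanSpace ℝ (Fin k) ×
      EuclideanSpace ℝ (Fin (d + 1)))).IsAddHaarMeasure := Measure.prod.instIsAddHaarMeasure _ _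
  obtain ⟨c, hc⟩ := exists_lintegral_comparison (M := M) (n := n) (by simpa using hdim)
    hΦ.lipschitzOnWith hΦ.edist_le
  obtain ⟨hκ0, hκ⟩ := measure_shell_pos_and_finite (V := EuclideanSpace ℝ (Fin k))
    (W := EuclideanSpace ℝ (Fin (d + 1))) hr
  set κ : ℝ≥0∞ := 1 / 2 * volume (Metric.closedBall (0 : EuclideanSpace ℝ (Fin k)) r ×ˢ
    shell (EuclideanSpace ℝ (Fin (d + 1))) r) with hκdef
  have hκ0' : κ ≠ 0 := mul_ne_zero (by simp) hκ0
  have hκ' : κ ≠ ⊤ := ENNReal.mul_ne_top (by simp) hκ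
  have hκ4 : κ / 4 ≠ 0 := by simp [ENNReal.div_eq_zero_iff, hκ0']
  have hκ4' : κ / 4 ≠ ⊤ := by simp [ENNReal.div_eq_top, hκ']
  -- This makes the contribution of the integral of 1/w at most a quarter of κ, before any
  -- competitor is given.
  obtain ⟨a, ha0, ha, haJ⟩ := ENNReal_exists_mul_inv_le
    (ENNReal.mul_ne_top (ENNReal.ofReal_ne_top (r := r)) hJ) hκ4 hκ4'
  set A : ℝ≥0∞ := ENNReal.ofReal r * (a * (4 * (C ^ 2 * c))) with hA
  have hAtop : A ≠ ⊤ := by finiteness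
  suffices h : ∀ u h : M → ℝ, IsCapacityCompetitor n (weightedVol n w) L Ω u h →
      κ / 2 ≤ A * ∫⁻ y in Ω, ENNReal.ofReal (h y) ∂weightedVol n w by
    refine lt_of_lt_of_le (ENNReal.div_pos (a := κ / 2) (b := A) ?_ hAtop) ?_
    · simp [ENNReal.div_eq_zero_iff, hκ0']
    · exact le_iInf fun u => le_iInf fun g => le_iInf fun hug =>
        ENNReal.div_le_of_le_mul' (h u g hug)
  intro u h hu
  obtain ⟨hhm, φ, hφ, hφu, -, hφh⟩ := hu.energy
  have huL : ∀ y ∈ L, 1 ≤ u y := fun y hy => by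
    simpa [indicator_of_mem hy] using hu.ge_indicator y
  obtain ⟨s, hs0, hs1, hs⟩ := hΦ.exists_half_le hr hrρ hu.continuous huL
  -- The smooth approximants of `u` need not vanish outside Ω. The cut-off enforces this and equals
  -- 1 on the support of `u`, so its derivative meets only the approximation error.
  obtain ⟨χ, hχ, h01, hχ0, hχ1⟩ := exists_smooth_cutoff
    (hΦc.preimage_isClosed_of_isClosed hDc.isClosed hΩ.isClosed_compl)
    (hΦc.preimage_isClosed_of_isClosed hDc.isClosed (isClosed_tsupport u))
    (disjoint_left.2 fun q hq hq' => hq.2 (hu.support_subset hq'.2))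
  obtain ⟨B, hB⟩ := hDc.exists_bound_of_continuousOn
    (hχ.continuous_fderiv (by simp)).continuousOn
  have hB' : ∀ q ∈ D, ‖fderiv ℝ χ q‖ₑ ≤ (Real.toNNReal B : ℝ≥0∞) := fun q hq => by
    rw [← ofReal_norm]
    exact ENNReal.ofReal_le_ofReal (hB q hq)
  set S : ℝ≥0∞ := ENNReal.ofReal ((s ^ (d + 1))⁻¹)
  set I := ∫⁻ q in Metric.closedBall 0 r ×ˢ shell _ (s * r), (ENNReal.ofReal (w (Φ q)))⁻¹
  obtain ⟨b, hb0, hb, hbI⟩ := ENNReal_exists_mul_inv_le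
    (ENNReal.mul_ne_top (ENNReal.ofReal_ne_top (r := (s ^ (d + 1))⁻¹)) (hfin s ⟨hs0, hs1⟩))
    hκ4 hκ4'
  set H := ∫⁻ y in Ω, ENNReal.ofReal (h y) ∂weightedVol n w
  set E : ℕ → ℝ≥0∞ := fun j => ∫⁻ y, ‖φ j y - u y‖ₑ ^ 2 ∂weightedVol n w
  set Z : ℕ → ℝ≥0∞ := fun j => ∫⁻ y, ‖gradNorm (n := n) (φ j) y ^ 2 - h y‖ₑ ∂weightedVol n w
  have key : ∀ j, κ ≤ S * (b * (c * E j) + b⁻¹ * I) + ENNReal.ofReal r *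
      (a * (4 * (C ^ 2 * (c * (H + Z j))) + 4 * ((Real.toNNReal B : ℝ≥0∞) ^ 2 * (c * E j))) +
        a⁻¹ * J) := by
    intro j
    have hEj : ∫⁻ q in D, ENNReal.ofReal (w (Φ q)) * ‖φ j (Φ q) - u (Φ q)‖ₑ ^ 2 ≤ c * E j := by
      refine ((hc D hDρ hDm).2 (fun y => ENNReal.ofReal (w y) * ‖φ j y - u y‖ₑ ^ 2)).1.trans
        (mul_le_mul' le_rfl ?_)
      rw [← setLIntegral_weightedVol n hw (hc D hDρ hDm).1]
      exact setLIntegral_le_lintegral _ _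
    have h1 := measure_shell_le_energy (V := EuclideanSpace ℝ (Fin k))
      (W := EuclideanSpace ℝ (Fin (d + 1))) (d := d) (by simp) hr
      (Q := Metric.closedBall 0 r) Metric.isClosed_closedBall.measurableSet
      (f := fun y => χ y * φ j (Φ y))
      (fun q hq => (hχ.contDiffAt.of_le (by simp)).mul (hΦ.contDiffAt _ (hφ j) q (hDρ hq)))
      (fun q hq => by
        have hqD : q ∈ D := ⟨hq.1, mem_closedBall_zero_iff.2 hq.2.2⟩
        rw [(hχ0 q ⟨hqD, hΩr q hq⟩).1, zero_mul])
      (w := fun q => ENNReal.ofReal (w (Φ q))) (e := fun q => ‖φ j (Φ q) - u (Φ q)‖ₑ)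
      (hw.comp hΦm).ennreal_ofReal
      (((hφ j).continuous.measurable.comp hΦm).sub (hu.continuous.measurable.comp hΦm)).enorm
      hs0 hs1 (c := 1 / 2)
      (fun q hq => by
        have hqD : q ∈ D := ⟨hq.1, mem_closedBall_zero_iff.2
          (hq.2.2.trans (mul_le_of_le_one_left hr.le hs1))⟩
        have hq2 := hs q hq
        have hsupp : Φ q ∈ tsupport u := subset_tsupport u (by
          rw [Function.mem_support]; linarith)
        rw [(hχ1 q ⟨hqD, hsupp⟩).1, one_mul]
        have h3 : ‖u (Φ q)‖ₑ ≤ ‖φ j (Φ q)‖ₑ + ‖φ j (Φ q) - u (Φ q)‖ₑ := by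
          have := enorm_sub_le (a := φ j (Φ q)) (b := φ j (Φ q) - u (Φ q))
          rwa [sub_sub_cancel] at this
        refine le_trans ?_ h3
        rw [Real.enorm_of_nonneg (by linarith)]
        rw [show (1 / 2 : ℝ≥0∞) = ENNReal.ofReal (1 / 2) by
          rw [ENNReal.ofReal_div_of_pos (by norm_num)]; simp]
        exact ENNReal.ofReal_le_ofReal hq2)
      ha0 ha hb0 hb
    refine h1.trans ?_
    refine add_le_add (mul_le_mul' le_rfl (add_le_add (mul_le_mul' le_rfl hEj) le_rfl))
      (mul_le_mul' le_rfl (add_le_add (mul_le_mul' le_rfl ?_) le_rfl))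
    refine (hΦ.energy_cutoff_le hΦm (fun T hT hTm => ⟨(hc T hT hTm).1, fun f =>
      ((hc T hT hTm).2 f).1⟩) hw hDm hDρ hΩ.measurableSet hu.continuous (hφ j) hχ h01 hB'
      (fun q hq hq' => hχ0 q ⟨hq, hq'⟩) (fun q hq hq' => (hχ1 q ⟨hq, hq'⟩).2)).trans ?_
    refine add_le_add ?_ (mul_le_mul' le_rfl (mul_le_mul' le_rfl hEj))
    refine mul_le_mul' le_rfl (mul_le_mul' le_rfl (mul_le_mul' le_rfl ?_))
    exact setLIntegral_enorm_gradNorm_sq_le hhm Ω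
  -- The approximation errors `E j` and `Z j` tend to zero while all constants are finite and fixed,
  -- so they can be replaced by 0, including the terms with the uncontrolled bound `B`.
  have hlim : κ ≤ S * (b * (c * 0) + b⁻¹ * I) + ENNReal.ofReal r *
      (a * (4 * (C ^ 2 * (c * (H + 0))) + 4 * ((Real.toNNReal B : ℝ≥0∞) ^ 2 * (c * 0))) +
        a⁻¹ * J) := by
    have hcE : Tendsto (fun j => (c : ℝ≥0∞) * E j) atTop (𝓝 (c * 0)) :=
      ENNReal.Tendsto.const_mul hφu (Or.inr (by finiteness))
    have hcZ : Tendsto (fun j => (c : ℝ≥0∞) * (H + Z j)) atTop (𝓝 (c * (H + 0))) :=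
      ENNReal.Tendsto.const_mul (tendsto_const_nhds.add hφh) (Or.inr (by finiteness))
    refine ge_of_tendsto' (x := atTop (α := ℕ)) ?_ key
    refine Tendsto.add (ENNReal.Tendsto.const_mul (Tendsto.add
      (ENNReal.Tendsto.const_mul hcE (Or.inr hb)) tendsto_const_nhds) (Or.inr (by finiteness)))
      (ENNReal.Tendsto.const_mul (Tendsto.add (ENNReal.Tendsto.const_mul (Tendsto.add
        (ENNReal.Tendsto.const_mul (ENNReal.Tendsto.const_mul hcZ (Or.inr (by finiteness)))
          (Or.inr (by finiteness)))
        (ENNReal.Tendsto.const_mul (ENNReal.Tendsto.const_mul hcE (Or.inr (by finiteness)))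
          (Or.inr (by finiteness)))) (Or.inr ha)) tendsto_const_nhds) (Or.inr (by finiteness)))
  have hrew : S * (b * (c * 0) + b⁻¹ * I) + ENNReal.ofReal r *
      (a * (4 * (C ^ 2 * (c * (H + 0))) + 4 * ((Real.toNNReal B : ℝ≥0∞) ^ 2 * (c * 0))) +
        a⁻¹ * J) = S * I * b⁻¹ + ENNReal.ofReal r * J * a⁻¹ + A * H := by
    rw [hA]; ring
  rw [hrew] at hlim
  have hκκ : κ / 4 + κ / 4 = κ / 2 := ENNReal_quarter_add_quarter κ
  -- Two error terms of at most κ/4 each are absorbed, which leaves κ/2 for the energy; cancelling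
  -- needs κ finite.
  refine (ENNReal.add_le_add_iff_left (a := κ / 2) (by simp [ENNReal.div_eq_top, hκ'])).1 ?_
  rw [ENNReal.add_halves]
  refine hlim.trans (add_le_add ?_ le_rfl)
  rw [← hκκ]
  exact add_le_add hbI haJ

end CapacityPos
end GluedManifold

namespace GluedManifold

/-! ### The glued distance -/

section GluedGeometry

variable {E M₁ M₂ : Type*} [MetricSpace M₁] [MetricSpace M₂] {ι₁ : M₁ → E} {ι₂ : M₂ → E}

theorem imageEDist_le {M : Type*} [MetricSpace M] (ι : M → E) (a b : M) :
    imageEDist ι (ι a) (ι b) ≤ edist a b :=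
  (iInf_le _ a).trans ((iInf_le _ b).trans ((iInf_le _ rfl).trans (iInf_le _ rfl)))

theorem exists_of_imageEDist_lt {M : Type*} [MetricSpace M] {ι : M → E} {x y : E} {r : ℝ≥0∞}
    (h : imageEDist ι x y < r) : ∃ a b, ι a = x ∧ ι b = y ∧ edist a b < r := by
  simpa only [imageEDist, iInf_lt_iff, exists_prop] using h

theorem imageEDist_comm {M : Type*} [MetricSpace M] (ι : M → E) (x y : E) :
    imageEDist ι x y = imageEDist ι y x := by
  have key : ∀ x y, imageEDist ι x y ≤ imageEDist ι y x := fun x y => by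
    refine le_iInf fun a => le_iInf fun b => le_iInf fun ha => le_iInf fun hb => ?_
    subst ha hb
    rw [edist_comm]
    exact imageEDist_le ι b a
  exact le_antisymm (key x y) (key y x)

theorem stepEDist_comm (x y : E) : stepEDist ι₁ ι₂ x y = stepEDist ι₁ ι₂ y x := by
  rw [stepEDist, stepEDist, imageEDist_comm ι₁, imageEDist_comm ι₂]

theorem stepEDist_swap (x y : E) : stepEDist ι₁ ι₂ x y = stepEDist ι₂ ι₁ x y := min_comm _ _

theorem inter_swap {E M₁ M₂ : Type*} {ι₁ : M₁ → E} {ι₂ : M₂ → E} :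
    inter ι₁ ι₂ = inter ι₂ ι₁ := inter_comm _ _

theorem tube_swap (R : ℝ) : tube ι₁ ι₂ R = tube ι₂ ι₁ R := by
  simp only [tube, gluedBall, gluedEDist, inter_swap (ι₁ := ι₁), stepEDist_swap (ι₁ := ι₁)]

theorem gluedEDist_comm (x y : E) : gluedEDist ι₁ ι₂ x y = gluedEDist ι₁ ι₂ y x := by
  have key : ∀ x y, gluedEDist ι₁ ι₂ x y ≤ gluedEDist ι₁ ι₂ y x := fun x y => by
    refine le_iInf fun m => le_iInf fun p => le_iInf fun h0 => le_iInf fun hm => ?_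
    refine (iInf_le _ m).trans ((iInf_le _ fun i => p (m - i)).trans
      ((iInf_le _ (by simpa using hm)).trans ((iInf_le _ (by simpa using h0)).trans ?_)))
    rw [← Finset.sum_range_reflect]
    refine (Finset.sum_congr rfl fun i hi => ?_).le
    have hi' := Finset.mem_range.1 hi
    dsimp only
    rw [stepEDist_comm, show m - (m - 1 - i + 1) = i by omega,
      show m - (m - 1 - i) = i + 1 by omega]
  exact le_antisymm (key x y) (key y x)

theorem gluedEDist_le_of_two_steps (x y z : E) :
    gluedEDist ι₁ ι₂ x z ≤ stepEDist ι₁ ι₂ x y + stepEDist ι₁ ι₂ y z := by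
  refine (iInf_le _ 2).trans ((iInf_le _ fun i => if i = 0 then x else if i = 1 then y else z).trans
    ((iInf_le _ (by simp)).trans ((iInf_le _ (by simp)).trans ?_)))
  simp [Finset.sum_range_succ]

theorem gluedEDist_le_stepEDist (x y : E) : gluedEDist ι₁ ι₂ x y ≤ stepEDist ι₁ ι₂ x y := by
  refine (iInf_le _ 1).trans ((iInf_le _ fun i => if i = 0 then x else y).trans
    ((iInf_le _ (by simp)).trans ((iInf_le _ (by simp)).trans ?_)))
  simp

/-- Until a chain starting in `M₁` meets `L`, none of its points lies in `M₂`, so every step of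
finite length is a `d₁` step. After it has met `L`, its initial part already gives the second
alternative. -/
theorem chain_alternative (h₁ : Function.Injective ι₁) (y : M₁) (p : ℕ → E) (h0 : p 0 = ι₁ y)
    (m : ℕ) (hfin : ∑ i ∈ Finset.range m, stepEDist ι₁ ι₂ (p i) (p (i + 1)) < ⊤) :
    (∃ z, p m = ι₁ z ∧ edist y z ≤ ∑ i ∈ Finset.range m, stepEDist ι₁ ι₂ (p i) (p (i + 1))) ∨
      ∃ a ∈ ι₁ ⁻¹' inter ι₁ ι₂,
        edist y a ≤ ∑ i ∈ Finset.range m, stepEDist ι₁ ι₂ (p i) (p (i + 1)) := by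
  induction m with
  | zero => exact Or.inl ⟨y, h0, by simp⟩
  | succ m ih =>
    rw [Finset.sum_range_succ] at hfin ⊢
    obtain ⟨hS, hstep⟩ := ENNReal.add_lt_top.1 hfin
    rcases ih hS with ⟨z, hz, hyz⟩ | ⟨a, ha, hya⟩
    · by_cases hz2 : ι₁ z ∈ range ι₂
      · exact Or.inr ⟨z, ⟨mem_range_self z, hz2⟩, hyz.trans le_self_add⟩
      have htop : imageEDist ι₂ (p m) (p (m + 1)) = ⊤ := by
        by_contra h
        obtain ⟨b, -, hb, -⟩ := exists_of_imageEDist_lt (lt_top_iff_ne_top.2 h)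
        exact hz2 ⟨b, hb.trans hz⟩
      have hs : stepEDist ι₁ ι₂ (p m) (p (m + 1)) = imageEDist ι₁ (p m) (p (m + 1)) := by
        rw [stepEDist, htop, min_eq_left le_top]
      obtain ⟨z', z'', hz', hz'', -⟩ := exists_of_imageEDist_lt (hs ▸ hstep)
      have hle : edist z z'' ≤ stepEDist ι₁ ι₂ (p m) (p (m + 1)) := by
        rw [hs]
        refine le_iInf fun a => le_iInf fun b => le_iInf fun ha => le_iInf fun hb => ?_
        rw [h₁ (ha.trans hz), h₁ (hb.trans hz''.symm)]
      exact Or.inl ⟨z'', hz''.symm, (edist_triangle y z z'').trans (add_le_add hyz hle)⟩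
    · exact Or.inr ⟨a, ha, hya.trans le_self_add⟩

theorem gluedEDist_alternative (h₁ : Function.Injective ι₁) {y : M₁} {x : E} {r : ℝ≥0∞}
    (h : gluedEDist ι₁ ι₂ (ι₁ y) x < r) :
    (∃ z, x = ι₁ z ∧ edist y z < r) ∨ ∃ a ∈ ι₁ ⁻¹' inter ι₁ ι₂, edist y a < r := by
  simp only [gluedEDist, iInf_lt_iff] at h
  obtain ⟨m, p, h0, hm, hlt⟩ := h
  rcases chain_alternative h₁ y p h0 m (hlt.trans_le le_top) with ⟨z, hz, hle⟩ | ⟨a, ha, hle⟩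
  · exact Or.inl ⟨z, hm.symm.trans hz, hle.trans_lt hlt⟩
  · exact Or.inr ⟨a, ha, hle.trans_lt hlt⟩

/-- Passing through `M₂` cannot shorten the way to `L`: a chain from `M₁` has to meet `L` before
leaving `M₁`. The tube is thus described by `d₁` alone. -/
theorem preimage_tube (h₁ : Function.Injective ι₁) (R : ℝ) :
    ι₁ ⁻¹' tube ι₁ ι₂ R = ⋃ a ∈ ι₁ ⁻¹' inter ι₁ ι₂, Metric.eball a (ENNReal.ofReal R) := by
  ext y
  simp only [mem_preimage, tube, mem_iUnion, exists_prop, gluedBall, mem_ofPred_eq,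
    Metric.mem_eball]
  constructor
  · rintro ⟨x, hx, hxy⟩
    rw [gluedEDist_comm] at hxy
    rcases gluedEDist_alternative h₁ hxy with ⟨z, rfl, hz⟩ | ⟨a, ha, hya⟩
    · exact ⟨z, hx, hz⟩
    · exact ⟨a, ha, hya⟩
  · rintro ⟨a, ha, hya⟩
    refine ⟨ι₁ a, ha, lt_of_le_of_lt ?_ hya⟩
    rw [gluedEDist_comm]
    exact (gluedEDist_le_stepEDist _ _).trans ((min_le_left _ _).trans (imageEDist_le ι₁ y a))

/-- The doubling condition transfers the measure of a ball of `M₂` centred on the intersection to a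
ball of `M₁` at a comparable distance from the intersection. -/
theorem IsNDoubling.measure_ball_le [MeasurableSpace E]
    [MeasurableSpace M₁] [BorelSpace M₁] [MeasurableSpace M₂] [BorelSpace M₂] {n₁ n₂ : ℕ}
    (h₁ : MeasurableEmbedding ι₁) (h₂ : MeasurableEmbedding ι₂) {w₁ : M₁ → ℝ} {w₂ : M₂ → ℝ}
    {N : ℝ → ℝ} (hN : IsNDoubling ι₁ ι₂ (gluedMeasure n₁ n₂ ι₁ ι₂ w₁ w₂) N)
    {y a : M₁} {b : M₂} {r : ℝ} (hr : 0 < r) (hab : ι₁ a = ι₂ b) (hya : dist y a < 2 * r)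
    (hy : ∀ a ∈ ι₁ ⁻¹' inter ι₁ ι₂, r ≤ dist y a) :
    weightedVol n₂ w₂ (Metric.ball b r) ≤
      ENNReal.ofReal (N (2 * r)) * weightedVol n₁ w₁ (Metric.ball y r) := by
  -- As `y` is at distance at least `r` from `L`, chains shorter than `r` never leave `M₁`.
  have hal : ∀ x, gluedEDist ι₁ ι₂ (ι₁ y) x < ENNReal.ofReal r →
      ∃ z, x = ι₁ z ∧ dist y z < r := by
    intro x hx
    rcases gluedEDist_alternative h₁.injective hx with ⟨z, rfl, hz⟩ | ⟨a, ha, hya⟩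
    · exact ⟨z, rfl, by rwa [edist_dist, ENNReal.ofReal_lt_ofReal_iff hr] at hz⟩
    · rw [edist_dist, ENNReal.ofReal_lt_ofReal_iff hr] at hya
      exact absurd hya (hy a ha).not_gt
  -- The two-step chain from `y` through the point `a = b` of `L` has length below 2r + r, which is
  -- why the doubling factor is 3.
  have hlow : Metric.ball b r ⊆ ι₂ ⁻¹' gluedBall ι₁ ι₂ (ι₁ y) (3 * r) := by
    intro z hz
    refine (gluedEDist_le_of_two_steps (ι₁ y) (ι₁ a) (ι₂ z)).trans_lt ?_
    have e1 : stepEDist ι₁ ι₂ (ι₁ y) (ι₁ a) < ENNReal.ofReal (2 * r) := by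
      refine ((min_le_left _ _).trans (imageEDist_le ι₁ y a)).trans_lt ?_
      rwa [edist_dist, ENNReal.ofReal_lt_ofReal_iff (by linarith)]
    have e2 : stepEDist ι₁ ι₂ (ι₁ a) (ι₂ z) < ENNReal.ofReal r := by
      rw [hab]
      refine ((min_le_right _ _).trans (imageEDist_le ι₂ b z)).trans_lt ?_
      rw [edist_dist, ENNReal.ofReal_lt_ofReal_iff hr, dist_comm]
      exact hz
    refine (ENNReal.add_lt_add e1 e2).trans_le ?_
    rw [← ENNReal.ofReal_add (by linarith) hr.le]
    exact ENNReal.ofReal_le_ofReal (by linarith)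
  have hup1 : ι₁ ⁻¹' gluedBall ι₁ ι₂ (ι₁ y) r ⊆ Metric.ball y r := by
    intro z hz
    obtain ⟨z', hz', hd⟩ := hal _ hz
    rw [h₁.injective hz', Metric.mem_ball, dist_comm]
    exact hd
  -- A point of `M₂` in this ball would also be in `M₁`, hence in `L` and too close to `y`.
  have hup2 : ι₂ ⁻¹' gluedBall ι₁ ι₂ (ι₁ y) r = ∅ := by
    refine eq_empty_of_forall_notMem fun z hz => ?_
    obtain ⟨z', hz', hd⟩ := hal _ hz
    exact (hy z' ⟨mem_range_self z', hz' ▸ mem_range_self z⟩).not_gt hd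
  calc weightedVol n₂ w₂ (Metric.ball b r)
      ≤ gluedMeasure n₁ n₂ ι₁ ι₂ w₁ w₂ (gluedBall ι₁ ι₂ (ι₁ y) (3 * r)) := by
        rw [gluedMeasure, Measure.add_apply, h₁.map_apply, h₂.map_apply]
        exact (measure_mono hlow).trans le_add_self
    _ ≤ ENNReal.ofReal (N (2 * r)) *
        gluedMeasure n₁ n₂ ι₁ ι₂ w₁ w₂ (gluedBall ι₁ ι₂ (ι₁ y) r) :=
      hN _ (Or.inl (mem_range_self y)) r hr
    _ ≤ _ := by
        rw [gluedMeasure, Measure.add_apply, h₁.map_apply, h₂.map_apply, hup2, measure_empty,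
          add_zero]
        gcongr

end GluedGeometry

end GluedManifold

namespace GluedManifold

/-! ### Capacities from integral bounds on shells -/

section ShellBounds

variable {n : ℕ} [NeZero n] {k d : ℕ}
  {M : Type*} [MetricSpace M] [ChartedSpace (EuclideanHalfSpace n) M]
  [RiemannianBundle (fun x : M => TangentSpace (𝓡∂ n) x)]
  {L : Set M} {ρ : ℝ} {C : ℝ≥0}

theorem IsAdaptedChart.mono {Φ : EuclideanSpace ℝ (Fin k) × EuclideanSpace ℝ (Fin d) → M}
    (hΦ : IsAdaptedChart (n := n) L Φ ρ C) {C' : ℝ≥0} (hC : C ≤ C') :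
    IsAdaptedChart (n := n) L Φ ρ C' where
  contDiffAt := hΦ.contDiffAt
  enorm_fderiv_le f hf q hq := (hΦ.enorm_fderiv_le f hf q hq).trans (by gcongr)
  lipschitzOnWith := hΦ.lipschitzOnWith.weaken hC
  edist_le q hq q' hq' := (hΦ.edist_le q hq q' hq').trans (by gcongr)
  mem := hΦ.mem
  norm_snd_le q hq a ha := (hΦ.norm_snd_le q hq a ha).trans (by gcongr)
  image_mem_nhds := hΦ.image_mem_nhds

theorem IsAdaptedChart.dist_le {Φ : EuclideanSpace ℝ (Fin k) × EuclideanSpace ℝ (Fin d) → M}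
    (hΦ : IsAdaptedChart (n := n) L Φ ρ C) {q q' : _} (hq : q ∈ Metric.ball 0 ρ)
    (hq' : q' ∈ Metric.ball 0 ρ) : dist q q' ≤ C * dist (Φ q) (Φ q') := by
  have h := hΦ.edist_le q hq q' hq'
  rw [edist_dist, edist_dist, ← ENNReal.ofReal_coe_nnreal, ← ENNReal.ofReal_mul C.coe_nonneg] at h
  exact (ENNReal.ofReal_le_ofReal_iff (by positivity)).1 h

theorem lintegral_ofReal_comp_mul_ne_top {g : ℝ → ℝ} {r : ℝ} (hr : 0 < r)
    (hg : IntegrableOn g (Ioc 0 r)) :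
    ∫⁻ τ in Ioc (0 : ℝ) 1, ENNReal.ofReal (g (τ * r)) ≠ ⊤ := by
  have h1 : IntervalIntegrable g volume 0 r :=
    (intervalIntegrable_iff_integrableOn_Ioc_of_le hr.le).2 hg
  have h2 := h1.comp_mul_right (c := r)
  rw [zero_div, div_self hr.ne', intervalIntegrable_iff_integrableOn_Ioc_of_le zero_le_one] at h2
  exact h2.lintegral_lt_top.ne

variable [MeasurableSpace M] [BorelSpace M]

/-- A bound for the integral of `1 / w` over shells, integrable against the natural scale, makes the
capacity of `L` in small tubes positive. -/
theorem IsAdaptedChart.exists_capacity_pos [SecondCountableTopology M]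
    {Φ : EuclideanSpace ℝ (Fin k) × EuclideanSpace ℝ (Fin (d + 1)) → M}
    (hdim : k + (d + 1) = n) (hΦm : Measurable Φ) (hΦ : IsAdaptedChart (n := n) L Φ ρ C)
    {r : ℝ} (hr : 0 < r) (hrρ : r < ρ) {w : M → ℝ} (hw : Measurable w) {A : ℝ≥0} {g : ℝ → ℝ}
    (hg : IntegrableOn g (Ioc 0 r))
    (hI : ∀ σ ∈ Ioc 0 r, ∫⁻ q in Metric.closedBall 0 r ×ˢ shell _ σ, (ENNReal.ofReal (w (Φ q)))⁻¹ ≤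
      A * ENNReal.ofReal (σ ^ (2 * d + 1)) * ENNReal.ofReal (g σ)) :
    ∃ R₀ : ℝ, 0 < R₀ ∧ ∀ R ≤ R₀, 0 < capacity n (weightedVol n w) L
      (⋃ a ∈ L, Metric.eball a (ENNReal.ofReal R)) := by
  have hmem : ∀ τ ∈ Ioc (0 : ℝ) 1, τ * r ∈ Ioc 0 r := fun τ hτ =>
    ⟨mul_pos hτ.1 hr, mul_le_of_le_one_left hr.le hτ.2⟩
  -- Points of the shell have ‖z‖ ≥ r/2, so by `norm_snd_le` they are farther from `L` than any such
  -- `R` and lie outside the tube.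
  refine ⟨r / 2 / (C + 1), by positivity, fun R hR => ?_⟩
  refine hΦ.capacity_pos hdim hΦm hr hrρ hw (fun τ hτ => ne_top_of_le_ne_top (by finiteness)
    (hI _ (hmem τ hτ))) ?_ (isOpen_biUnion fun a _ => Metric.isOpen_eball) ?_
  · have hle : ∀ τ ∈ Ioc (0 : ℝ) 1, ENNReal.ofReal ((τ ^ (2 * d + 1))⁻¹) *
        ∫⁻ q in Metric.closedBall 0 r ×ˢ shell _ (τ * r), (ENNReal.ofReal (w (Φ q)))⁻¹ ≤
        A * ENNReal.ofReal (r ^ (2 * d + 1)) * ENNReal.ofReal (g (τ * r)) := by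
      intro τ hτ
      refine (mul_le_mul' le_rfl (hI _ (hmem τ hτ))).trans (le_of_eq ?_)
      have hτ0 : τ ^ (2 * d + 1) ≠ 0 := (pow_pos hτ.1 _).ne'
      have : ENNReal.ofReal (r ^ (2 * d + 1)) =
          ENNReal.ofReal ((τ ^ (2 * d + 1))⁻¹) * ENNReal.ofReal ((τ * r) ^ (2 * d + 1)) := by
        rw [← ENNReal.ofReal_mul (inv_nonneg.2 (pow_nonneg hτ.1.le _)), mul_pow,
          inv_mul_cancel_left₀ hτ0]
      rw [this]
      ring
    refine ne_top_of_le_ne_top ?_ (setLIntegral_mono' measurableSet_Ioc hle)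
    rw [lintegral_const_mul' _ _ (by finiteness)]
    exact ENNReal.mul_ne_top (by finiteness) (lintegral_ofReal_comp_mul_ne_top hr hg)
  · rintro q hq hqΩ
    simp only [mem_iUnion, exists_prop, Metric.mem_eball, edist_dist] at hqΩ
    obtain ⟨a, ha, hqa⟩ := hqΩ
    have hqR := (ENNReal.ofReal_lt_ofReal_iff_of_nonneg dist_nonneg).1 hqa
    have hqρ : q ∈ Metric.ball 0 ρ := by
      rw [mem_ball_zero_iff, Prod.norm_def]
      exact max_lt ((mem_closedBall_zero_iff.1 hq.1).trans_lt hrρ) (hq.2.2.trans_lt hrρ)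
    have h1 := hΦ.norm_snd_le q hqρ a ha
    have h2 : dist (Φ q) a < r / 2 / (C + 1) := hqR.trans_le hR
    rw [lt_div_iff₀ (by positivity)] at h2
    have h3 := hq.2.1
    have h4 : 0 ≤ dist (Φ q) a := dist_nonneg
    nlinarith

/-! ### Volumes of small balls -/

/-- With b = C + 1, a small metric ball of radius s lies between the images of coordinate balls of
radii s/b and bs. -/
theorem IsAdaptedChart.exists_vol_ball_bounds {n' : ℕ}
    {Φ : EuclideanSpace ℝ (Fin k) × EuclideanSpace ℝ (Fin d) → M}
    (hdim : k + d = n') (hρ : 0 < ρ) (hΦ : IsAdaptedChart (n := n) L Φ ρ C) :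
    ∃ (δ : ℝ) (a : ℝ≥0), 0 < δ ∧ a ≠ 0 ∧ ∀ y ∈ Metric.ball (Φ 0) δ, ∀ s ∈ Ioo 0 δ,
      ENNReal.ofReal (s ^ n') ≤ a * vol M n' (Metric.ball y s) ∧
      vol M n' (Metric.ball y s) ≤ a * ENNReal.ofReal (s ^ n') := by
  have : (volume : Measure (EuclideanSpace ℝ (Fin k) ×
      EuclideanSpace ℝ (Fin d))).IsAddHaarMeasure := Measure.prod.instIsAddHaarMeasure _ _
  have hfr : Module.finrank ℝ (EuclideanSpace ℝ (Fin k) × EuclideanSpace ℝ (Fin d)) = n' := by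
    simpa using hdim
  obtain ⟨c, hc⟩ := exists_volume_comparison (M := M) (n := n') hfr
    hΦ.lipschitzOnWith hΦ.edist_le
  have h0 : (0 : EuclideanSpace ℝ (Fin k) × EuclideanSpace ℝ (Fin d)) ∈ Metric.ball 0 ρ :=
    Metric.mem_ball_self hρ
  obtain ⟨ε, hε, hεΦ⟩ := Metric.mem_nhds_iff.1 hΦ.image_mem_nhds
  set v : ℝ≥0∞ := volume (Metric.ball (0 : EuclideanSpace ℝ (Fin k) × EuclideanSpace ℝ (Fin d)) 1)
    with hv
  have hv0 : v ≠ 0 := (Metric.measure_ball_pos _ _ one_pos).ne'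
  have hvt : v ≠ ⊤ := measure_ball_lt_top.ne
  have hball : ∀ (q : EuclideanSpace ℝ (Fin k) × EuclideanSpace ℝ (Fin d)) (s : ℝ), 0 ≤ s →
      volume (Metric.closedBall q s) = ENNReal.ofReal (s ^ n') * v := fun q s hs => by
    rw [Measure.addHaar_closedBall _ _ hs, hfr]
  set b : ℝ := C + 1 with hb
  have hb0 : 0 < b := by positivity
  set a₁ : ℝ≥0∞ := ENNReal.ofReal (b ^ n') * v⁻¹ * c with ha₁
  set a₂ : ℝ≥0∞ := c * ENNReal.ofReal (b ^ n') * v with ha₂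
  have ha₁t : a₁ ≠ ⊤ := by finiteness
  have ha₂t : a₂ ≠ ⊤ := by finiteness
  refine ⟨min (ε / 2) (ρ / (2 * b)), (a₁ + a₂ + 1).toNNReal, by positivity, ?_,
    fun y hy s hs => ?_⟩
  · rw [Ne, ENNReal.toNNReal_eq_zero_iff, not_or]
    exact ⟨by simp, by finiteness⟩
  rw [ENNReal.coe_toNNReal (by finiteness)]
  have hs1 : s < ε / 2 := hs.2.trans_le (min_le_left _ _)
  have hs2 : s < ρ / (2 * b) := hs.2.trans_le (min_le_right _ _)
  have hy1 : dist y (Φ 0) < ε / 2 := (Metric.mem_ball.1 hy).trans_le (min_le_left _ _)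
  have hy2 : dist y (Φ 0) < ρ / (2 * b) := (Metric.mem_ball.1 hy).trans_le (min_le_right _ _)
  obtain ⟨q, hq, rfl⟩ := hεΦ (by rw [Metric.mem_ball]; linarith : y ∈ Metric.ball (Φ 0) ε)
  rw [lt_div_iff₀ (by positivity)] at hs2 hy2
  have hq0 : ‖q‖ < ρ / 2 := by
    have := hΦ.dist_le hq h0
    rw [dist_zero_right] at this
    have h3 : (C : ℝ) * dist (Φ q) (Φ 0) ≤ b * dist (Φ q) (Φ 0) := by
      rw [hb]; gcongr; linarith
    linarith
  constructor
  · have hsub : Metric.closedBall q (s / b) ⊆ Metric.ball 0 ρ := by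
      intro q' hq'
      have h1 : dist q' q ≤ s / b := hq'
      have h2 : s / b ≤ b * s := by
        rw [div_le_iff₀ hb0]
        have : (1:ℝ) ≤ b := by rw [hb]; linarith [C.coe_nonneg]
        nlinarith [hs.1, mul_nonneg hs.1.le hb0.le]
      rw [mem_ball_zero_iff]
      calc ‖q'‖ = ‖(q' - q) + q‖ := by rw [sub_add_cancel]
        _ ≤ ‖q' - q‖ + ‖q‖ := norm_add_le _ _
        _ < ρ := by rw [← dist_eq_norm]; linarith
    have himg : Φ '' Metric.closedBall q (s / b) ⊆ Metric.ball (Φ q) s := by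
      rintro _ ⟨q', hq', rfl⟩
      have h1 : dist q' q ≤ s / b := hq'
      have h2 := hΦ.lipschitzOnWith.dist_le_mul _ (hsub hq') _ hq
      rw [Metric.mem_ball]
      rw [le_div_iff₀ hb0] at h1
      have h4 : 0 ≤ dist q' q := dist_nonneg
      rcases h4.eq_or_lt with h4 | h4
      · rw [← h4, mul_zero] at h2
        exact h2.trans_lt hs.1
      · rw [hb] at h1
        nlinarith
    have h := (hc _ hsub).1
    rw [hball _ _ (by have := hs.1; positivity), div_pow] at h
    have hbn : 0 < b ^ n' := by positivity
    calc ENNReal.ofReal (s ^ n')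
        = ENNReal.ofReal (b ^ n') * v⁻¹ * (ENNReal.ofReal (s ^ n' / b ^ n') * v) := by
          rw [mul_comm (ENNReal.ofReal (s ^ n' / b ^ n')), ← mul_assoc, mul_assoc _ v⁻¹,
            ENNReal.inv_mul_cancel hv0 hvt, mul_one, ← ENNReal.ofReal_mul hbn.le,
            mul_div_cancel₀ _ hbn.ne']
      _ ≤ ENNReal.ofReal (b ^ n') * v⁻¹ * (c * vol M n' (Metric.ball (Φ q) s)) := by
          exact mul_le_mul' le_rfl (h.trans (mul_le_mul' le_rfl (measure_mono himg)))
      _ = a₁ * vol M n' (Metric.ball (Φ q) s) := by rw [ha₁]; ring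
      _ ≤ _ := by
          gcongr
          rw [add_assoc]
          exact le_self_add
  · have hsub : Metric.ball (Φ q) s ⊆ Φ '' (Metric.ball 0 ρ ∩ Metric.closedBall q (b * s)) := by
      intro y' hy'
      have h1 : dist y' (Φ q) < s := hy'
      obtain ⟨q', hq', rfl⟩ := hεΦ (by
        rw [Metric.mem_ball]
        linarith [dist_triangle y' (Φ q) (Φ 0)] : y' ∈ Metric.ball (Φ 0) ε)
      refine mem_image_of_mem _ ⟨hq', ?_⟩
      have h2 := hΦ.dist_le hq' hq
      rw [Metric.mem_closedBall]
      refine h2.trans (mul_le_mul ?_ h1.le dist_nonneg hb0.le)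
      rw [hb]; linarith
    calc vol M n' (Metric.ball (Φ q) s)
        ≤ c * volume (Metric.ball 0 ρ ∩ Metric.closedBall q (b * s)) :=
          (measure_mono hsub).trans (hc _ inter_subset_left).2
      _ ≤ c * volume (Metric.closedBall q (b * s)) := by gcongr; exact inter_subset_right
      _ = a₂ * ENNReal.ofReal (s ^ n') := by
          rw [hball _ _ (mul_nonneg hb0.le hs.1.le), mul_pow, ENNReal.ofReal_mul (by positivity),
            ha₂]
          ring
      _ ≤ _ := by
          gcongr
          exact le_add_self.trans le_self_add

/-- A weight that is bounded from below satisfies the bound on shells in codimension one. -/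
theorem IsAdaptedChart.exists_shell_bound_of_le [SecondCountableTopology M]
    {Φ : EuclideanSpace ℝ (Fin k) × EuclideanSpace ℝ (Fin (0 + 1)) → M}
    (hdim : k + (0 + 1) = n) (hΦ : IsAdaptedChart (n := n) L Φ ρ C)
    {r : ℝ} (hrρ : r < ρ) {w : M → ℝ} {c : ℝ} (hc : 0 < c)
    (hw : ∀ᵐ y ∂vol M n, c ≤ w y) :
    ∃ A : ℝ≥0, ∀ σ ∈ Ioc 0 r,
      ∫⁻ q in Metric.closedBall 0 r ×ˢ shell _ σ, (ENNReal.ofReal (w (Φ q)))⁻¹ ≤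
        A * ENNReal.ofReal (σ ^ (2 * 0 + 1)) * ENNReal.ofReal 1 := by
  have : (volume : Measure (EuclideanSpace ℝ (Fin k) ×
      EuclideanSpace ℝ (Fin (0 + 1)))).IsAddHaarMeasure := Measure.prod.instIsAddHaarMeasure _ _
  obtain ⟨b, hb⟩ := exists_lintegral_comparison (M := M) (n := n) (by simpa using hdim)
    hΦ.lipschitzOnWith hΦ.edist_le
  set v := volume (Metric.closedBall (0 : EuclideanSpace ℝ (Fin k)) r)
  set v' := volume (Metric.ball (0 : EuclideanSpace ℝ (Fin (0 + 1))) 1)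
  have hv : v ≠ ⊤ := measure_closedBall_lt_top.ne
  have hv' : v' ≠ ⊤ := measure_ball_lt_top.ne
  have hci : (ENNReal.ofReal c)⁻¹ ≠ ⊤ := by simpa using hc
  refine ⟨(b * ((ENNReal.ofReal c)⁻¹ * (b * (v * v')))).toNNReal, fun σ hσ => ?_⟩
  rw [ENNReal.coe_toNNReal (by finiteness)]
  set T : Set (EuclideanSpace ℝ (Fin k) × EuclideanSpace ℝ (Fin (0 + 1))) :=
    Metric.closedBall 0 r ×ˢ shell _ σ
  have hTm : MeasurableSet T := Metric.isClosed_closedBall.measurableSet.prod (measurableSet_shell σ)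
  have hT : T ⊆ Metric.ball 0 ρ := by
    intro q hq
    rw [mem_ball_zero_iff, Prod.norm_def]
    exact max_lt ((mem_closedBall_zero_iff.1 hq.1).trans_lt hrρ)
      ((hq.2.2.trans hσ.2).trans_lt hrρ)
  calc ∫⁻ q in T, (ENNReal.ofReal (w (Φ q)))⁻¹
      ≤ b * ∫⁻ y in Φ '' T, (ENNReal.ofReal (w y))⁻¹ ∂vol M n :=
        ((hb T hT hTm).2 fun y => (ENNReal.ofReal (w y))⁻¹).1
    _ ≤ b * ∫⁻ y in Φ '' T, (ENNReal.ofReal c)⁻¹ ∂vol M n := by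
        refine mul_le_mul' le_rfl ?_
        refine lintegral_mono_ae ((ae_restrict_of_ae hw).mono fun y hy => ?_)
        exact ENNReal.inv_le_inv.2 (ENNReal.ofReal_le_ofReal hy)
    _ ≤ b * (b * ∫⁻ q in T, (ENNReal.ofReal c)⁻¹) := by
        refine mul_le_mul' le_rfl ?_
        exact ((hb T hT hTm).2 fun y => (ENNReal.ofReal c)⁻¹).2
    _ ≤ b * (b * ((ENNReal.ofReal c)⁻¹ * (v * (ENNReal.ofReal (σ ^ (0 + 1)) * v')))) := by
        rw [setLIntegral_const]
        gcongr
        rw [Measure.volume_eq_prod, Measure.prod_prod]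
        gcongr
        have : volume (Metric.closedBall (0 : EuclideanSpace ℝ (Fin (0 + 1))) σ) =
            ENNReal.ofReal (σ ^ (0 + 1)) * v' := by
          rw [Measure.addHaar_closedBall _ _ hσ.1.le, finrank_euclideanSpace_fin]
        rw [← this]
        exact measure_mono fun z hz => mem_closedBall_zero_iff.2 hz.2
    _ = _ := by
        simp only [mul_zero, zero_add, ENNReal.ofReal_one]
        ring

end ShellBounds

end GluedManifold

namespace GluedManifold

/-! ### Shell bounds for Muckenhoupt weights -/

section Averaging

variable {V W : Type*} [NormedAddCommGroup V] [NormedSpace ℝ V] [FiniteDimensional ℝ V]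
  [MeasureSpace V] [BorelSpace V] [(volume : Measure V).IsAddHaarMeasure]
  [NormedAddCommGroup W] [NormedSpace ℝ W] [FiniteDimensional ℝ W]
  [MeasureSpace W] [BorelSpace W] [(volume : Measure W).IsAddHaarMeasure]

/-- Averaging of integrals over small balls centred on `V × {0}`. -/
theorem measure_closedBall_mul_setLIntegral_le {F : V × W → ℝ≥0∞} (hF : Measurable F) {r σ : ℝ}
    (hσr : σ ≤ r) {B : ℝ≥0∞}
    (h : ∀ x ∈ Metric.closedBall (0 : V) (2 * r),
      ∫⁻ q in Metric.closedBall (x, (0 : W)) σ, F q ≤ B) :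
    volume (Metric.closedBall (0 : V) σ) * ∫⁻ q in Metric.closedBall 0 r ×ˢ shell W σ, F q ≤
      volume (Metric.closedBall (0 : V) (2 * r)) * B := by
  set T : Set (V × W) := Metric.closedBall 0 r ×ˢ shell W σ
  have hT : MeasurableSet T := Metric.isClosed_closedBall.measurableSet.prod (measurableSet_shell σ)
  -- The kernel pairs q in the shell with centres x within σ of its first coordinate. Integrating in
  -- x first gives the left side; in q first, the max norm puts q in the ball of radius σ about (x,
  -- 0), and x has norm at most r + σ ≤ 2r.
  let g : V × W → V → ℝ≥0∞ := fun q x =>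
    T.indicator F q * (Metric.closedBall q.1 σ).indicator 1 x
  have hg : Measurable (Function.uncurry g) := by
    refine ((hF.indicator hT).comp measurable_fst).mul ?_
    have hS : MeasurableSet {p : (V × W) × V | dist p.2 p.1.1 ≤ σ} :=
      (isClosed_le (by fun_prop) continuous_const).measurableSet
    exact (measurable_const (a := (1 : ℝ≥0∞))).indicator hS
  have h1 : ∀ q, ∫⁻ x, g q x = volume (Metric.closedBall (0 : V) σ) * T.indicator F q := by
    intro q
    have hm : Measurable ((Metric.closedBall q.1 σ).indicator (1 : V → ℝ≥0∞)) :=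
      measurable_one.indicator Metric.isClosed_closedBall.measurableSet
    simp only [g]
    rw [lintegral_const_mul _ hm, lintegral_indicator_one Metric.isClosed_closedBall.measurableSet,
      Measure.addHaar_closedBall_center, mul_comm]
  have h2 : ∀ x, ∫⁻ q, g q x ≤ (Metric.closedBall (0 : V) (2 * r)).indicator (fun _ => B) x := by
    intro x
    by_cases hx : x ∈ Metric.closedBall (0 : V) (2 * r)
    · rw [indicator_of_mem hx]
      refine le_trans ?_ (h x hx)
      rw [← lintegral_indicator Metric.isClosed_closedBall.measurableSet]
      refine lintegral_mono fun q => ?_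
      by_cases hq : q ∈ T ∧ x ∈ Metric.closedBall q.1 σ
      · have hqx : q ∈ Metric.closedBall (x, (0 : W)) σ := by
          rw [Metric.mem_closedBall, Prod.dist_eq]
          exact max_le (Metric.mem_closedBall'.1 hq.2) (by simpa using hq.1.2.2)
        simp only [g]
        rw [indicator_of_mem hq.1, indicator_of_mem hq.2, indicator_of_mem hqx]
        simp
      · have : g q x = 0 := by
          simp only [g, mul_eq_zero]
          by_cases hqT : q ∈ T
          · exact Or.inr (indicator_of_notMem (fun h => hq ⟨hqT, h⟩) _)
          · exact Or.inl (indicator_of_notMem hqT _)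
        rw [this]; exact zero_le
    · rw [indicator_of_notMem hx]
      refine (lintegral_eq_zero_of_ae_eq_zero (ae_of_all _ fun q => ?_)).le
      simp only [g, Pi.zero_apply, mul_eq_zero]
      by_cases hqT : q ∈ T
      · refine Or.inr (indicator_of_notMem (fun hxq => hx ?_) _)
        rw [mem_closedBall_zero_iff]
        have h3 : ‖q.1‖ ≤ r := mem_closedBall_zero_iff.1 hqT.1
        have h4 : dist x q.1 ≤ σ := hxq
        rw [dist_eq_norm] at h4
        calc ‖x‖ = ‖(x - q.1) + q.1‖ := by rw [sub_add_cancel]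
          _ ≤ ‖x - q.1‖ + ‖q.1‖ := norm_add_le _ _
          _ ≤ 2 * r := by linarith
      · exact Or.inl (indicator_of_notMem hqT _)
  calc volume (Metric.closedBall (0 : V) σ) * ∫⁻ q in T, F q
      = ∫⁻ q, ∫⁻ x, g q x := by
        simp_rw [h1]
        rw [lintegral_const_mul _ (hF.indicator hT), lintegral_indicator hT]
    _ = ∫⁻ x, ∫⁻ q, g q x := lintegral_lintegral_swap hg.aemeasurable
    _ ≤ ∫⁻ x, (Metric.closedBall (0 : V) (2 * r)).indicator (fun _ => B) x := lintegral_mono h2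
    _ = _ := by
        rw [lintegral_indicator Metric.isClosed_closedBall.measurableSet, setLIntegral_const,
          mul_comm]

end Averaging

section Muckenhoupt

theorem IsMuckenhouptA2.exists_mul_le {M : Type*} [MetricSpace M] [MeasurableSpace M]
    [BorelSpace M] {n : ℕ} {w : M → ℝ} (hw : IsMuckenhouptA2 n w) :
    ∃ A : ℝ≥0, ∀ (x : M) (r : ℝ), 0 < r → vol M n (Metric.ball x r) ≠ 0 →
      vol M n (Metric.ball x r) ≠ ⊤ →
      (∫⁻ y in Metric.ball x r, ENNReal.ofReal (w y) ∂vol M n) *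
        (∫⁻ y in Metric.ball x r, (ENNReal.ofReal (w y))⁻¹ ∂vol M n) ≤
        A * vol M n (Metric.ball x r) ^ 2 := by
  obtain ⟨-, -, A, hA⟩ := hw
  refine ⟨A, fun x r hr h0 ht => ?_⟩
  have h := hA x r hr
  rw [setLAverage_eq, setLAverage_eq] at h
  set v := vol M n (Metric.ball x r)
  set P := ∫⁻ y in Metric.ball x r, ENNReal.ofReal (w y) ∂vol M n
  set Q := ∫⁻ y in Metric.ball x r, (ENNReal.ofReal (w y))⁻¹ ∂vol M n
  calc P * Q = (P / v * v) * (Q / v * v) := by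
        rw [ENNReal.div_mul_cancel h0 ht, ENNReal.div_mul_cancel h0 ht]
    _ = P / v * (Q / v) * v ^ 2 := by ring
    _ ≤ A * v ^ 2 := by gcongr

variable {n : ℕ} [NeZero n] {k d : ℕ}
  {M : Type*} [MetricSpace M] [ChartedSpace (EuclideanHalfSpace n) M]
  [RiemannianBundle (fun x : M => TangentSpace (𝓡∂ n) x)]
  {L : Set M} {ρ : ℝ} {C : ℝ≥0}
  {Φ : EuclideanSpace ℝ (Fin k) × EuclideanSpace ℝ (Fin (d + 1)) → M}

/-- Near `L` there are points at any prescribed small distance from `L`. -/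
theorem IsAdaptedChart.exists_infDist_eq (hΦ : IsAdaptedChart (n := n) L Φ ρ C) (hC : 1 ≤ C)
    {x : EuclideanSpace ℝ (Fin k)} {s : ℝ} (hx : ‖x‖ < ρ) (hs : 0 ≤ s) (hsρ : C * s < ρ) :
    ∃ z, ‖z‖ ≤ C * s ∧ Metric.infDist (Φ (x, z)) L = s := by
  set e : EuclideanSpace ℝ (Fin (d + 1)) := EuclideanSpace.single 0 1 with he
  have hne : ‖e‖ = 1 := by simp [he]
  have hC0 : (0 : ℝ) < C := lt_of_lt_of_le one_pos (by exact_mod_cast hC)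
  have hCs : 0 ≤ (C : ℝ) * s := mul_nonneg hC0.le hs
  have hmem : ∀ t ∈ Icc (0 : ℝ) (C * s), (x, t • e) ∈ Metric.ball 0 ρ := by
    intro t ht
    rw [mem_ball_zero_iff, Prod.norm_def, max_lt_iff]
    refine ⟨hx, ?_⟩
    rw [norm_smul, hne, mul_one, Real.norm_of_nonneg ht.1]
    exact ht.2.trans_lt hsρ
  -- The intermediate value theorem along a straight segment: the distance to `L` is 0 at t = 0, and
  -- at least s at t = Cs by `norm_snd_le`.
  have hcont : ContinuousOn (fun t : ℝ => Metric.infDist (Φ (x, t • e)) L) (Icc 0 (C * s)) :=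
    (Metric.continuous_infDist_pt L).comp_continuousOn
      (hΦ.lipschitzOnWith.continuousOn.comp (by fun_prop) hmem)
  have h0 : Metric.infDist (Φ (x, (0 : ℝ) • e)) L = 0 := by
    rw [zero_smul]
    exact Metric.infDist_zero_of_mem (hΦ.mem x hx)
  have h1 : s ≤ Metric.infDist (Φ (x, (C * s : ℝ) • e)) L := by
    refine (Metric.le_infDist ⟨_, hΦ.mem x hx⟩).2 fun a ha => ?_
    have := hΦ.norm_snd_le _ (hmem (C * s) ⟨hCs, le_rfl⟩) a ha
    rw [norm_smul, hne, mul_one, Real.norm_of_nonneg hCs] at this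
    exact le_of_mul_le_mul_left this hC0
  obtain ⟨t, ht, hts⟩ := intermediate_value_Icc hCs hcont
    (show s ∈ Icc _ _ from ⟨by simpa only [h0] using hs, h1⟩)
  refine ⟨t • e, ?_, hts⟩
  rw [norm_smul, hne, mul_one, Real.norm_of_nonneg ht.1]
  exact ht.2

variable [MeasurableSpace M] [BorelSpace M]

/-- A ball about a point of `L` contains one of radius s about a point at distance exactly s from
`L`, where the doubling condition bounds the mass from below. The A₂ product bound, of order s^(2n),
divided by s^(k+1) leaves the exponent 2n - (k+1) = k + 2d + 1. -/
theorem IsAdaptedChart.exists_ball_bound (hρ : 0 < ρ) (hC : 1 ≤ C) (hdim : k + (d + 1) = n)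
    (hΦ : IsAdaptedChart (n := n) L Φ ρ C) {w : M → ℝ} (hw : IsMuckenhouptA2 n w)
    {δ₀ : ℝ} (hδ₀ : 0 < δ₀) {m : ℝ≥0} {N : ℝ → ℝ}
    (hH : ∀ y, ∀ s ∈ Ioo 0 δ₀, dist y (Φ 0) < δ₀ → Metric.infDist y L = s →
      ENNReal.ofReal (s ^ (k + 1)) ≤
        m * ENNReal.ofReal (N (2 * s)) * weightedVol n w (Metric.ball y s)) :
    ∃ (δ : ℝ) (G : ℝ≥0), 0 < δ ∧ ∀ x ∈ Metric.closedBall (0 : EuclideanSpace ℝ (Fin k)) δ,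
      ∀ s ∈ Ioc 0 δ, ∫⁻ y in Metric.ball (Φ (x, 0)) ((C ^ 2 + 1) * s),
        (ENNReal.ofReal (w y))⁻¹ ∂vol M n ≤
          G * ENNReal.ofReal (N (2 * s)) * ENNReal.ofReal (s ^ (k + 2 * d + 1)) := by
  obtain ⟨δ₁, a, hδ₁, -, ha⟩ := hΦ.exists_vol_ball_bounds hdim hρ
  obtain ⟨A, hA⟩ := hw.exists_mul_le
  have hC1 : (1 : ℝ) ≤ C := by exact_mod_cast hC
  -- The point (x, z) found below has ‖z‖ ≤ Cs, so its image is within C²s of Φ(x, 0); one more s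
  -- covers its ball.
  set Λ : ℝ := (C : ℝ) ^ 2 + 1 with hΛ
  have hΛ0 : 0 < Λ := by positivity
  set η := min ρ (min δ₁ δ₀) with hη
  have hη0 : 0 < η := lt_min hρ (lt_min hδ₁ hδ₀)
  have hηρ : η ≤ ρ := min_le_left _ _
  have hηδ₁ : η ≤ δ₁ := (min_le_right _ _).trans (min_le_left _ _)
  have hηδ₀ : η ≤ δ₀ := (min_le_right _ _).trans (min_le_right _ _)
  set δ := η / (2 * Λ) with hδ
  have hδ0 : 0 < δ := by positivity
  have hδΛ : Λ * δ = η / 2 := by rw [hδ]; field_simp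
  have hCC : (C : ℝ) ≤ C ^ 2 := by nlinarith
  have hbd : δ < η ∧ C * δ < η ∧ C * (C * δ) < η := by
    refine ⟨?_, ?_, ?_⟩ <;> nlinarith
  set G : ℝ≥0∞ := m * A * (a * ENNReal.ofReal (Λ ^ n)) ^ 2 with hG
  have hGt : G ≠ ⊤ := by finiteness
  refine ⟨δ, G.toNNReal, hδ0, fun x hx s hs => ?_⟩
  rw [ENNReal.coe_toNNReal hGt]
  have hx' : ‖x‖ ≤ δ := mem_closedBall_zero_iff.1 hx
  have hxρ : ‖x‖ < ρ := hx'.trans_lt (hbd.1.trans_le hηρ)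
  have hCs : C * s ≤ C * δ := mul_le_mul_of_nonneg_left hs.2 C.coe_nonneg
  obtain ⟨z, hz, hzs⟩ := hΦ.exists_infDist_eq hC hxρ hs.1.le
    (hCs.trans_lt (hbd.2.1.trans_le hηρ))
  have h0 : (0 : EuclideanSpace ℝ (Fin k) × EuclideanSpace ℝ (Fin (d + 1))) ∈
    Metric.ball 0 ρ := Metric.mem_ball_self hρ
  have hx0 : (x, (0 : EuclideanSpace ℝ (Fin (d + 1)))) ∈ Metric.ball 0 ρ := by
    rw [mem_ball_zero_iff, Prod.norm_def, norm_zero]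
    exact max_lt hxρ hρ
  have hxz : (x, z) ∈ Metric.ball 0 ρ := by
    rw [mem_ball_zero_iff, Prod.norm_def]
    exact max_lt hxρ (hz.trans_lt (hCs.trans_lt (hbd.2.1.trans_le hηρ)))
  have hyd : dist (Φ (x, z)) (Φ 0) < δ₀ := by
    refine (hΦ.lipschitzOnWith.dist_le_mul _ hxz _ h0).trans_lt (lt_of_le_of_lt ?_
      (hbd.2.2.trans_le hηδ₀))
    gcongr
    rw [dist_zero_right, Prod.norm_def]
    refine max_le (hx'.trans ?_) (hz.trans hCs)
    nlinarith
  have hsub : Metric.ball (Φ (x, z)) s ⊆ Metric.ball (Φ (x, 0)) (Λ * s) := by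
    refine Metric.ball_subset_ball' ?_
    have h1 := hΦ.lipschitzOnWith.dist_le_mul _ hxz _ hx0
    rw [Prod.dist_eq, dist_self, dist_zero_right, max_eq_right (norm_nonneg _)] at h1
    have h2 : (C : ℝ) * ‖z‖ ≤ C * (C * s) := by gcongr
    rw [hΛ]
    linarith
  have hxd : Φ (x, 0) ∈ Metric.ball (Φ 0) δ₁ := by
    refine (hΦ.lipschitzOnWith.dist_le_mul _ hx0 _ h0).trans_lt (lt_of_le_of_lt ?_
      (hbd.2.1.trans_le hηδ₁))
    gcongr
    rw [dist_zero_right, Prod.norm_def, norm_zero]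
    exact max_le hx' hδ0.le
  have hΛs : Λ * s ∈ Ioo 0 δ₁ := by
    refine ⟨mul_pos hΛ0 hs.1, ?_⟩
    have : Λ * s ≤ Λ * δ := by gcongr; exact hs.2
    linarith
  obtain ⟨hv1, hv2⟩ := ha _ hxd _ hΛs
  have hv0 : vol M n (Metric.ball (Φ (x, 0)) (Λ * s)) ≠ 0 := by
    intro h
    rw [h, mul_zero, nonpos_iff_eq_zero, ENNReal.ofReal_eq_zero] at hv1
    exact absurd hv1 (not_le.2 (pow_pos hΛs.1 n))
  have hvt : vol M n (Metric.ball (Φ (x, 0)) (Λ * s)) ≠ ⊤ :=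
    ne_top_of_le_ne_top (by finiteness) hv2
  have hA' := hA _ _ hΛs.1 hv0 hvt
  set I := ∫⁻ y in Metric.ball (Φ (x, 0)) (Λ * s), (ENNReal.ofReal (w y))⁻¹ ∂vol M n
  have hsk : ENNReal.ofReal (s ^ (k + 1)) ≠ 0 := by
    rw [Ne, ENNReal.ofReal_eq_zero, not_le]
    exact pow_pos hs.1 _
  refine (ENNReal.mul_le_mul_iff_right hsk ENNReal.ofReal_ne_top).1 ?_
  have hpow : ENNReal.ofReal ((Λ * s) ^ n) ^ 2 = ENNReal.ofReal (Λ ^ n) ^ 2 *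
      (ENNReal.ofReal (s ^ (k + 1)) * ENNReal.ofReal (s ^ (k + 2 * d + 1))) := by
    rw [mul_pow, ENNReal.ofReal_mul (by positivity), mul_pow,
      ← ENNReal.ofReal_mul (pow_nonneg hs.1.le _), ← ENNReal.ofReal_pow (pow_nonneg hs.1.le _),
      ← pow_mul, ← pow_add]
    congr 3
    omega
  calc ENNReal.ofReal (s ^ (k + 1)) * I
      ≤ m * ENNReal.ofReal (N (2 * s)) * weightedVol n w (Metric.ball (Φ (x, z)) s) * I := by
        gcongr
        exact hH _ s ⟨hs.1, hs.2.trans_lt (hbd.1.trans_le hηδ₀)⟩ hyd hzs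
    _ ≤ m * ENNReal.ofReal (N (2 * s)) *
        (∫⁻ y in Metric.ball (Φ (x, 0)) (Λ * s), ENNReal.ofReal (w y) ∂vol M n) * I := by
        gcongr
        refine (measure_mono hsub).trans_eq ?_
        rw [weightedVol, withDensity_apply _ Metric.isOpen_ball.measurableSet]
    _ ≤ m * ENNReal.ofReal (N (2 * s)) *
        (A * vol M n (Metric.ball (Φ (x, 0)) (Λ * s)) ^ 2) := by
        rw [mul_assoc]
        gcongr
    _ ≤ m * ENNReal.ofReal (N (2 * s)) * (A * (a * ENNReal.ofReal ((Λ * s) ^ n)) ^ 2) := by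
        gcongr
    _ = _ := by
        rw [mul_pow, hpow, hG, mul_pow]
        ring

/-- The bound on shells for a Muckenhoupt weight whose mass near `L` is bounded from below. -/
theorem IsAdaptedChart.exists_shell_bound_of_isMuckenhouptA2 [SecondCountableTopology M]
    (hρ : 0 < ρ) (hC : 1 ≤ C) (hdim : k + (d + 1) = n) (hΦm : Measurable Φ)
    (hΦ : IsAdaptedChart (n := n) L Φ ρ C) {w : M → ℝ} (hw : IsMuckenhouptA2 n w)
    {δ₀ : ℝ} (hδ₀ : 0 < δ₀) {m : ℝ≥0} {N : ℝ → ℝ}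
    (hH : ∀ y, ∀ s ∈ Ioo 0 δ₀, dist y (Φ 0) < δ₀ → Metric.infDist y L = s →
      ENNReal.ofReal (s ^ (k + 1)) ≤
        m * ENNReal.ofReal (N (2 * s)) * weightedVol n w (Metric.ball y s)) :
    ∃ (r : ℝ) (A : ℝ≥0), 0 < r ∧ r < ρ ∧ ∀ σ ∈ Ioc 0 r,
      ∫⁻ q in Metric.closedBall 0 r ×ˢ shell _ σ, (ENNReal.ofReal (w (Φ q)))⁻¹ ≤
        A * ENNReal.ofReal (σ ^ (2 * d + 1)) * ENNReal.ofReal (N (2 * σ)) := by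
  have : (volume : Measure (EuclideanSpace ℝ (Fin k) ×
      EuclideanSpace ℝ (Fin (d + 1)))).IsAddHaarMeasure := Measure.prod.instIsAddHaarMeasure _ _
  obtain ⟨δ, G, hδ, hball⟩ := hΦ.exists_ball_bound hρ hC hdim hw hδ₀ hH
  obtain ⟨c, hc⟩ := exists_lintegral_comparison (M := M) (n := n) (by simpa using hdim)
    hΦ.lipschitzOnWith hΦ.edist_le
  have hC1 : (1 : ℝ) ≤ C := by exact_mod_cast hC
  set r := min (δ / 2) (ρ / 4)
  have hr0 : 0 < r := lt_min (by linarith) (by linarith)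
  have hrδ : r ≤ δ / 2 := min_le_left _ _
  have hrρ : r ≤ ρ / 4 := min_le_right _ _
  set v := volume (Metric.ball (0 : EuclideanSpace ℝ (Fin k)) 1)
  have hv0 : v ≠ 0 := (Metric.measure_ball_pos _ _ one_pos).ne'
  have hvt : v ≠ ⊤ := measure_ball_lt_top.ne
  set v' := volume (Metric.closedBall (0 : EuclideanSpace ℝ (Fin k)) (2 * r))
  have hv't : v' ≠ ⊤ := measure_closedBall_lt_top.ne
  refine ⟨r, (v⁻¹ * (v' * (c * G))).toNNReal, hr0, by linarith, fun σ hσ => ?_⟩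
  rw [ENNReal.coe_toNNReal (by finiteness)]
  have hF : Measurable fun q => (ENNReal.ofReal (w (Φ q)))⁻¹ :=
    ((hw.1.comp hΦm).ennreal_ofReal).inv
  have key := measure_closedBall_mul_setLIntegral_le hF hσ.2
    (B := c * (G * ENNReal.ofReal (N (2 * σ)) * ENNReal.ofReal (σ ^ (k + 2 * d + 1)))) (by
      intro x hx
      have hx' : ‖x‖ ≤ 2 * r := mem_closedBall_zero_iff.1 hx
      have hx0 : (x, (0 : EuclideanSpace ℝ (Fin (d + 1)))) ∈ Metric.ball 0 ρ := by
        rw [mem_ball_zero_iff, Prod.norm_def, norm_zero]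
        exact max_lt (by linarith) hρ
      have hsub : Metric.closedBall (x, (0 : EuclideanSpace ℝ (Fin (d + 1)))) σ ⊆
          Metric.ball 0 ρ := by
        refine Metric.closedBall_subset_ball' ?_
        rw [dist_zero_right, Prod.norm_def, norm_zero, max_eq_left (norm_nonneg _)]
        linarith [hσ.2]
      refine ((hc _ hsub Metric.isClosed_closedBall.measurableSet).2
        fun y => (ENNReal.ofReal (w y))⁻¹).1.trans (mul_le_mul' le_rfl (le_trans ?_
          (hball x (mem_closedBall_zero_iff.2 (by linarith)) σ ⟨hσ.1, by linarith [hσ.2]⟩)))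
      refine lintegral_mono_set ?_
      rintro _ ⟨q, hq, rfl⟩
      refine (hΦ.lipschitzOnWith.dist_le_mul _ (hsub hq) _ hx0).trans_lt ?_
      have h1 : (C : ℝ) * dist q (x, 0) ≤ C * σ := by gcongr; exact hq
      have h2 : (C : ℝ) * σ < (C ^ 2 + 1) * σ :=
        mul_lt_mul_of_pos_right (by nlinarith) hσ.1
      exact h1.trans_lt h2)
  rw [Measure.addHaar_closedBall _ _ hσ.1.le, finrank_euclideanSpace_fin] at key
  have hσk : ENNReal.ofReal (σ ^ k) ≠ 0 := by
    rw [Ne, ENNReal.ofReal_eq_zero, not_le]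
    exact pow_pos hσ.1 _
  -- Dividing by the volume of a k-dimensional ball of radius σ lowers the exponent from k + 2d + 1
  -- to 2d + 1.
  refine (ENNReal.mul_le_mul_iff_right (mul_ne_zero hσk hv0) (by finiteness)).1 (key.trans_eq ?_)
  have hpow : ENNReal.ofReal (σ ^ (k + 2 * d + 1)) =
      ENNReal.ofReal (σ ^ k) * ENNReal.ofReal (σ ^ (2 * d + 1)) := by
    rw [← ENNReal.ofReal_mul (pow_nonneg hσ.1.le _), ← pow_add, add_assoc]
  rw [hpow]
  calc v' * (c * (G * ENNReal.ofReal (N (2 * σ)) *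
        (ENNReal.ofReal (σ ^ k) * ENNReal.ofReal (σ ^ (2 * d + 1)))))
      = (v * v⁻¹) * (v' * (c * (G * ENNReal.ofReal (N (2 * σ)) *
        (ENNReal.ofReal (σ ^ k) * ENNReal.ofReal (σ ^ (2 * d + 1)))))) := by
        rw [ENNReal.mul_inv_cancel hv0 hvt, one_mul]
    _ = _ := by ring

end Muckenhoupt

/-- The doubling condition bounds the mass of `M₁` near the intersection from below. -/
theorem IsNDoubling.exists_le_weightedVol_ball {E M₁ M₂ : Type*} [TopologicalSpace E]
    [MeasurableSpace E] [MetricSpace M₁] [MetricSpace M₂]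
    [MeasurableSpace M₁] [BorelSpace M₁] [MeasurableSpace M₂] [BorelSpace M₂] {n₁ n₂ : ℕ}
    {ι₁ : M₁ → E} {ι₂ : M₂ → E} (h₁ : MeasurableEmbedding ι₁) (h₂ : MeasurableEmbedding ι₂)
    (h₁c : Continuous ι₁) (h₂e : IsEmbedding ι₂) {w₁ : M₁ → ℝ} {w₂ : M₂ → ℝ}
    {N : ℝ → ℝ} (hN : IsNDoubling ι₁ ι₂ (gluedMeasure n₁ n₂ ι₁ ι₂ w₁ w₂) N)
    {c : ℝ} (hc : 0 < c) (hw₂ : ∀ᵐ y ∂vol M₂ n₂, c ≤ w₂ y) {p₁ : M₁} {p₂ : M₂}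
    (hp : ι₁ p₁ = ι₂ p₂) {δ : ℝ} (hδ : 0 < δ) {a : ℝ≥0}
    (hvol : ∀ b ∈ Metric.ball p₂ δ, ∀ s ∈ Ioo 0 δ,
      ENNReal.ofReal (s ^ n₂) ≤ a * vol M₂ n₂ (Metric.ball b s)) :
    ∃ (δ₀ : ℝ) (m : ℝ≥0), 0 < δ₀ ∧ ∀ y, ∀ s ∈ Ioo 0 δ₀, dist y p₁ < δ₀ →
      Metric.infDist y (ι₁ ⁻¹' inter ι₁ ι₂) = s →
      ENNReal.ofReal (s ^ n₂) ≤
        m * ENNReal.ofReal (N (2 * s)) * weightedVol n₁ w₁ (Metric.ball y s) := by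
  -- The two manifolds share only the topology of the ambient space, so this is how points of `L`
  -- that are `d₁`-close to `p₁` are seen to be `d₂`-close to `p₂`.
  have hnhds : Metric.ball p₂ δ ∈ comap ι₂ (𝓝 (ι₂ p₂)) := by
    rw [← h₂e.isInducing.nhds_eq_comap]
    exact Metric.ball_mem_nhds _ hδ
  obtain ⟨O, hO, hOsub⟩ := hnhds
  obtain ⟨ε, hε, hεO⟩ := Metric.mem_nhds_iff.1 (h₁c.continuousAt (x := p₁) (hp ▸ hO))
  have hci : (ENNReal.ofReal c)⁻¹ ≠ ⊤ := by simpa using hc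
  refine ⟨min δ (ε / 3), (a * (ENNReal.ofReal c)⁻¹).toNNReal, lt_min hδ (by linarith),
    fun y s hs hy hys => ?_⟩
  rw [ENNReal.coe_toNNReal (by finiteness)]
  have hne : (ι₁ ⁻¹' inter ι₁ ι₂).Nonempty := ⟨p₁, mem_range_self p₁, hp ▸ mem_range_self p₂⟩
  -- A point of `L` within 2s, rather than a nearest one, is all that `IsNDoubling.measure_ball_le`
  -- asks for.
  obtain ⟨x, hx, hyx⟩ := (Metric.infDist_lt_iff hne).1
    (hys.trans_lt (by linarith [hs.1] : s < 2 * s))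
  obtain ⟨b, hb⟩ := hx.2
  have hsε : s < ε / 3 := hs.2.trans_le (min_le_right _ _)
  have hyε : dist y p₁ < ε / 3 := hy.trans_le (min_le_right _ _)
  have hxε : x ∈ Metric.ball p₁ ε := by
    rw [Metric.mem_ball]
    linarith [dist_triangle x y p₁, dist_comm x y]
  have hbδ : b ∈ Metric.ball p₂ δ := hOsub (by
    rw [mem_preimage, hb]
    exact hεO hxε)
  have hlow : vol M₂ n₂ (Metric.ball b s) ≤
      (ENNReal.ofReal c)⁻¹ * weightedVol n₂ w₂ (Metric.ball b s) := by
    rw [weightedVol, withDensity_apply _ Metric.isOpen_ball.measurableSet]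
    have : ENNReal.ofReal c * vol M₂ n₂ (Metric.ball b s) ≤
        ∫⁻ y in Metric.ball b s, ENNReal.ofReal (w₂ y) ∂vol M₂ n₂ := by
      rw [← setLIntegral_const]
      exact lintegral_mono_ae ((ae_restrict_of_ae hw₂).mono fun y hy =>
        ENNReal.ofReal_le_ofReal hy)
    rw [mul_comm, ← div_eq_mul_inv, ENNReal.le_div_iff_mul_le (by simp [hc]) (by simp), mul_comm]
    exact this
  calc ENNReal.ofReal (s ^ n₂) ≤ a * vol M₂ n₂ (Metric.ball b s) :=
        hvol b hbδ s ⟨hs.1, hs.2.trans_le (min_le_left _ _)⟩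
    _ ≤ a * ((ENNReal.ofReal c)⁻¹ * (ENNReal.ofReal (N (2 * s)) *
          weightedVol n₁ w₁ (Metric.ball y s))) := by
        gcongr
        refine hlow.trans ?_
        gcongr
        exact hN.measure_ball_le h₁ h₂ hs.1 hb.symm hyx fun a ha =>
          hys ▸ Metric.infDist_le_dist_of_mem ha
    _ = _ := by ring

end GluedManifold

/-! ### Assembly at a common point of the two manifolds -/

theorem mainTheorem3 {n₁ n₂ n k m : ℕ} [NeZero n₁] [NeZero n₂]
    -- `M₁` and `M₂` are compact connected smooth Riemannian manifolds with boundary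
    {M₁ : Type*} [MetricSpace M₁] [CompactSpace M₁] [ConnectedSpace M₁]
    [ChartedSpace (EuclideanHalfSpace n₁) M₁] [IsManifold (𝓡∂ n₁) ∞ M₁]
    [RiemannianBundle (fun x : M₁ => TangentSpace (𝓡∂ n₁) x)]
    [IsContMDiffRiemannianBundle (𝓡∂ n₁) ∞ (EuclideanSpace ℝ (Fin n₁))
      (fun x : M₁ => TangentSpace (𝓡∂ n₁) x)]
    [IsRiemannianManifold (𝓡∂ n₁) M₁] [MeasurableSpace M₁] [BorelSpace M₁]
    {M₂ : Type*} [MetricSpace M₂] [CompactSpace M₂] [ConnectedSpace M₂]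
    [ChartedSpace (EuclideanHalfSpace n₂) M₂] [IsManifold (𝓡∂ n₂) ∞ M₂]
    [RiemannianBundle (fun x : M₂ => TangentSpace (𝓡∂ n₂) x)]
    [IsContMDiffRiemannianBundle (𝓡∂ n₂) ∞ (EuclideanSpace ℝ (Fin n₂))
      (fun x : M₂ => TangentSpace (𝓡∂ n₂) x)]
    [IsRiemannianManifold (𝓡∂ n₂) M₂] [MeasurableSpace M₂] [BorelSpace M₂]
    -- both are smoothly embedded in the same Euclidean space
    (ι₁ : M₁ → EuclideanSpace ℝ (Fin m)) (ι₂ : M₂ → EuclideanSpace ℝ (Fin m))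
    (hι₁ : IsSmoothEmbedding (𝓡∂ n₁) 𝓘(ℝ, EuclideanSpace ℝ (Fin m)) ∞ ι₁)
    (hι₂ : IsSmoothEmbedding (𝓡∂ n₂) 𝓘(ℝ, EuclideanSpace ℝ (Fin m)) ∞ ι₂)
    -- the intersection `L` is nonempty and lies in the interior of both manifolds
    (hL : (GluedManifold.inter ι₁ ι₂).Nonempty)
    (hL₁ : ∀ a : M₁, ι₁ a ∈ GluedManifold.inter ι₁ ι₂ → (𝓡∂ n₁).IsInteriorPoint a)
    (hL₂ : ∀ b : M₂, ι₂ b ∈ GluedManifold.inter ι₁ ι₂ → (𝓡∂ n₂).IsInteriorPoint b)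
    -- `L` is a smooth embedded manifold of dimension `k`, with `k = n₂ - 1` and `n₁ ≥ n₂`
    {K : Type*} [TopologicalSpace K] [ChartedSpace (EuclideanSpace ℝ (Fin k)) K]
    [IsManifold (𝓡 k) ∞ K] (e : K → EuclideanSpace ℝ (Fin m))
    (he : IsSmoothEmbedding (𝓡 k) 𝓘(ℝ, EuclideanSpace ℝ (Fin m)) ∞ e)
    (heL : range e = GluedManifold.inter ι₁ ι₂)
    (hk : n₂ = k + 1) (hn : n₂ ≤ n₁)
    -- `M₁` and `M₂` are transversal in an embedded smooth manifold `P`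
    {P : Type*} [TopologicalSpace P] [ChartedSpace (EuclideanSpace ℝ (Fin n)) P]
    [IsManifold (𝓡 n) ∞ P] (j : P → EuclideanSpace ℝ (Fin m))
    (hj : IsSmoothEmbedding (𝓡 n) 𝓘(ℝ, EuclideanSpace ℝ (Fin m)) ∞ j)
    (htrans : GluedManifold.IsTransversal (n₁ := n₁) (n₂ := n₂) (n := n) ι₁ ι₂ j)
    -- the weights
    (w₁ : M₁ → ℝ) (w₂ : M₂ → ℝ)
    (hw₁ : GluedManifold.IsMuckenhouptA2 n₁ w₁) (hw₂ : GluedManifold.IsMuckenhouptA2 n₂ w₂)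
    (hw₁_bdry : ∃ V : Set M₁, IsOpen V ∧ (𝓡∂ n₁).boundary M₁ ⊆ V ∧
      ∃ C : ℝ, ∀ᵐ x ∂GluedManifold.vol M₁ n₁, x ∈ V → w₁ x ≤ C)
    (hw₂_bdd : ∃ c C : ℝ, 0 < c ∧ ∀ᵐ x ∂GluedManifold.vol M₂ n₂, c ≤ w₂ x ∧ w₂ x ≤ C)
    -- the measure
    (hμL : GluedManifold.gluedMeasure n₁ n₂ ι₁ ι₂ w₁ w₂ (GluedManifold.inter ι₁ ι₂) = 0)
    (N : ℝ → ℝ) (hN : LocallyIntegrableOn N (Ici 0) volume)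
    (hdoubling : GluedManifold.IsNDoubling ι₁ ι₂
      (GluedManifold.gluedMeasure n₁ n₂ ι₁ ι₂ w₁ w₂) N) :
    ∃ R : ℝ, 0 < R ∧
      0 < GluedManifold.capacity n₁ (GluedManifold.weightedVol n₁ w₁)
        (ι₁ ⁻¹' GluedManifold.inter ι₁ ι₂) (ι₁ ⁻¹' GluedManifold.tube ι₁ ι₂ R) ∧
      0 < GluedManifold.capacity n₂ (GluedManifold.weightedVol n₂ w₂)
        (ι₂ ⁻¹' GluedManifold.inter ι₁ ι₂) (ι₂ ⁻¹' GluedManifold.tube ι₁ ι₂ R) := by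
  have hι₁m : MeasurableEmbedding ι₁ :=
    (hι₁.isEmbedding.continuous.isClosedEmbedding hι₁.isEmbedding.injective).measurableEmbedding
  have hι₂m : MeasurableEmbedding ι₂ :=
    (hι₂.isEmbedding.continuous.isClosedEmbedding hι₂.isEmbedding.injective).measurableEmbedding
  obtain ⟨x, ⟨p₁, hp₁⟩, ⟨p₂, hp₂⟩⟩ := hL
  have hp₁L : ι₁ p₁ ∈ GluedManifold.inter ι₁ ι₂ :=
    ⟨mem_range_self p₁, p₂, hp₂.trans hp₁.symm⟩
  have hp₂L : ι₂ p₂ ∈ GluedManifold.inter ι₁ ι₂ :=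
    ⟨⟨p₁, hp₁.trans hp₂.symm⟩, mem_range_self p₂⟩
  -- The codimension of `L` in `M₁` is d + 1 ≥ 1, because n₁ ≥ n₂ = k + 1.
  obtain ⟨d, hd⟩ : ∃ d, k + (d + 1) = n₁ := ⟨n₁ - n₂, by omega⟩
  obtain ⟨Φ₁, ρ₁, C₁, hρ₁, hΦ₁0, hΦ₁⟩ := GluedManifold.exists_isAdaptedChart hι₁ he
    (heL ▸ inter_subset_left) (hL₁ p₁ hp₁L) (heL ▸ hp₁L) hd
  obtain ⟨Φ₂, ρ₂, C₂, hρ₂, hΦ₂0, hΦ₂⟩ := GluedManifold.exists_isAdaptedChart (d := 0 + 1) hι₂ he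
    (heL ▸ inter_subset_right) (hL₂ p₂ hp₂L) (heL ▸ hp₂L) (by omega)
  rw [heL] at hΦ₁ hΦ₂
  obtain ⟨Ψ₁, hΨ₁0, hΨ₁m, hΨ₁'⟩ := hΦ₁.exists_measurable hρ₁
  obtain ⟨Ψ₂, hΨ₂0, hΨ₂m, hΨ₂⟩ := hΦ₂.exists_measurable hρ₂
  have hΨ₁ := hΨ₁'.mono (le_max_left C₁ 1)
  obtain ⟨c, C, hc, hcC⟩ := hw₂_bdd
  have hcw : ∀ᵐ y ∂GluedManifold.vol M₂ n₂, c ≤ w₂ y := hcC.mono fun y hy => hy.1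
  obtain ⟨δ, a, hδ, -, ha⟩ := hΨ₂.exists_vol_ball_bounds (n' := n₂) (by omega) hρ₂
  rw [hΨ₂0, hΦ₂0] at ha
  obtain ⟨δ₀, m', hδ₀, hH⟩ := hdoubling.exists_le_weightedVol_ball hι₁m hι₂m
    hι₁.isEmbedding.continuous hι₂.isEmbedding hc hcw (hp₁.trans hp₂.symm) hδ
    fun b hb s hs => (ha b hb s hs).1
  -- The exponent n₂ of the mass of `M₂` becomes k + 1: one more than the dimension of `L`, as the
  -- shell bound requires.
  rw [← hΦ₁0, ← hΨ₁0, hk] at hH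
  obtain ⟨r, A, hr, hrρ, hA⟩ := hΨ₁.exists_shell_bound_of_isMuckenhouptA2 hρ₁
    (le_max_right C₁ 1) hd hΨ₁m hw₁ hδ₀ hH
  -- Local integrability of `N` up to and including 0 is what makes the integral over the shells
  -- converge.
  have hNr : IntegrableOn (fun σ => N (2 * σ)) (Ioc 0 r) := by
    have h1 : IntegrableOn N (Icc 0 (2 * r)) :=
      hN.integrableOn_compact_subset Icc_subset_Ici_self isCompact_Icc
    have h2 : IntervalIntegrable N volume 0 (2 * r) :=
      (intervalIntegrable_iff_integrableOn_Icc_of_le (by linarith)).2 h1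
    have h3 := h2.comp_mul_left (c := 2)
    rw [zero_div, mul_div_cancel_left₀ r two_ne_zero] at h3
    exact (intervalIntegrable_iff_integrableOn_Ioc_of_le hr.le).1 h3
  obtain ⟨R₁, hR₁, hcap₁⟩ := hΨ₁.exists_capacity_pos hd hΨ₁m hr hrρ hw₁.1 hNr hA
  -- In `M₂` the codimension is one, so the lower bound on the weight suffices and the constant
  -- function 1 takes the place of `N`.
  obtain ⟨A₂, hA₂⟩ := hΨ₂.exists_shell_bound_of_le (r := ρ₂ / 2) (by omega)
    (by linarith) hc hcw
  obtain ⟨R₂, hR₂, hcap₂⟩ := hΨ₂.exists_capacity_pos (by omega) hΨ₂m (by linarith)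
    (by linarith) hw₂.1 (g := fun _ => 1) (integrableOn_const (by simp)) hA₂
  -- Each positivity statement holds for every smaller radius as well, so one `R` serves both
  -- manifolds.
  refine ⟨min R₁ R₂, lt_min hR₁ hR₂, ?_, ?_⟩
  · rw [GluedManifold.preimage_tube hι₁.isEmbedding.injective]
    exact hcap₁ _ (min_le_left _ _)
  · rw [GluedManifold.tube_swap, GluedManifold.preimage_tube hι₂.isEmbedding.injective,
      GluedManifold.inter_swap (ι₁ := ι₂)]
    exact hcap₂ _ (min_le_right _ _)
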